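/- Let $x\mapsto[x]$ be a non-zero odd entire function on $\mathbb C$ such that, for all $x,y,u,v\in\mathbb C$, $$[x+y][x-y][u+v][u-v]+[x+v][x-v][y+u][y-u]=[x+u][x-u][y+v][y-v].$$ Let $\delta,\kappa\in\mathbb C$ satisfy $[n\delta]\neq0$ and $[n\kappa]\neq 0$ for all integers $n>0$, and let $m,r\ge 0$ be integers. Write $\langle n\rangle=\{1,\dots,n\}$ and $[x;\delta]_k=[x][x+\delta]\cdots[x+(k-1)\delta]$. For variables $x=(x_1,\dots,x_m)$, $y=(y_1,\dots,y_r)$, $\mu\in\mathbb Z_{\ge0}^m$ and $I\subseteq\langle r\rangle$ with complement $I^c=\langle r\rangle\setminus I$, put $|\mu|=\mu_1+\dots+\mu_m$ and $$\begin{aligned}C_{\mu,I}(x;y;\delta,\kappa)={}&(-1)^{|I|}\prod_{1\le i<j\le m}\frac{[x_i-x_j+(\mu_i-\mu_j)\delta]}{[x_i-x_j]}\prod_{i\in I,\,j\in I^c}\frac{[y_i-y_j-\delta]}{[y_i-y_j]}\prod_{i,j=1}^m\frac{[x_i-x_j+\kappa;\delta]_{\mu_i}}{[x_i-x_j+\delta;\delta]_{\mu_i}}\\&\times\prod_{i=1}^m\left(\prod_{j\in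 I}\frac{[x_i-y_j-\kappa]}{[x_i-y_j+\mu_i\delta]}\prod_{j\in I^c}\frac{[x_i-y_j-\delta]}{[x_i-y_j+(\mu_i-1)\delta]}\right).\end{aligned}$$ The same formula with the roles of $x$ and $y$ (and of $m$ and $r$) interchanged and with parameters $(-\kappa,-\delta)$ in place of $(\delta,\kappa)$ defines $C_{\mu,I}(y;x;-\kappa,-\delta)$ for $\mu\in\mathbb Z_{\geq 0}^r$, $I\subseteq\langle m\rangle$. For $k\in\mathbb Z_{\ge0}$, define the following $\mathbb C$-linear difference operators on meromorphic functions of $(x,y)\in\mathbb C^{m+r}$: $$H_{m,r}^{(k)}=\sum_{\substack{\mu\in\mathbb Z_{\ge0}^m,\ I\subseteq\langle r\rangle\\|\mu|+|I|=k}}C_{\mu,I}(x;y;\delta,\kappa)\,T_x^{\delta\mu}T_y^{-\kappa I},\qquad D_{m,r}^{(k)}=\sum_{\substack{\mu\in\mathbb Z_{\ge0}^r,\ I\subseteq\langle m\rangle\\|\mu|+|I|=k}}C_{\mu,I}(y;x;-\kappa,-\delta)\,T_x^{\delta I}T_y^{-\kappa\mu}.$$ Here $T_x^{\delta\mu}f(x,y)=f(x_1+\mu_1\delta,\dots,x_m+\mu_m\delta,\,y)$,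 similarly for $T_y$, and a subset $I$ is identified with its indicator vector. Then for every $l\in\mathbb Z_{\ge0}$ the operator $H_{m,r}^{(l)}$ lies in the (unital) $\mathbb C$-algebra generated by the operators $D_{m,r}^{(k)}$, $1\le k\le l$. In particular, $[D_{m,r}^{(k)},H_{m,r}^{(l)}]=D_{m,r}^{(k)}H_{m,r}^{(l)}-H_{m,r}^{(l)}D_{m,r}^{(k)}=0$ for all $k,l\in\mathbb Z_{\ge0}$. -/

import Mathlib

noncomputable section

/-- A non-zero odd entire function `x ↦ [x]` of one complex variable that satisfies the
three-term addition formula (Weierstrass sigma function, sine, hyperbolic sine, identity). -/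
structure SigmaFunction where
  toFun : ℂ → ℂ
  entire : Differentiable ℂ toFun
  odd : ∀ x, toFun (-x) = -toFun x
  ne_zero : ∃ x, toFun x ≠ 0
  addition : ∀ x y u v : ℂ,
    toFun (x + y) * toFun (x - y) * toFun (u + v) * toFun (u - v)
      + toFun (x + v) * toFun (x - v) * toFun (y + u) * toFun (y - u)
      = toFun (x + u) * toFun (x - u) * toFun (y + v) * toFun (y - v)

/-- The ℂ-algebra of entire functions on `ℂ^ι`. -/
def entireSubalgebra (ι : Type) [Fintype ι] : Subalgebra ℂ ((ι → ℂ) → ℂ) where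
  carrier := {f | AnalyticOnNhd ℂ f Set.univ}
  mul_mem' hf hg := hf.mul hg
  add_mem' hf hg := hf.add hg
  algebraMap_mem' c := by
    intro p _
    exact (analyticAt_const : AnalyticAt ℂ (fun _ : ι → ℂ => c) p)

abbrev Entire (ι : Type) [Fintype ι] : Type := entireSubalgebra ι

instance Entire.instIsDomain (ι : Type) [Fintype ι] : IsDomain (Entire ι) := by
  have hdiv : NoZeroDivisors (Entire ι) := by
    refine ⟨fun {f g} h => ?_⟩
    by_cases hf : f = 0
    · exact Or.inl hf
    right
    obtain ⟨p, hp⟩ : ∃ p, f.1 p ≠ 0 := by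
      by_contra hcon
      push Not at hcon
      exact hf (Subtype.ext (funext hcon))
    have hfp : AnalyticAt ℂ f.1 p := f.2 p (Set.mem_univ p)
    have hev : g.1 =ᶠ[nhds p] 0 := by
      filter_upwards [hfp.continuousAt.eventually_ne hp] with q hq
      have hmul : f.1 q * g.1 q = 0 := congrFun (congrArg Subtype.val h) q
      simpa [hq] using hmul
    have hall := AnalyticOnNhd.eqOn_zero_of_preconnected_of_eventuallyEq_zero g.2
      isPreconnected_univ (Set.mem_univ p) hev
    exact Subtype.ext (funext fun q => hall (Set.mem_univ q))
  exact NoZeroDivisors.to_isDomain _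

/-- The field of meromorphic functions on `ℂ^ι`. Every meromorphic function on `ℂ^ι` is a
global quotient of two entire functions (the Poincaré problem is solvable on `ℂ^ι`), so
this is the field of fractions of the ring of entire functions. -/
abbrev Mero (ι : Type) [Fintype ι] : Type := FractionRing (Entire ι)

/-- Translation `f ↦ f (· + v)` on entire functions. -/
def Entire.shift {ι : Type} [Fintype ι] (v : ι → ℂ) : Entire ι ≃ₐ[ℂ] Entire ι where
  toFun f := ⟨fun p => f.1 (p + v), fun p _ =>
    (f.2 (p + v) (Set.mem_univ _)).comp_of_eq (analyticAt_id.add analyticAt_const) rfl⟩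
  invFun f := ⟨fun p => f.1 (p - v), fun p _ =>
    (f.2 (p - v) (Set.mem_univ _)).comp_of_eq (analyticAt_id.sub analyticAt_const) rfl⟩
  left_inv f := by ext p; simp
  right_inv f := by ext p; simp
  map_mul' _ _ := rfl
  map_add' _ _ := rfl
  commutes' _ := rfl

/-- The shift operator `f ↦ f (· + v)` on meromorphic functions, as a ℂ-linear operator. -/
def Mero.shift {ι : Type} [Fintype ι] (v : ι → ℂ) : Module.End ℂ (Mero ι) :=
  (IsFractionRing.fieldEquivOfAlgEquiv ℂ (Mero ι) (Mero ι) (Entire.shift v)).toLinearMap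

/-- The coordinate function `p ↦ p i`. -/
def Entire.coord {ι : Type} [Fintype ι] (i : ι) : Entire ι :=
  ⟨fun p => p i, fun p _ => (ContinuousLinearMap.proj (R := ℂ) (φ := fun _ : ι => ℂ) i).analyticAt p⟩

/-- The function `p ↦ [f p]`, for `f` entire, as a meromorphic function. -/
def SigmaFunction.br (s : SigmaFunction) {ι : Type} [Fintype ι] (f : Entire ι) : Mero ι :=
  algebraMap (Entire ι) (Mero ι)
    ⟨fun p => s.toFun (f.1 p), fun p hp =>
      (s.entire.analyticAt (f.1 p)).comp (f.2 p hp)⟩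

/-- The shifted factorial `[f; δ]_k = [f] [f + δ] ⋯ [f + (k - 1) δ]`. -/
def SigmaFunction.brFactorial (s : SigmaFunction) {ι : Type} [Fintype ι] (δ : ℂ)
    (f : Entire ι) (k : ℕ) : Mero ι :=
  ∏ a ∈ Finset.range k, s.br (f + algebraMap ℂ (Entire ι) (a * δ))

/-- The coefficient `C_{μ,I}(x; y; δ, κ)`, a meromorphic function, where
`x = (x_1, …, x_m)` and `y = (y_1, …, y_r)` are tuples of entire functions. -/
def deformedCoeff (s : SigmaFunction) {ι : Type} [Fintype ι] {m r : ℕ}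
    (x : Fin m → Entire ι) (y : Fin r → Entire ι) (δ κ : ℂ)
    (μ : Fin m → ℕ) (I : Finset (Fin r)) : Mero ι :=
  let c : ℂ → Entire ι := algebraMap ℂ (Entire ι)
  (-1) ^ I.card
    * (∏ i : Fin m, ∏ j ∈ Finset.Ioi i,
        s.br (x i - x j + c (((μ i : ℂ) - (μ j : ℂ)) * δ)) / s.br (x i - x j))
    * (∏ i ∈ I, ∏ j ∈ Iᶜ, s.br (y i - y j - c δ) / s.br (y i - y j))
    * (∏ i : Fin m, ∏ j : Fin m,
        s.brFactorial δ (x i - x j + c κ) (μ i) / s.brFactorial δ (x i - x j + c δ) (μ i))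
    * ∏ i : Fin m,
        ((∏ j ∈ I, s.br (x i - y j - c κ) / s.br (x i - y j + c ((μ i : ℂ) * δ)))
          * ∏ j ∈ Iᶜ, s.br (x i - y j - c δ) / s.br (x i - y j + c (((μ i : ℂ) - 1) * δ)))

/-- The pairs `(μ, I)` with `μ ∈ ℕ^m`, `I ⊆ {1, …, r}` and `|μ| + |I| = k`. -/
def deformedIndex (m r k : ℕ) : Finset ((Fin m → ℕ) × Finset (Fin r)) :=
  (Finset.HasAntidiagonal.antidiagonal k).biUnion fun p =>
    Finset.piAntidiag Finset.univ p.1 ×ˢ Finset.powersetCard p.2 Finset.univ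

theorem mem_deformedIndex {m r k : ℕ} (μ : Fin m → ℕ) (I : Finset (Fin r)) :
    (μ, I) ∈ deformedIndex m r k ↔ ∑ i, μ i + I.card = k := by
  simp [deformedIndex]

/-- The variables `x_1, …, x_m` among `(x_1, …, x_m, y_1, …, y_r)`. -/
def xVar (m r : ℕ) (i : Fin m) : Entire (Fin m ⊕ Fin r) := Entire.coord (Sum.inl i)

/-- The variables `y_1, …, y_r` among `(x_1, …, x_m, y_1, …, y_r)`. -/
def yVar (m r : ℕ) (j : Fin r) : Entire (Fin m ⊕ Fin r) := Entire.coord (Sum.inr j)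

/-- The operator `H_{m,r}^{(k)} = ∑_{|μ|+|I|=k} C_{μ,I}(x; y; δ, κ) T_x^{δ μ} T_y^{-κ I}` on
meromorphic functions of `(x, y)`. -/
def opH (s : SigmaFunction) (δ κ : ℂ) (m r k : ℕ) : Module.End ℂ (Mero (Fin m ⊕ Fin r)) :=
  ∑ p ∈ deformedIndex m r k,
    LinearMap.mulLeft ℂ (deformedCoeff s (xVar m r) (yVar m r) δ κ p.1 p.2)
      * Mero.shift (Sum.elim (fun i => δ * (p.1 i : ℂ)) (fun j => if j ∈ p.2 then -κ else 0))

/-- The operator `D_{m,r}^{(k)} = ∑_{|μ|+|I|=k} C_{μ,I}(y; x; -κ, -δ) T_x^{δ I} T_y^{-κ μ}` on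
meromorphic functions of `(x, y)`; here `μ ∈ ℕ^r` and `I ⊆ {1, …, m}`. -/
def opD (s : SigmaFunction) (δ κ : ℂ) (m r k : ℕ) : Module.End ℂ (Mero (Fin m ⊕ Fin r)) :=
  ∑ p ∈ deformedIndex r m k,
    LinearMap.mulLeft ℂ (deformedCoeff s (yVar m r) (xVar m r) (-κ) (-δ) p.1 p.2)
      * Mero.shift (Sum.elim (fun i => if i ∈ p.2 then δ else 0) (fun j => -κ * (p.1 j : ℂ)))

end

/-!
Both families of operators are sums of weighted shifts, so every identity between products of them
is a family of identities between weights, one for each total shift. Two such families are needed.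

* *The operators `D^{(k)}` commute.* The product of two weights is, up to a factor that depends only
  on the total shift, a product of two-body factors `[z - a] [z + a - b] / ([z] [z - b])` over
  `T × (σ \ T)`, where `σ` consists of strings of points `x_i + n δ` and of some of the `y_j`
  (`coeffVal_mul_coeffVal`). Subsets `T` that are not initial in each string contribute zero, so the
  total weight is the sum over all `T ⊆ σ` of given size, and commutation is the source identity
  `exchSum_neg_neg`: this sum is invariant under `z ↦ -z`. These lemmas are stated for the
  weights of `H^{(k)}`; those of `D^{(k)}` arise by exchanging `(x, δ)` with `(y, -κ)`.
* *The Wronski relation* `∑_{k + l = K} [k κ + l δ] D^{(k)} H^{(l)} = 0` for `K > 0`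
  (`sum_smul_opD_mul_opH`). Here a product of two weights is a summand of the alternating identity
  `sum_altTerm_eq_zero` (`wronski_term`), and the superfluous summands vanish.

Since `D^{(0)} = H^{(0)} = 1` and `[l δ] ≠ 0`, the Wronski relation expresses `H^{(l)}` recursively
through `H^{(l - k)}` and `D^{(k)}` with `1 ≤ k ≤ l`; hence `H^{(l)}` lies in the algebra generated
by these `D^{(k)}`, and it commutes with all `D^{(k)}` because they commute with each other.

The two identities of elliptic functions are proved by interpolation. The addition formula gives the
partial fraction identity `partial_fractions`, which says that a linear combination of products
`∏_{i=1}^n [z - c_i]` with fixed `∑ c_i` is determined by its values at `n` points unless the sum of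
these points is exceptional (`IsTheta.eq_zero`), and up to a constant otherwise
(`IsTheta.mul_prod_eq`). Each identity is checked by induction at sufficiently many points.

The factorizations divide by values `[a δ + b κ]`, which the hypotheses do not force to be non-zero.
They are applied with one of the two parameters replaced by a generic one, which is any but
countably many, and the identities between total weights extend by continuity, because the
denominators of the weights themselves only involve `[n δ]`, `[n κ]` and shifted differences of
variables. Finally an identity between meromorphic functions is tested at points whose coordinates
are generic (`Mero.eq_zero_of_hasVal_zero`).
-/

open Filter Topology

/-! ### The sigma function, partial fractions and theta functions -/

namespace SigmaFunction

instance : CoeFun SigmaFunction (fun _ => ℂ → ℂ) := ⟨toFun⟩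

variable (s : SigmaFunction)

theorem map_neg (x : ℂ) : s (-x) = -s x := s.odd x

theorem map_zero : s 0 = 0 := by
  have h := s.odd 0
  rw [neg_zero] at h
  linear_combination h / 2

theorem map_sub_comm (x y : ℂ) : s (x - y) = -s (y - x) := by
  rw [← s.map_neg, neg_sub]

theorem continuous : Continuous s := s.entire.continuous

/-- The zeros of a non-zero entire function form a discrete closed set. -/
theorem countable_zeros : {z | s z = 0}.Countable := by
  obtain ⟨x, hx⟩ := s.ne_zero
  have han : AnalyticOnNhd ℂ s.toFun Set.univ := fun z _ => s.entire.analyticAt z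
  have h := han.preimage_zero_mem_codiscrete hx
  have hd : IsDiscrete {z | s z = 0} := by
    have := (mem_codiscrete'.1 h).2
    simpa [Set.preimage, Set.compl_def] using this
  have := hd.to_subtype
  exact Set.countable_coe_iff.1 (TopologicalSpace.separableSpace_iff_countable.1 inferInstance)

theorem countable_zeros_affine (a : ℂ) {b : ℂ} (hb : b ≠ 0) :
    {t | s (a + t * b) = 0}.Countable := by
  refine (s.countable_zeros.preimage (f := fun t => a + t * b) ?_)
  intro t t' h
  simpa [hb] using h

theorem eventually_ne_zero (a : ℂ) {b : ℂ} (hb : b ≠ 0) :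
    ∀ᶠ t in 𝓝[≠] (0 : ℂ), s (a + t * b) ≠ 0 := by
  have han : AnalyticOnNhd ℂ (fun t : ℂ => s (a + t * b)) Set.univ := fun z _ =>
    (s.entire.comp (by fun_prop : Differentiable ℂ fun t : ℂ => a + t * b)).analyticAt z
  rcases (han 0 (Set.mem_univ _)).eventually_eq_zero_or_eventually_ne_zero with h | h
  · exfalso
    have := han.eqOn_zero_of_preconnected_of_eventuallyEq_zero isPreconnected_univ
      (Set.mem_univ 0) h
    obtain ⟨x, hx⟩ := s.ne_zero
    apply hx
    have h2 := this (Set.mem_univ ((x - a) / b))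
    simpa [hb] using h2
  · exact h

end SigmaFunction

theorem eq_zero_of_eventually_eq_zero {f : ℂ → ℂ} (hf : ContinuousAt f 0)
    (h : ∀ᶠ t in 𝓝[≠] (0 : ℂ), f t = 0) : f 0 = 0 := by
  have h1 : Tendsto f (𝓝[≠] 0) (𝓝 (f 0)) := hf.tendsto.mono_left nhdsWithin_le_nhds
  have h2 : Tendsto f (𝓝[≠] 0) (𝓝 0) := tendsto_const_nhds.congr' (h.mono fun _ ht => ht.symm)
  exact tendsto_nhds_unique h1 h2

namespace SigmaFunction

variable (s : SigmaFunction)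

/-- The addition formula as an interpolation in `z`: the left-hand product is expressed through two
products with the same sum of zeros that vanish at `p` and at `q` respectively. -/
theorem three_term (z b c p q : ℂ) :
    s (z - b) * s (z - c) * (s (p + q - (b + c)) * s (p - q)) =
      s (z - p) * s (z - (b + c - p)) * (s (q - c) * s (b - q))
        - s (z - q) * s (z - (b + c - q)) * (s (p - c) * s (b - p)) := by
  have h := s.addition (z - (b + c) / 2) ((b - c) / 2) (p - (b + c) / 2) (q - (b + c) / 2)
  rw [show z - (b + c) / 2 + (b - c) / 2 = z - c by ring,
    show z - (b + c) / 2 - (b - c) / 2 = z - b by ring,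
    show p - (b + c) / 2 + (q - (b + c) / 2) = p + q - (b + c) by ring,
    show p - (b + c) / 2 - (q - (b + c) / 2) = p - q by ring,
    show z - (b + c) / 2 + (q - (b + c) / 2) = z - (b + c - q) by ring,
    show z - (b + c) / 2 - (q - (b + c) / 2) = z - q by ring,
    show (b - c) / 2 + (p - (b + c) / 2) = p - c by ring,
    show (b - c) / 2 - (p - (b + c) / 2) = b - p by ring,
    show z - (b + c) / 2 + (p - (b + c) / 2) = z - (b + c - p) by ring,
    show z - (b + c) / 2 - (p - (b + c) / 2) = z - p by ring,
    show (b - c) / 2 + (q - (b + c) / 2) = q - c by ring,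
    show (b - c) / 2 - (q - (b + c) / 2) = b - q by ring] at h
  linear_combination h

/-- The function `z ↦ ∏_{c ∈ b} [z - c]`. -/
def thetaProd (b : Multiset ℂ) (z : ℂ) : ℂ := (b.map fun c => s (z - c)).prod

@[simp] theorem thetaProd_zero (z : ℂ) : s.thetaProd 0 z = 1 := by simp [thetaProd]

@[simp] theorem thetaProd_cons (c : ℂ) (b : Multiset ℂ) (z : ℂ) :
    s.thetaProd (c ::ₘ b) z = s (z - c) * s.thetaProd b z := by simp [thetaProd]

theorem thetaProd_add (b c : Multiset ℂ) (z : ℂ) :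
    s.thetaProd (b + c) z = s.thetaProd b z * s.thetaProd c z := by simp [thetaProd]

/-- The points of `σ` are pairwise distinct modulo the zeros of the sigma function. -/
def Separated (σ : Finset ℂ) : Prop := ∀ i ∈ σ, ∀ j ∈ σ, i ≠ j → s (i - j) ≠ 0

theorem Separated.mono {s : SigmaFunction} {σ τ : Finset ℂ} (h : s.Separated σ) (hτ : τ ⊆ σ) :
    s.Separated τ := fun i hi j hj => h i (hτ hi) j (hτ hj)

/-- Multiplying the numerator of a partial fraction sum by `[z - p]` removes the node `p`. -/
theorem sum_cancel_node {s : SigmaFunction} {σ : Finset ℂ} (h : s.Separated σ) {p : ℂ}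
    (hp : p ∈ σ) (f : ℂ → ℂ) :
    ∑ i ∈ σ, s (i - p) * f i / ∏ j ∈ σ.erase i, s (i - j) =
      ∑ i ∈ σ.erase p, f i / ∏ j ∈ (σ.erase p).erase i, s (i - j) := by
  rw [← Finset.add_sum_erase σ _ hp, sub_self, s.map_zero, zero_mul, zero_div, zero_add]
  refine Finset.sum_congr rfl fun i hi => ?_
  have hip := Finset.ne_of_mem_erase hi
  have hi' := Finset.mem_of_mem_erase hi
  have h0 := h i hi' p hp hip
  rw [← Finset.mul_prod_erase (σ.erase i) _ (Finset.mem_erase.2 ⟨hip.symm, hp⟩),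
    Finset.erase_right_comm, mul_div_mul_left _ _ h0]

/-- The partial fraction identity. By `three_term`, a numerator is a combination of numerators with
a zero at one of the nodes `p`, `q`, and for those the sum has fewer nodes. This needs `p + q`
and `b₁ + b₂` to differ modulo zeros, which is achieved by perturbing `b₂` and `b₃`. -/
theorem partial_fractions (n : ℕ) : ∀ (σ : Finset ℂ) (b : Multiset ℂ), σ.card = n + 1 →
    b.card = n + 1 → b.sum = ∑ i ∈ σ, i → s.Separated σ →
    ∑ i ∈ σ, s.thetaProd b i / ∏ j ∈ σ.erase i, s (i - j) = 0 := by
  induction n with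
  | zero =>
    intro σ b hσ hb hsum _
    obtain ⟨p, rfl⟩ := Finset.card_eq_one.1 hσ
    obtain ⟨c, rfl⟩ := Multiset.card_eq_one.1 hb
    simp only [Multiset.sum_singleton, Finset.sum_singleton] at hsum
    subst hsum
    simp [thetaProd, s.map_zero]
  | succ n ih =>
    intro σ b hσ hb hsum hsep
    obtain ⟨p, hp⟩ : σ.Nonempty := Finset.card_pos.1 (by omega)
    obtain ⟨q, hq⟩ : (σ.erase p).Nonempty :=
      Finset.card_pos.1 (by rw [Finset.card_erase_of_mem hp]; omega)
    have hqp := Finset.ne_of_mem_erase hq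
    have hq' := Finset.mem_of_mem_erase hq
    obtain ⟨b₁, b', rfl⟩ : ∃ c b', b = c ::ₘ b' := by
      obtain ⟨c, hc⟩ := Multiset.card_pos_iff_exists_mem.1 (by omega : 0 < b.card)
      exact ⟨c, Multiset.exists_cons_of_mem hc⟩
    rw [Multiset.card_cons] at hb
    obtain ⟨b₂, b'', rfl⟩ : ∃ c b'', b' = c ::ₘ b'' := by
      obtain ⟨c, hc⟩ := Multiset.card_pos_iff_exists_mem.1 (by omega : 0 < b'.card)
      exact ⟨c, Multiset.exists_cons_of_mem hc⟩
    rw [Multiset.card_cons] at hb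
    -- the inductive step, as long as `p + q` and `b₁ + b₂` differ modulo zeros
    have key : ∀ (c₁ c₂ : ℂ) (c : Multiset ℂ), c.card = n → c₁ + c₂ + c.sum = ∑ i ∈ σ, i →
        s (p + q - (c₁ + c₂)) ≠ 0 →
        ∑ i ∈ σ, s.thetaProd (c₁ ::ₘ c₂ ::ₘ c) i / ∏ j ∈ σ.erase i, s (i - j) = 0 := by
      intro c₁ c₂ c hc hcs hne
      have hstep : ∀ r ∈ σ, ∑ i ∈ σ, s (i - r) * s.thetaProd ((c₁ + c₂ - r) ::ₘ c) i /
          ∏ j ∈ σ.erase i, s (i - j) = 0 := by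
        intro r hr
        rw [sum_cancel_node hsep hr]
        refine ih _ _ (by rw [Finset.card_erase_of_mem hr]; omega) (by simp [hc]) ?_
          (hsep.mono (Finset.erase_subset _ _))
        rw [Multiset.sum_cons, ← Finset.add_sum_erase σ _ hr] at *
        linear_combination hcs
      have hK : s (p + q - (c₁ + c₂)) * s (p - q) ≠ 0 :=
        mul_ne_zero hne (hsep p hp q hq' hqp.symm)
      refine (mul_eq_zero.1 ?_).resolve_right hK
      have e := congrArg₂ (fun u v => s (q - c₂) * s (c₁ - q) * u - s (p - c₂) * s (c₁ - p) * v)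
        (hstep p hp) (hstep q hq')
      simp only [mul_zero, sub_zero] at e
      rw [← e, Finset.mul_sum, Finset.mul_sum, ← Finset.sum_sub_distrib, Finset.sum_mul]
      refine Finset.sum_congr rfl fun i _ => ?_
      simp only [thetaProd_cons]
      have h3 := s.three_term i c₁ c₂ p q
      linear_combination (s.thetaProd c i / ∏ j ∈ σ.erase i, s (i - j)) * h3
    rcases Nat.eq_zero_or_pos n with rfl | hn
    · obtain rfl : b'' = 0 := Multiset.card_eq_zero.1 (by omega)
      have hσ2 : σ = {p, q} := by
        symm
        refine Finset.eq_of_subset_of_card_le (by simp [Finset.insert_subset_iff, hp, hq']) ?_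
        rw [Finset.card_pair hqp.symm, hσ]
      subst hσ2
      have h1 : s (q - p) ≠ 0 := hsep q hq' p hp hqp
      rw [Finset.sum_pair hqp.symm] at hsum ⊢
      have e1 : ({p, q} : Finset ℂ).erase p = {q} := by
        ext x; simp only [Finset.mem_erase, Finset.mem_insert, Finset.mem_singleton]; grind
      have e2 : ({p, q} : Finset ℂ).erase q = {p} := by
        ext x; simp only [Finset.mem_erase, Finset.mem_insert, Finset.mem_singleton]; grind
      simp only [Multiset.sum_cons, Multiset.sum_zero, add_zero] at hsum
      rw [e1, e2, Finset.prod_singleton, Finset.prod_singleton, s.map_sub_comm p q]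
      simp only [thetaProd_cons, thetaProd_zero, mul_one]
      rw [show p - b₁ = b₂ - q by linear_combination -hsum,
        show p - b₂ = b₁ - q by linear_combination -hsum, s.map_sub_comm q b₁,
        s.map_sub_comm q b₂]
      field_simp
      ring
    · obtain ⟨b₃, b₄, rfl⟩ : ∃ c b₄, b'' = c ::ₘ b₄ := by
        obtain ⟨c, hc⟩ := Multiset.card_pos_iff_exists_mem.1 (by omega : 0 < b''.card)
        exact ⟨c, Multiset.exists_cons_of_mem hc⟩
      rw [Multiset.card_cons] at hb
      simp only [Multiset.sum_cons] at hsum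
      have := eq_zero_of_eventually_eq_zero (f := fun t =>
        ∑ i ∈ σ, s.thetaProd (b₁ ::ₘ (b₂ + t) ::ₘ (b₃ - t) ::ₘ b₄) i /
          ∏ j ∈ σ.erase i, s (i - j)) ?_ ?_
      · simpa using this
      · have := s.continuous
        simp only [thetaProd_cons]
        fun_prop
      · filter_upwards [s.eventually_ne_zero (p + q - (b₁ + b₂)) (b := -1) (by norm_num)] with t ht
        refine key b₁ (b₂ + t) _ (by simp; omega) (by simp; linear_combination hsum) ?_
        convert ht using 2
        ring

/-- `f` satisfies the interpolation formula of theta functions of degree `n` and characteristic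
`t`, that is, of linear combinations of the functions `z ↦ ∏_{i=1}^n [z - c_i]`, `∑ c_i = t`. -/
def IsTheta (n : ℕ) (t : ℂ) (f : ℂ → ℂ) : Prop :=
  ∀ σ : Finset ℂ, σ.card = n + 1 → s.Separated σ →
    ∑ i ∈ σ, f i * s (i - (∑ j ∈ σ, j - t)) / ∏ j ∈ σ.erase i, s (i - j) = 0

variable {s} {n : ℕ} {t : ℂ}

theorem IsTheta.const_mul {f : ℂ → ℂ} (hf : s.IsTheta n t f) (c : ℂ) :
    s.IsTheta n t (fun z => c * f z) := by
  intro σ hσ hs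
  have h := congrArg (c * ·) (hf σ hσ hs)
  simp only [mul_zero, Finset.mul_sum] at h
  rw [← h]
  exact Finset.sum_congr rfl fun i _ => by ring

theorem IsTheta.add {f g : ℂ → ℂ} (hf : s.IsTheta n t f) (hg : s.IsTheta n t g) :
    s.IsTheta n t (fun z => f z + g z) := by
  intro σ hσ hs
  have h := congrArg₂ (· + ·) (hf σ hσ hs) (hg σ hσ hs)
  simp only [add_zero, ← Finset.sum_add_distrib] at h
  rw [← h]
  exact Finset.sum_congr rfl fun i _ => by ring

theorem IsTheta.sum {α : Type*} {A : Finset α} {f : α → ℂ → ℂ}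
    (hf : ∀ a ∈ A, s.IsTheta n t (f a)) : s.IsTheta n t (fun z => ∑ a ∈ A, f a z) := by
  intro σ hσ hs
  simp only [Finset.sum_mul, Finset.sum_div]
  rw [Finset.sum_comm]
  exact Finset.sum_eq_zero fun a ha => hf a ha σ hσ hs

/-- A theta function of degree `n` that vanishes at `n` points whose sum is not its
characteristic is zero. -/
theorem IsTheta.eq_zero {f : ℂ → ℂ} (hf : s.IsTheta n t f) {P : Finset ℂ} (hP : P.card = n)
    (hs : s.Separated P) (h0 : ∀ p ∈ P, f p = 0) (ht : s (∑ p ∈ P, p - t) ≠ 0) {z : ℂ}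
    (hz : ∀ p ∈ P, s (z - p) ≠ 0) : f z = 0 := by
  have hzP : z ∉ P := fun h => hz z h (by rw [sub_self, s.map_zero])
  have h := hf (insert z P) (by rw [Finset.card_insert_of_notMem hzP, hP]) ?_
  · rw [Finset.sum_insert hzP, Finset.sum_insert hzP, Finset.sum_eq_zero (s := P)
      (f := fun i => f i * s (i - (z + ∑ p ∈ P, p - t)) / ∏ j ∈ (insert z P).erase i, s (i - j)),
      add_zero, Finset.erase_insert hzP, div_eq_zero_iff, mul_eq_zero] at h
    · rcases h with (h | h) | h
      · exact h
      · rw [show z - (z + ∑ p ∈ P, p - t) = -(∑ p ∈ P, p - t) by ring, s.map_neg,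
          neg_eq_zero] at h
        exact absurd h ht
      · exact absurd h (Finset.prod_ne_zero_iff.2 hz)
    · intro p hp
      rw [h0 p hp, zero_mul, zero_div]
  · intro i hi j hj hij
    rcases Finset.mem_insert.1 hi with rfl | hi <;> rcases Finset.mem_insert.1 hj with rfl | hj
    · exact absurd rfl hij
    · exact hz j hj
    · rw [s.map_sub_comm, neg_ne_zero]; exact hz _ ‹_›
    · exact hs i hi j hj hij

/-- A theta function of degree `n` that vanishes at `n` points `p` whose sum is its
characteristic is a constant multiple of `∏ [z - p]`. -/
theorem IsTheta.mul_prod_eq {f : ℂ → ℂ} (hf : s.IsTheta n t f) {P : Finset ℂ} (hP : P.card = n)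
    (hn : 0 < n) (hs : s.Separated P) (h0 : ∀ p ∈ P, f p = 0) (ht : ∑ p ∈ P, p = t) {z w : ℂ}
    (hz : ∀ p ∈ P, s (z - p) ≠ 0) (hw : ∀ p ∈ P, s (w - p) ≠ 0) (hzw : s (z - w) ≠ 0) :
    f z * ∏ p ∈ P, s (w - p) = f w * ∏ p ∈ P, s (z - p) := by
  obtain ⟨p, hp⟩ : P.Nonempty := Finset.card_pos.1 (by omega)
  have hzP : z ∉ P := fun h => hz z h (by rw [sub_self, s.map_zero])
  have hwP : w ∉ P := fun h => hw w h (by rw [sub_self, s.map_zero])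
  have hne : z ≠ w := fun h => hzw (by rw [h, sub_self, s.map_zero])
  set P' := P.erase p with hP'
  have hzP' : z ∉ P' := fun h => hzP (Finset.mem_of_mem_erase h)
  have hwP' : w ∉ P' := fun h => hwP (Finset.mem_of_mem_erase h)
  have hzi : z ∉ insert w P' := by simp [hne, hzP']
  have hwz : w ∉ insert z P' := by simp [hne.symm, hwP']
  have h := hf (insert z (insert w P')) (by
    rw [Finset.card_insert_of_notMem hzi, Finset.card_insert_of_notMem hwP',
      Finset.card_erase_of_mem hp]; omega) ?_
  · have hp0 : ∀ i ∈ P', f i = 0 := fun i hi => h0 i (Finset.mem_of_mem_erase hi)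
    rw [Finset.sum_insert hzi, Finset.sum_insert hzi, Finset.sum_insert hwP',
      Finset.sum_insert hwP', Finset.erase_insert hzi, Finset.insert_comm,
      Finset.erase_insert hwz, Finset.prod_insert hwP', Finset.prod_insert hzP',
      Finset.sum_eq_zero (s := P') (f := fun i => f i * s (i - (z + (w + ∑ i ∈ P', i) - t)) /
        ∏ j ∈ (insert w (insert z P')).erase i, s (i - j)), add_zero] at h
    · rw [← Finset.mul_prod_erase P _ hp, ← Finset.mul_prod_erase P _ hp, ← hP']
      have hsum := Finset.add_sum_erase P (fun i => i) hp
      rw [← hP', ht] at hsum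
      rw [show z - (z + (w + ∑ i ∈ P', i) - t) = p - w by linear_combination -hsum,
        show w - (z + (w + ∑ i ∈ P', i) - t) = p - z by linear_combination -hsum,
        s.map_sub_comm w z, s.map_sub_comm p w, s.map_sub_comm p z] at h
      have hz1 : ∏ i ∈ P', s (z - i) ≠ 0 :=
        Finset.prod_ne_zero_iff.2 fun i hi => hz i (Finset.mem_of_mem_erase hi)
      have hw1 : ∏ i ∈ P', s (w - i) ≠ 0 :=
        Finset.prod_ne_zero_iff.2 fun i hi => hw i (Finset.mem_of_mem_erase hi)
      field_simp at h
      linear_combination -h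
    · intro i hi
      rw [hp0 i hi, zero_mul, zero_div]
  · intro i hi j hj hij
    have hwz' : s (w - z) ≠ 0 := by rwa [s.map_sub_comm, neg_ne_zero]
    rcases Finset.mem_insert.1 hi with rfl | hi
    · rcases Finset.mem_insert.1 hj with rfl | hj
      · exact absurd rfl hij
      rcases Finset.mem_insert.1 hj with rfl | hj
      · exact hzw
      · exact hz j (Finset.mem_of_mem_erase hj)
    rcases Finset.mem_insert.1 hi with rfl | hi
    · rcases Finset.mem_insert.1 hj with rfl | hj
      · exact hwz'
      rcases Finset.mem_insert.1 hj with rfl | hj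
      · exact absurd rfl hij
      · exact hw j (Finset.mem_of_mem_erase hj)
    · have hi' := Finset.mem_of_mem_erase hi
      rcases Finset.mem_insert.1 hj with rfl | hj
      · rw [s.map_sub_comm, neg_ne_zero]; exact hz i hi'
      rcases Finset.mem_insert.1 hj with rfl | hj
      · rw [s.map_sub_comm, neg_ne_zero]; exact hw i hi'
      · exact hs i hi' j (Finset.mem_of_mem_erase hj) hij

variable (s) in
/-- `f` is a multiple of a product `z ↦ ∏_{i=1}^n [z - c_i]` with `∑ c_i = t`. -/
def IsThetaProd (n : ℕ) (t : ℂ) (f : ℂ → ℂ) : Prop :=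
  ∃ (a : ℂ) (b : Multiset ℂ), b.card = n ∧ b.sum = t ∧ ∀ z, f z = a * s.thetaProd b z

theorem IsThetaProd.isTheta {f : ℂ → ℂ} (hf : s.IsThetaProd n t f) : s.IsTheta n t f := by
  obtain ⟨a, b, hb, ht, hf⟩ := hf
  rw [funext hf]
  refine IsTheta.const_mul ?_ a
  intro σ hσ hs
  have := s.partial_fractions n σ ((∑ j ∈ σ, j - t) ::ₘ b) hσ (by simp [hb]) (by simp [ht]) hs
  simpa only [thetaProd_cons, mul_comm] using this

theorem isThetaProd_const (a : ℂ) : s.IsThetaProd 0 0 (fun _ => a) :=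
  ⟨a, 0, by simp, by simp, by simp⟩

theorem isThetaProd_sub (c : ℂ) : s.IsThetaProd 1 c (fun z => s (z - c)) :=
  ⟨1, {c}, by simp, by simp, by simp [thetaProd]⟩

theorem isThetaProd_sub' (c : ℂ) : s.IsThetaProd 1 c (fun z => s (c - z)) :=
  ⟨-1, {c}, by simp, by simp, fun z => by simp [thetaProd, s.map_sub_comm c z]⟩

theorem IsThetaProd.mul {f g : ℂ → ℂ} {m : ℕ} {u : ℂ} (hf : s.IsThetaProd n t f)
    (hg : s.IsThetaProd m u g) : s.IsThetaProd (n + m) (t + u) (fun z => f z * g z) := by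
  obtain ⟨a, b, hb, ht, hf⟩ := hf
  obtain ⟨a', b', hb', ht', hg⟩ := hg
  exact ⟨a * a', b + b', by simp [hb, hb'], by simp [ht, ht'], fun z => by
    beta_reduce; rw [hf, hg, thetaProd_add]; ring⟩

theorem IsThetaProd.const_mul {f : ℂ → ℂ} (hf : s.IsThetaProd n t f) (c : ℂ) :
    s.IsThetaProd n t (fun z => c * f z) := by
  simpa using (isThetaProd_const (s := s) c).mul hf

theorem IsThetaProd.prod {α : Type*} {A : Finset α} {f : α → ℂ → ℂ} {d : ℕ} {e : α → ℂ}
    (hf : ∀ a ∈ A, s.IsThetaProd d (e a) (f a)) :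
    s.IsThetaProd (A.card * d) (∑ a ∈ A, e a) (fun z => ∏ a ∈ A, f a z) := by
  classical
  induction A using Finset.induction_on with
  | empty => simpa using isThetaProd_const (s := s) 1
  | insert a A ha ih =>
    simp only [Finset.prod_insert ha, Finset.sum_insert ha, Finset.card_insert_of_notMem ha]
    have := (hf a (by simp)).mul (ih fun i hi => hf i (Finset.mem_insert_of_mem hi))
    rwa [show d + A.card * d = (A.card + 1) * d by ring] at this

theorem IsThetaProd.congr {f g : ℂ → ℂ} {m : ℕ} {u : ℂ} (hf : s.IsThetaProd n t f) (hn : n = m)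
    (ht : t = u) (hfg : ∀ z, g z = f z) : s.IsThetaProd m u g := by
  subst hn ht
  rwa [funext hfg]

end SigmaFunction

/-! ### An alternating elliptic identity -/

namespace SigmaFunction

variable (s : SigmaFunction) {ι : Type*} [DecidableEq ι]

/-- The summand of the alternating identity `sum_altTerm_eq_zero`. -/
noncomputable def altTerm (σ : Finset ι) (Q : ι → ℂ) (Z : Multiset ℂ) (η : ℂ) (S : Finset ι) : ℂ :=
  (-1) ^ S.card * s (∑ i ∈ σ, Q i - Z.sum + S.card * η)
    * (∏ i ∈ S, ∏ j ∈ σ \ S, s (Q i - Q j + η) / s (Q i - Q j))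
    * (∏ i ∈ S, s.thetaProd Z (Q i)) * ∏ i ∈ σ \ S, s.thetaProd Z (Q i + η)

variable {s}

theorem isThetaProd_altTerm {σ S : Finset ι} (hS : S ⊆ σ) (Q : ι → ℂ) (Z : Multiset ℂ) (η : ℂ) :
    s.IsThetaProd (σ.card + 1) (2 * ∑ i ∈ σ, Q i - Z.sum + σ.card * η)
      (fun v => s.altTerm σ Q (v ::ₘ Z) η S) := by
  have h1 := isThetaProd_sub' (s := s) (∑ i ∈ σ, Q i - Z.sum + S.card * η)
  have h2 := IsThetaProd.prod (A := S) fun i _ => isThetaProd_sub' (s := s) (Q i)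
  have h3 := IsThetaProd.prod (A := σ \ S) fun i _ => isThetaProd_sub' (s := s) (Q i + η)
  have h := ((h1.mul h2).mul h3).const_mul ((-1) ^ S.card
    * (∏ i ∈ S, ∏ j ∈ σ \ S, s (Q i - Q j + η) / s (Q i - Q j))
    * (∏ i ∈ S, s.thetaProd Z (Q i)) * ∏ i ∈ σ \ S, s.thetaProd Z (Q i + η))
  have hc := Finset.card_sdiff_add_card_eq_card hS
  refine h.congr (by omega) ?_ fun v => ?_
  · have hq := Finset.sum_sdiff hS (f := Q)
    rw [Finset.sum_add_distrib, Finset.sum_const, nsmul_eq_mul, ← hq, ← hc]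
    push_cast
    ring
  · simp only [altTerm, thetaProd_cons, Finset.prod_mul_distrib, Multiset.sum_cons]
    rw [show ∑ i ∈ σ, Q i - (v + Z.sum) + S.card * η = ∑ i ∈ σ, Q i - Z.sum + S.card * η - v by
      ring]
    ring

/-- If one of the `z` is `Q k`, then the summands with `k ∈ S` vanish, and the alternating sum
reduces to the one without `k`. -/
theorem sum_altTerm_insert {τ : Finset ι} {k : ι} (hk : k ∉ τ) (Q : ι → ℂ) (Z : Multiset ℂ)
    (η : ℂ) (hQ : ∀ i ∈ τ, s (Q i - Q k) ≠ 0) :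
    ∑ S ∈ (insert k τ).powerset, s.altTerm (insert k τ) Q (Q k ::ₘ Z) η S =
      s η * s.thetaProd Z (Q k + η) * (∏ i ∈ τ, s (Q i - Q k + η)) *
        ∑ S ∈ τ.powerset, s.altTerm τ Q Z η S := by
  rw [Finset.sum_powerset_insert hk, Finset.sum_eq_zero (s := τ.powerset)
    (f := fun S => s.altTerm (insert k τ) Q (Q k ::ₘ Z) η (insert k S)), add_zero, Finset.mul_sum]
  · refine Finset.sum_congr rfl fun S hS => ?_
    have hS := Finset.mem_powerset.1 hS
    have hkS : k ∉ S := fun h => hk (hS h)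
    have hd : insert k τ \ S = insert k (τ \ S) := Finset.insert_sdiff_of_notMem _ hkS
    have hkd : k ∉ τ \ S := fun h => hk (Finset.mem_sdiff.1 h).1
    have h1 : ∏ i ∈ S, s (Q i - Q k + η) / s (Q i - Q k) =
        (∏ i ∈ S, s (Q i - Q k + η)) / ∏ i ∈ S, s (Q i - Q k) := Finset.prod_div_distrib ..
    have h2 : ∏ i ∈ S, s (Q i - Q k) ≠ 0 := Finset.prod_ne_zero_iff.2 fun i hi => hQ i (hS hi)
    simp only [altTerm, hd, Finset.prod_insert hkd, thetaProd_cons, Finset.prod_mul_distrib,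
      Finset.sum_insert hk, Multiset.sum_cons, h1]
    rw [← Finset.prod_sdiff hS (f := fun i => s (Q i - Q k + η)),
      show Q k + η - Q k = η by ring,
      show Q k + ∑ i ∈ τ, Q i - (Q k + Z.sum) = ∑ i ∈ τ, Q i - Z.sum by ring]
    simp only [show ∀ i, Q i + η - Q k = Q i - Q k + η from fun i => by ring]
    field_simp
  · intro S hS
    have hS := Finset.mem_powerset.1 hS
    have hkS : k ∉ S := fun h => hk (hS h)
    simp [altTerm, Finset.prod_insert hkS, s.map_zero]

/-- If one of the `z` is `Q k + η`, then the summands with `k ∉ S` vanish, and the alternating sum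
reduces to the one without `k`. -/
theorem sum_altTerm_insert_add {τ : Finset ι} {k : ι} (hk : k ∉ τ) (Q : ι → ℂ) (Z : Multiset ℂ)
    (η : ℂ) (hQ : ∀ i ∈ τ, s (Q k - Q i) ≠ 0) :
    ∑ S ∈ (insert k τ).powerset, s.altTerm (insert k τ) Q ((Q k + η) ::ₘ Z) η S =
      s η * s.thetaProd Z (Q k) * (∏ i ∈ τ, s (Q i - Q k - η)) *
        ∑ S ∈ τ.powerset, s.altTerm τ Q Z η S := by
  rw [Finset.sum_powerset_insert hk, Finset.sum_eq_zero (s := τ.powerset)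
    (f := fun S => s.altTerm (insert k τ) Q ((Q k + η) ::ₘ Z) η S), zero_add, Finset.mul_sum]
  · refine Finset.sum_congr rfl fun S hS => ?_
    have hS := Finset.mem_powerset.1 hS
    have hkS : k ∉ S := fun h => hk (hS h)
    have hd : insert k τ \ insert k S = τ \ S := by
      rw [Finset.insert_sdiff_insert, Finset.sdiff_insert_of_notMem hk]
    have h1 : ∏ j ∈ τ \ S, s (Q k - Q j + η) / s (Q k - Q j) =
        (∏ j ∈ τ \ S, s (Q j - Q k - η)) / ∏ j ∈ τ \ S, s (Q j - Q k) := by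
      rw [← Finset.prod_div_distrib]
      refine Finset.prod_congr rfl fun j _ => ?_
      rw [s.map_sub_comm (Q k) (Q j), ← neg_div_neg_eq, neg_neg, ← s.map_neg]
      congr 2
      ring
    have h2 : ∏ j ∈ τ \ S, s (Q j - Q k) ≠ 0 := Finset.prod_ne_zero_iff.2 fun i hi => by
      rw [s.map_sub_comm, neg_ne_zero]
      exact hQ i (Finset.mem_sdiff.1 hi).1
    simp only [altTerm, hd, Finset.prod_insert hkS, thetaProd_cons, Finset.prod_mul_distrib,
      Finset.sum_insert hk, Multiset.sum_cons, h1, Finset.card_insert_of_notMem hkS, pow_succ]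
    rw [← Finset.prod_sdiff hS (f := fun i => s (Q i - Q k - η)),
      show Q k - (Q k + η) = -η by ring, s.map_neg,
      show Q k + ∑ i ∈ τ, Q i - (Q k + η + Z.sum) + ((S.card + 1 : ℕ) : ℂ) * η =
        ∑ i ∈ τ, Q i - Z.sum + S.card * η by push_cast; ring]
    simp only [show ∀ i, Q i + η - (Q k + η) = Q i - Q k from fun i => by ring,
      show ∀ i, Q i - (Q k + η) = Q i - Q k - η from fun i => by ring]
    field_simp
  · intro S hS
    have hS := Finset.mem_powerset.1 hS
    have hkS : k ∉ S := fun h => hk (hS h)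
    simp only [altTerm, Finset.insert_sdiff_of_notMem _ hkS]
    rw [Finset.prod_insert (a := k) (s := τ \ S) (fun h => hk (Finset.mem_sdiff.1 h).1)]
    simp [s.map_zero]

theorem continuous_thetaProd (f : ℂ → ℂ) (hf : Continuous f) (Z : Multiset ℂ) :
    Continuous fun t => s.thetaProd Z (f t) := by
  have := s.continuous
  induction Z using Multiset.induction_on with
  | empty => simpa using continuous_const
  | cons c Z ih => simp only [thetaProd_cons]; fun_prop

/-- In one of the `z`, the sum is a theta function of degree `|σ| + 1`. By induction it vanishes at
the points `Q i` and at `Q k + η`, and generically the sum of these points is not exceptional. -/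
theorem sum_altTerm_eq_zero (n : ℕ) : ∀ (σ : Finset ι) (Q : ι → ℂ) (Z : Multiset ℂ) (η : ℂ),
    σ.card = n + 1 → Z.card = n + 1 → (∀ i ∈ σ, ∀ j ∈ σ, i ≠ j → s (Q i - Q j) ≠ 0) →
    ∑ S ∈ σ.powerset, s.altTerm σ Q Z η S = 0 := by
  induction n with
  | zero =>
    intro σ Q Z η hσ hZ _
    obtain ⟨k, rfl⟩ := Finset.card_eq_one.1 hσ
    obtain ⟨z, rfl⟩ := Multiset.card_eq_one.1 hZ
    rw [← insert_empty_eq, Finset.sum_powerset_insert (Finset.notMem_empty k)]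
    simp [altTerm, thetaProd]
    ring_nf
  | succ n ih =>
    intro σ Q Z η hσ hZ hQ
    obtain ⟨z, Z, rfl⟩ : ∃ c Z', Z = c ::ₘ Z' := by
      obtain ⟨c, hc⟩ := Multiset.card_pos_iff_exists_mem.1 (by omega : 0 < Z.card)
      exact ⟨c, Multiset.exists_cons_of_mem hc⟩
    rw [Multiset.card_cons] at hZ
    obtain ⟨k, hk⟩ : σ.Nonempty := Finset.card_pos.1 (by omega)
    -- the identity vanishes by induction if one of the `z` is `Q i` or `Q i + η`
    have hzero1 : ∀ i ∈ σ, ∀ η, ∑ S ∈ σ.powerset, s.altTerm σ Q (Q i ::ₘ Z) η S = 0 := by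
      intro i hi η
      have := sum_altTerm_insert (s := s) (Finset.notMem_erase i σ) Q Z η fun j hj =>
        hQ j (Finset.mem_of_mem_erase hj) i hi (Finset.ne_of_mem_erase hj)
      rw [Finset.insert_erase hi] at this
      rw [this, ih _ Q Z η (by rw [Finset.card_erase_of_mem hi]; omega) (by omega), mul_zero]
      exact fun a ha b hb => hQ a (Finset.mem_of_mem_erase ha) b (Finset.mem_of_mem_erase hb)
    have hzero2 : ∀ i ∈ σ, ∀ η, ∑ S ∈ σ.powerset, s.altTerm σ Q ((Q i + η) ::ₘ Z) η S = 0 := by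
      intro i hi η
      have := sum_altTerm_insert_add (s := s) (Finset.notMem_erase i σ) Q Z η fun j hj =>
        hQ i hi j (Finset.mem_of_mem_erase hj) (Finset.ne_of_mem_erase hj).symm
      rw [Finset.insert_erase hi] at this
      rw [this, ih _ Q Z η (by rw [Finset.card_erase_of_mem hi]; omega) (by omega), mul_zero]
      exact fun a ha b hb => hQ a (Finset.mem_of_mem_erase ha) b (Finset.mem_of_mem_erase hb)
    have hinj : Set.InjOn Q σ := by
      intro i hi j hj hij
      by_contra hne
      exact hQ i hi j hj hne (by rw [hij, sub_self, s.map_zero])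
    -- a perturbation puts `z` and `η` in general position
    have := eq_zero_of_eventually_eq_zero (f := fun t =>
      ∑ S ∈ σ.powerset, s.altTerm σ Q ((z + t * 2) ::ₘ Z) (η + t) S) ?_ ?_
    · simpa using this
    · have := s.continuous
      have hc := fun i => continuous_thetaProd (s := s) (fun t => Q i + (η + t)) (by fun_prop) Z
      simp only [altTerm, thetaProd_cons, Multiset.sum_cons]
      fun_prop
    · have e1 : ∀ᶠ t in 𝓝[≠] (0 : ℂ), ∀ i ∈ σ, s (Q k + (η + t) - Q i) ≠ 0 := by
        rw [Finset.eventually_all]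
        intro i _
        filter_upwards [s.eventually_ne_zero (Q k + η - Q i) one_ne_zero] with t ht
        convert ht using 2
        ring
      have e2 : ∀ᶠ t in 𝓝[≠] (0 : ℂ), ∀ i ∈ σ, s (z + t * 2 - Q i) ≠ 0 := by
        rw [Finset.eventually_all]
        intro i _
        filter_upwards [s.eventually_ne_zero (z - Q i) two_ne_zero] with t ht
        convert ht using 2
        ring
      have e3 := s.eventually_ne_zero (z - Q k - η) one_ne_zero
      have e4 := s.eventually_ne_zero (Q k + η - ∑ i ∈ σ, Q i + Z.sum - (n + 2) * η)
        (b := -(n + 1 : ℂ)) (neg_ne_zero.2 (by exact_mod_cast Nat.succ_ne_zero n))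
      filter_upwards [e1, e2, e3, e4] with t h1 h2 h3 h4
      have hPn : Q k + (η + t) ∉ σ.image Q := by
        intro h
        obtain ⟨i, hi, hi'⟩ := Finset.mem_image.1 h
        exact h1 i hi (by rw [hi', sub_self, s.map_zero])
      refine IsTheta.eq_zero (s := s) (f := fun v =>
        ∑ S ∈ σ.powerset, s.altTerm σ Q (v ::ₘ Z) (η + t) S)
        (IsTheta.sum fun S hS => (isThetaProd_altTerm (Finset.mem_powerset.1 hS) Q Z _).isTheta)
        (P := insert (Q k + (η + t)) (σ.image Q)) ?_ ?_ ?_ ?_ ?_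
      · rw [Finset.card_insert_of_notMem hPn, Finset.card_image_of_injOn hinj]
      · have hsym : ∀ a b, s (a - b) ≠ 0 → s (b - a) ≠ 0 := fun a b h => by
          rwa [s.map_sub_comm, neg_ne_zero]
        intro a ha b hb hab
        simp only [Finset.mem_insert, Finset.mem_image] at ha hb
        rcases ha with rfl | ⟨i, hi, rfl⟩ <;> rcases hb with rfl | ⟨j, hj, rfl⟩
        · exact absurd rfl hab
        · exact h1 j hj
        · exact hsym _ _ (h1 i hi)
        · exact hQ i hi j hj fun h => hab (by rw [h])
      · intro p hp
        simp only [Finset.mem_insert, Finset.mem_image] at hp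
        rcases hp with rfl | ⟨i, hi, rfl⟩
        · exact hzero2 k hk _
        · exact hzero1 i hi _
      · rw [Finset.sum_insert hPn, Finset.sum_image hinj, hσ]
        convert h4 using 2
        push_cast
        ring
      · intro p hp
        simp only [Finset.mem_insert, Finset.mem_image] at hp
        rcases hp with rfl | ⟨i, hi, rfl⟩
        · convert h3 using 2
          ring
        · exact h2 i hi

end SigmaFunction

/-! ### The source identity -/

section PowersetCard

variable {ι M : Type*} [DecidableEq ι] [AddCommMonoid M]

theorem Finset.sum_powersetCard_insert_of_notMem {τ : Finset ι} {j : ι} (k : ℕ)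
    {f : Finset ι → M} (hf : ∀ I ⊆ τ, f (insert j I) = 0) :
    ∑ I ∈ powersetCard k (insert j τ), f I = ∑ I ∈ powersetCard k τ, f I := by
  symm
  refine Finset.sum_subset (powersetCard_mono (subset_insert _ _)) fun I hI hI' => ?_
  rw [mem_powersetCard] at hI hI'
  have hjI : j ∈ I := by
    by_contra h
    exact hI' ⟨(subset_insert_iff_of_notMem h).1 hI.1, hI.2⟩
  rw [← insert_erase hjI]
  exact hf _ (subset_insert_iff.1 hI.1)

theorem Finset.sum_powersetCard_succ_insert {τ : Finset ι} {j : ι} (hj : j ∉ τ) (k : ℕ)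
    (f : Finset ι → M) :
    ∑ I ∈ powersetCard (k + 1) (insert j τ), f I =
      ∑ I ∈ powersetCard (k + 1) τ, f I + ∑ I ∈ powersetCard k τ, f (insert j I) := by
  rw [powersetCard_succ_insert hj, sum_union, sum_image]
  · intro I hI J hJ h
    rw [mem_coe, mem_powersetCard] at hI hJ
    rw [← erase_insert (fun h => hj (hI.1 h)), ← erase_insert (fun h => hj (hJ.1 h)), h]
  · rw [disjoint_left]
    intro I hI hI'
    obtain ⟨J, _, rfl⟩ := mem_image.1 hI'
    exact hj ((mem_powersetCard.1 hI).1 (mem_insert_self _ _))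

theorem Finset.sum_powersetCard_succ_insert_of_mem {τ : Finset ι} {j : ι} (hj : j ∉ τ) (k : ℕ)
    {f : Finset ι → M} (hf : ∀ I ⊆ τ, f I = 0) :
    ∑ I ∈ powersetCard (k + 1) (insert j τ), f I = ∑ I ∈ powersetCard k τ, f (insert j I) := by
  rw [sum_powersetCard_succ_insert hj, sum_eq_zero, zero_add]
  exact fun I hI => hf I (mem_powersetCard.1 hI).1

end PowersetCard

namespace SigmaFunction

variable {s : SigmaFunction} {ι : Type*}

/-- The points `z i + n b`, `i ∈ σ`, `n ∈ ℤ`, with different `i` are different modulo the zeros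
of the sigma function. -/
def StrongSep (s : SigmaFunction) (b : ℂ) (z : ι → ℂ) (σ : Finset ι) : Prop :=
  ∀ i ∈ σ, ∀ j ∈ σ, i ≠ j → ∀ n : ℤ, s (z i - z j + n * b) ≠ 0

theorem StrongSep.mono {b : ℂ} {z : ι → ℂ} {σ τ : Finset ι} (h : s.StrongSep b z σ)
    (hτ : τ ⊆ σ) : s.StrongSep b z τ := fun i hi j hj => h i (hτ hi) j (hτ hj)

theorem StrongSep.neg_right {b : ℂ} {z : ι → ℂ} {σ : Finset ι} (h : s.StrongSep b z σ) :
    s.StrongSep (-b) z σ := fun i hi j hj hij n => by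
  simpa using h i hi j hj hij (-n)

theorem StrongSep.neg {b : ℂ} {z : ι → ℂ} {σ : Finset ι} (h : s.StrongSep b z σ) :
    s.StrongSep b (-z) σ := fun i hi j hj hij n => by
  have := h j hj i hi hij.symm n
  rwa [Pi.neg_apply, Pi.neg_apply, neg_sub_neg]

theorem StrongSep.sub_ne {b : ℂ} {z : ι → ℂ} {σ : Finset ι} (h : s.StrongSep b z σ)
    {i j : ι} (hi : i ∈ σ) (hj : j ∈ σ) (hij : i ≠ j) : s (z i - z j) ≠ 0 := by
  simpa using h i hi j hj hij 0

theorem StrongSep.add_ne {b : ℂ} {z : ι → ℂ} {σ : Finset ι} (h : s.StrongSep b z σ)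
    {i j : ι} (hi : i ∈ σ) (hj : j ∈ σ) (hij : i ≠ j) : s (z i - z j + b) ≠ 0 := by
  simpa using h i hi j hj hij 1

theorem StrongSep.sub_sub_ne {b : ℂ} {z : ι → ℂ} {σ : Finset ι} (h : s.StrongSep b z σ)
    {i j : ι} (hi : i ∈ σ) (hj : j ∈ σ) (hij : i ≠ j) : s (z i - z j - b) ≠ 0 := by
  simpa [sub_eq_add_neg] using h i hi j hj hij (-1)

variable (s) [DecidableEq ι]

/-- The two-body factor `[z - a] [z + a - b] / ([z] [z - b])` of the source identity. -/
noncomputable def exch (a b z : ℂ) : ℂ := s (z - a) * s (z + a - b) / (s z * s (z - b))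

theorem exch_neg (a b z : ℂ) : s.exch a b (-z) = s.exch (-a) (-b) z := by
  rw [exch, exch, show -z - a = -(z - -a) by ring, show -z + a - b = -(z + -a - -b) by ring,
    show -z - b = -(z - -b) by ring, s.map_neg, s.map_neg, s.map_neg, s.map_neg]
  simp only [neg_mul_neg]

theorem exch_sub (a b z : ℂ) : s.exch a b (b - z) = s.exch a b z := by
  rw [exch, exch, show b - z - a = -(z + a - b) by ring, show b - z + a - b = -(z - a) by ring,
    show b - z - b = -z by ring, show b - z = -(z - b) by ring, s.map_neg, s.map_neg, s.map_neg,
    s.map_neg]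
  simp only [neg_mul_neg]
  ring

/-- The product of the two-body factors over `I × J`. -/
noncomputable def exchProd (a b : ℂ) (z : ι → ℂ) (I J : Finset ι) : ℂ :=
  ∏ i ∈ I, ∏ j ∈ J, s.exch a b (z i - z j)

/-- The sum over all subsets of `σ` of size `k` in the source identity. -/
noncomputable def exchSum (a b : ℂ) (z : ι → ℂ) (σ : Finset ι) (k : ℕ) : ℂ :=
  ∑ I ∈ Finset.powersetCard k σ, s.exchProd a b z I (σ \ I)

/-- The cleared denominator of `exch a b (v - w)` and of `exch a b (w - v)`. -/
noncomputable def exchDen (b v w : ℂ) : ℂ := s (v - w) * s (v - w - b) * s (v - w + b)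

/-- The numerator of `exch a b (v - w)` over the denominator `exchDen b v w`. -/
noncomputable def exchNum (a b v w : ℂ) : ℂ := s (v - w - a) * s (v - w + a - b) * s (v - w + b)

theorem exchDen_neg (b v w : ℂ) : s.exchDen (-b) v w = s.exchDen b v w := by
  simp only [exchDen, sub_neg_eq_add, ← sub_eq_add_neg]
  ring

variable {s}

theorem exch_mul_exchDen {a b v w : ℂ} (h0 : s (v - w) ≠ 0) (h1 : s (v - w - b) ≠ 0) :
    s.exch a b (v - w) * s.exchDen b v w = s.exchNum a b v w := by
  rw [exch, exchDen, exchNum]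
  field_simp

theorem exch_mul_exchDen' {a b v w : ℂ} (h0 : s (v - w) ≠ 0) (h1 : s (v - w + b) ≠ 0) :
    s.exch a b (w - v) * s.exchDen b v w = s.exchNum (-a) (-b) v w := by
  rw [← neg_sub v w, exch_neg, ← exchDen_neg, exch_mul_exchDen h0 (by rwa [sub_neg_eq_add])]

/-- The sum in the source identity for `σ = insert i τ`, multiplied by its denominators, as a
function of the variable `v = z i`. -/
noncomputable def exchCleared (s : SigmaFunction) (a b : ℂ) (z : ι → ℂ) (τ : Finset ι) (k : ℕ)
    (v : ℂ) : ℂ :=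
  ∑ I ∈ Finset.powersetCard (k + 1) τ, s.exchProd a b z I (τ \ I) *
      ((∏ i ∈ I, s.exchNum (-a) (-b) v (z i)) * ∏ j ∈ τ \ I, s.exchDen b v (z j))
    + ∑ I ∈ Finset.powersetCard k τ, s.exchProd a b z I (τ \ I) *
      ((∏ i ∈ I, s.exchDen b v (z i)) * ∏ j ∈ τ \ I, s.exchNum a b v (z j))

theorem exchProd_insert_left {I : Finset ι} {j : ι} (hj : j ∉ I) (a b : ℂ) (z : ι → ℂ)
    (J : Finset ι) : s.exchProd a b z (insert j I) J =
      s.exchProd a b z I J * ∏ l ∈ J, s.exch a b (z j - z l) := by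
  rw [exchProd, Finset.prod_insert hj, mul_comm, exchProd]

theorem exchProd_insert_right {J : Finset ι} {j : ι} (hj : j ∉ J) (a b : ℂ) (z : ι → ℂ)
    (I : Finset ι) : s.exchProd a b z I (insert j J) =
      s.exchProd a b z I J * ∏ i ∈ I, s.exch a b (z i - z j) := by
  simp only [exchProd, Finset.prod_insert hj, Finset.prod_mul_distrib]
  rw [mul_comm]

/-- `exchCleared` is the sum of the source identity with its denominators in `z i` cleared. -/
theorem exchSum_succ_mul {τ : Finset ι} {i : ι} (hi : i ∉ τ) {a b : ℂ} {z : ι → ℂ} (k : ℕ)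
    (hz : s.StrongSep b z (insert i τ)) :
    s.exchSum a b z (insert i τ) (k + 1) * ∏ j ∈ τ, s.exchDen b (z i) (z j) =
      s.exchCleared a b z τ k (z i) := by
  have hne : ∀ j ∈ τ, i ≠ j := fun j hj h => hi (h ▸ hj)
  have hm := Finset.mem_insert_self i τ
  have hm' : ∀ j ∈ τ, j ∈ insert i τ := fun j hj => Finset.mem_insert_of_mem hj
  rw [exchSum, Finset.sum_powersetCard_succ_insert hi, exchCleared, add_mul, Finset.sum_mul,
    Finset.sum_mul]
  congr 1
  · refine Finset.sum_congr rfl fun I hI => ?_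
    have hIτ := (Finset.mem_powersetCard.1 hI).1
    have hiI : i ∉ I := fun h => hi (hIτ h)
    rw [Finset.insert_sdiff_of_notMem _ hiI, exchProd_insert_right (by simp [hi]),
      ← Finset.prod_sdiff hIτ]
    have : ∏ l ∈ I, s.exchNum (-a) (-b) (z i) (z l) =
        (∏ l ∈ I, s.exch a b (z l - z i)) * ∏ l ∈ I, s.exchDen b (z i) (z l) := by
      rw [← Finset.prod_mul_distrib]
      refine Finset.prod_congr rfl fun l hl => (exch_mul_exchDen' ?_ ?_).symm
      · exact hz.sub_ne hm (hm' l (hIτ hl)) (hne l (hIτ hl))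
      · exact hz.add_ne hm (hm' l (hIτ hl)) (hne l (hIτ hl))
    rw [this]
    ring
  · refine Finset.sum_congr rfl fun I hI => ?_
    have hIτ := (Finset.mem_powersetCard.1 hI).1
    have hiI : i ∉ I := fun h => hi (hIτ h)
    rw [Finset.insert_sdiff_insert, Finset.sdiff_insert_of_notMem hi, exchProd_insert_left hiI,
      ← Finset.prod_sdiff hIτ]
    have : ∏ l ∈ τ \ I, s.exchNum a b (z i) (z l) =
        (∏ l ∈ τ \ I, s.exch a b (z i - z l)) * ∏ l ∈ τ \ I, s.exchDen b (z i) (z l) := by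
      rw [← Finset.prod_mul_distrib]
      refine Finset.prod_congr rfl fun l hl => (exch_mul_exchDen ?_ ?_).symm
      · have hl := (Finset.mem_sdiff.1 hl).1
        exact hz.sub_ne hm (hm' l hl) (hne l hl)
      · have hl := (Finset.mem_sdiff.1 hl).1
        exact hz.sub_sub_ne hm (hm' l hl) (hne l hl)
    rw [this]
    ring

theorem isThetaProd_exchDen (b w : ℂ) : s.IsThetaProd 3 (3 * w) fun v => s.exchDen b v w := by
  refine (((isThetaProd_sub w).mul (isThetaProd_sub (w + b))).mul
    (isThetaProd_sub (w - b))).congr rfl (by ring) fun v => ?_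
  simp only [exchDen]
  rw [show v - w - b = v - (w + b) by ring, show v - w + b = v - (w - b) by ring]

theorem isThetaProd_exchNum (a b w : ℂ) :
    s.IsThetaProd 3 (3 * w) fun v => s.exchNum a b v w := by
  refine (((isThetaProd_sub (w + a)).mul (isThetaProd_sub (w - a + b))).mul
    (isThetaProd_sub (w - b))).congr rfl (by ring) fun v => ?_
  simp only [exchNum]
  rw [show v - w - a = v - (w + a) by ring, show v - w + a - b = v - (w - a + b) by ring,
    show v - w + b = v - (w - b) by ring]

theorem isTheta_exchCleared (a b : ℂ) (z : ι → ℂ) (τ : Finset ι) (k : ℕ) :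
    s.IsTheta (3 * τ.card) (3 * ∑ j ∈ τ, z j) (s.exchCleared a b z τ k) := by
  have hc : ∀ I ⊆ τ, I.card * 3 + (τ \ I).card * 3 = 3 * τ.card := fun I hI => by
    have := Finset.card_sdiff_add_card_eq_card hI
    omega
  have ht : ∀ I ⊆ τ, ∑ i ∈ I, 3 * z i + ∑ i ∈ τ \ I, 3 * z i = 3 * ∑ i ∈ τ, z i := fun I hI => by
    rw [← Finset.sum_sdiff hI, ← Finset.mul_sum, ← Finset.mul_sum]
    ring
  refine IsTheta.add (IsTheta.sum fun I hI => ?_) (IsTheta.sum fun I hI => ?_)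
  · have hI := (Finset.mem_powersetCard.1 hI).1
    exact ((((IsThetaProd.prod fun i _ => isThetaProd_exchNum (-a) (-b) (z i)).mul
      (IsThetaProd.prod fun j _ => isThetaProd_exchDen b (z j))).congr (hc I hI) (ht I hI)
        fun _ => rfl).const_mul _).isTheta
  · have hI := (Finset.mem_powersetCard.1 hI).1
    exact ((((IsThetaProd.prod fun i _ => isThetaProd_exchDen b (z i)).mul
      (IsThetaProd.prod fun j _ => isThetaProd_exchNum a b (z j))).congr (hc I hI) (ht I hI)
        fun _ => rfl).const_mul _).isTheta

/-- At `v = z j` the summands with `j ∈ I` and with `j ∉ I` cancel in pairs. -/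
theorem exchCleared_self {τ : Finset ι} {j : ι} (hj : j ∉ τ) {a b : ℂ} {z : ι → ℂ} (k : ℕ)
    (hz : s.StrongSep b z (insert j τ)) : s.exchCleared a b z (insert j τ) k (z j) = 0 := by
  have hne : ∀ l ∈ τ, j ≠ l := fun l hl h => hj (h ▸ hl)
  have hm := Finset.mem_insert_self j τ
  have hm' : ∀ l ∈ τ, l ∈ insert j τ := fun l hl => Finset.mem_insert_of_mem hl
  have h0 : s.exchDen b (z j) (z j) = 0 := by simp [exchDen, s.map_zero]
  rw [exchCleared, Finset.sum_powersetCard_succ_insert_of_mem hj,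
    Finset.sum_powersetCard_insert_of_notMem, ← Finset.sum_add_distrib]
  · refine Finset.sum_eq_zero fun I hI => ?_
    have hIτ := (Finset.mem_powersetCard.1 hI).1
    have hjI : j ∉ I := fun h => hj (hIτ h)
    have hjd : j ∉ τ \ I := by simp [hj]
    rw [Finset.insert_sdiff_insert, Finset.sdiff_insert_of_notMem hj,
      Finset.insert_sdiff_of_notMem _ hjI, exchProd_insert_left hjI, exchProd_insert_right hjd,
      Finset.prod_insert hjI, Finset.prod_insert hjd]
    have e1 : ∏ l ∈ I, s.exchNum (-a) (-b) (z j) (z l) =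
        (∏ l ∈ I, s.exch a b (z l - z j)) * ∏ l ∈ I, s.exchDen b (z j) (z l) := by
      rw [← Finset.prod_mul_distrib]
      refine Finset.prod_congr rfl fun l hl => (exch_mul_exchDen' ?_ ?_).symm
      · exact hz.sub_ne hm (hm' l (hIτ hl)) (hne l (hIτ hl))
      · exact hz.add_ne hm (hm' l (hIτ hl)) (hne l (hIτ hl))
    have e2 : ∏ l ∈ τ \ I, s.exchNum a b (z j) (z l) =
        (∏ l ∈ τ \ I, s.exch a b (z j - z l)) * ∏ l ∈ τ \ I, s.exchDen b (z j) (z l) := by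
      rw [← Finset.prod_mul_distrib]
      refine Finset.prod_congr rfl fun l hl => (exch_mul_exchDen ?_ ?_).symm
      · have hl := (Finset.mem_sdiff.1 hl).1
        exact hz.sub_ne hm (hm' l hl) (hne l hl)
      · have hl := (Finset.mem_sdiff.1 hl).1
        exact hz.sub_sub_ne hm (hm' l hl) (hne l hl)
    have e3 : s.exchNum (-a) (-b) (z j) (z j) = -s.exchNum a b (z j) (z j) := by
      simp only [exchNum, sub_self, zero_sub, zero_add, sub_neg_eq_add]
      rw [show -a + b = -(a - b) by ring, s.map_neg, s.map_neg a, s.map_neg]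
      ring
    rw [e1, e2, e3]
    ring
  · intro I hI
    rw [Finset.prod_insert (fun h => hj (hI h)), h0]
    simp
  · intro I hI
    have hjI : j ∉ I := fun h => hj (hI h)
    rw [Finset.insert_sdiff_of_notMem _ hjI, Finset.prod_insert (s := τ \ I) (by simp [hj]), h0]
    simp

/-- At `v = z j + b` only the summands with `i ∈ I`, `j ∉ I` remain, and they form the sum without
`i` and `j`. -/
theorem exchCleared_add {τ : Finset ι} {j : ι} (hj : j ∉ τ) {a b : ℂ} {z : ι → ℂ} (k : ℕ)
    (hz : s.StrongSep b z (insert j τ)) : s.exchCleared a b z (insert j τ) k (z j + b) =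
      s.exchNum a b (z j + b) (z j) *
        (∏ l ∈ τ, s.exch a b (z l - z j) * s.exchDen b (z j + b) (z l)) *
        s.exchSum a b z τ k := by
  have hne : ∀ l ∈ τ, j ≠ l := fun l hl h => hj (h ▸ hl)
  have hm := Finset.mem_insert_self j τ
  have hm' : ∀ l ∈ τ, l ∈ insert j τ := fun l hl => Finset.mem_insert_of_mem hl
  have h0 : s.exchDen b (z j + b) (z j) = 0 := by simp [exchDen, s.map_zero]
  have h1 : s.exchNum (-a) (-b) (z j + b) (z j) = 0 := by simp [exchNum, s.map_zero]
  rw [exchCleared, Finset.sum_eq_zero, zero_add,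
    Finset.sum_powersetCard_insert_of_notMem, exchSum, Finset.mul_sum]
  · refine Finset.sum_congr rfl fun I hI => ?_
    have hIτ := (Finset.mem_powersetCard.1 hI).1
    have hjI : j ∉ I := fun h => hj (hIτ h)
    have hjd : j ∉ τ \ I := by simp [hj]
    rw [Finset.insert_sdiff_of_notMem _ hjI, exchProd_insert_right hjd, Finset.prod_insert hjd,
      ← Finset.prod_sdiff hIτ]
    have e2 : ∏ l ∈ τ \ I, s.exchNum a b (z j + b) (z l) =
        ∏ l ∈ τ \ I, s.exch a b (z l - z j) * s.exchDen b (z j + b) (z l) := by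
      refine Finset.prod_congr rfl fun l hl => ?_
      have hl := (Finset.mem_sdiff.1 hl).1
      rw [← exch_sub, show b - (z l - z j) = z j + b - z l by ring, exch_mul_exchDen]
      · rw [show z j + b - z l = z j - z l + b by ring]
        exact hz.add_ne hm (hm' l hl) (hne l hl)
      · rw [show z j + b - z l - b = z j - z l by ring]
        exact hz.sub_ne hm (hm' l hl) (hne l hl)
    rw [e2, Finset.prod_mul_distrib (s := I)]
    ring
  · intro I hI
    rw [Finset.prod_insert (fun h => hj (hI h)), h0]
    simp
  · intro I hI
    have hIτ := (Finset.mem_powersetCard.1 hI).1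
    by_cases hjI : j ∈ I
    · rw [Finset.prod_eq_zero hjI h1]
      simp
    · rw [Finset.prod_eq_zero (s := insert j τ \ I) (Finset.mem_sdiff.2 ⟨hm, hjI⟩) h0]
      simp

/-- At `v = z j - b` only the summands with `i ∉ I`, `j ∈ I` remain, and they form the sum without
`i` and `j`. -/
theorem exchCleared_sub {τ : Finset ι} {j : ι} (hj : j ∉ τ) {a b : ℂ} {z : ι → ℂ} (k : ℕ)
    (hz : s.StrongSep b z (insert j τ)) : s.exchCleared a b z (insert j τ) k (z j - b) =
      s.exchNum (-a) (-b) (z j - b) (z j) *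
        (∏ l ∈ τ, s.exch a b (z j - z l) * s.exchDen b (z j - b) (z l)) *
        s.exchSum a b z τ k := by
  have hne : ∀ l ∈ τ, j ≠ l := fun l hl h => hj (h ▸ hl)
  have hm := Finset.mem_insert_self j τ
  have hm' : ∀ l ∈ τ, l ∈ insert j τ := fun l hl => Finset.mem_insert_of_mem hl
  have h0 : s.exchDen b (z j - b) (z j) = 0 := by simp [exchDen, s.map_zero]
  have h1 : s.exchNum a b (z j - b) (z j) = 0 := by simp [exchNum, s.map_zero]
  rw [exchCleared, Finset.sum_powersetCard_succ_insert_of_mem hj,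
    Finset.sum_eq_zero (s := Finset.powersetCard k (insert j τ)), add_zero, exchSum,
    Finset.mul_sum]
  · refine Finset.sum_congr rfl fun I hI => ?_
    have hIτ := (Finset.mem_powersetCard.1 hI).1
    have hjI : j ∉ I := fun h => hj (hIτ h)
    rw [Finset.insert_sdiff_insert, Finset.sdiff_insert_of_notMem hj, exchProd_insert_left hjI,
      Finset.prod_insert hjI, ← Finset.prod_sdiff hIτ]
    have e2 : ∏ l ∈ I, s.exchNum (-a) (-b) (z j - b) (z l) =
        ∏ l ∈ I, s.exch a b (z j - z l) * s.exchDen b (z j - b) (z l) := by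
      refine Finset.prod_congr rfl fun l hl => ?_
      have hl := hIτ hl
      rw [← exch_sub, show b - (z j - z l) = z l - (z j - b) by ring, exch_mul_exchDen']
      · rw [show z j - b - z l = z j - z l - b by ring]
        exact hz.sub_sub_ne hm (hm' l hl) (hne l hl)
      · rw [show z j - b - z l + b = z j - z l by ring]
        exact hz.sub_ne hm (hm' l hl) (hne l hl)
    rw [e2, Finset.prod_mul_distrib (s := τ \ I)]
    ring
  · intro I hI
    have hIτ := (Finset.mem_powersetCard.1 hI).1
    by_cases hjI : j ∈ I
    · rw [Finset.prod_eq_zero hjI h0]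
      simp
    · rw [Finset.prod_eq_zero (s := insert j τ \ I) (Finset.mem_sdiff.2 ⟨hm, hjI⟩) h1]
      simp
  · intro I hI
    have hjI : j ∉ I := fun h => hj (hI h)
    rw [Finset.prod_eq_zero (s := insert j τ \ I) (Finset.mem_sdiff.2 ⟨hm, hjI⟩) h0]
    simp

end SigmaFunction

namespace SigmaFunction

variable {s : SigmaFunction} {ι : Type*} [DecidableEq ι]

theorem exchSum_zero (a b : ℂ) (z : ι → ℂ) (σ : Finset ι) : s.exchSum a b z σ 0 = 1 := by
  simp [exchSum, exchProd]

theorem exchSum_singleton (a b : ℂ) (z : ι → ℂ) (i : ι) (k : ℕ) :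
    s.exchSum a b z {i} k = if k ≤ 1 then 1 else 0 := by
  rcases k with _ | _ | k
  · simp [exchSum_zero]
  · have h1 := Finset.powersetCard_self ({i} : Finset ι)
    rw [Finset.card_singleton] at h1
    simp [exchSum, exchProd, h1]
  · rw [exchSum, Finset.powersetCard_eq_empty.2 (by simp)]
    simp

theorem exchSum_congr {a b : ℂ} {z z' : ι → ℂ} {σ : Finset ι} (h : ∀ i ∈ σ, z i = z' i) (k : ℕ) :
    s.exchSum a b z σ k = s.exchSum a b z' σ k := by
  refine Finset.sum_congr rfl fun I hI => Finset.prod_congr rfl fun i hi =>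
    Finset.prod_congr rfl fun j hj => ?_
  rw [h i ((Finset.mem_powersetCard.1 hI).1 hi), h j (Finset.mem_sdiff.1 hj).1]

theorem exchSum_neg (a b : ℂ) (z : ι → ℂ) (σ : Finset ι) (k : ℕ) :
    s.exchSum a b (-z) σ k = s.exchSum (-a) (-b) z σ k := by
  refine Finset.sum_congr rfl fun I hI => Finset.prod_congr rfl fun i hi =>
    Finset.prod_congr rfl fun j hj => ?_
  rw [← exch_neg, Pi.neg_apply, Pi.neg_apply]
  congr 1
  ring

theorem exchCleared_congr {a b : ℂ} {z z' : ι → ℂ} {τ : Finset ι} (h : ∀ i ∈ τ, z i = z' i)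
    (k : ℕ) (v : ℂ) : s.exchCleared a b z τ k v = s.exchCleared a b z' τ k v := by
  have e : ∀ I ⊆ τ, s.exchProd a b z I (τ \ I) = s.exchProd a b z' I (τ \ I) := fun I hI =>
    Finset.prod_congr rfl fun i hi => Finset.prod_congr rfl fun j hj => by
      rw [h i (hI hi), h j (Finset.mem_sdiff.1 hj).1]
  refine congrArg₂ (· + ·) (Finset.sum_congr rfl fun I hI => ?_)
    (Finset.sum_congr rfl fun I hI => ?_)
  all_goals
    have hI := (Finset.mem_powersetCard.1 hI).1
    rw [e I hI]
    congr 2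
    · exact Finset.prod_congr rfl fun i hi => by rw [h i (hI hi)]
    · exact Finset.prod_congr rfl fun i hi => by rw [h i (Finset.mem_sdiff.1 hi).1]

/-- The points at which the difference of the two sides of the source identity, with denominators
cleared, vanishes. -/
noncomputable def exchNodes (b : ℂ) (z : ι → ℂ) (τ : Finset ι) : Finset ℂ :=
  (τ ×ˢ ({0, 1, -1} : Finset ℤ)).image fun p => z p.1 + p.2 * b

theorem separated_exchNodes {b : ℂ} {z : ι → ℂ} {τ : Finset ι} (hz : s.StrongSep b z τ)
    (hb : s b ≠ 0) (hb2 : s (2 * b) ≠ 0) :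
    ∀ p ∈ τ ×ˢ ({0, 1, -1} : Finset ℤ), ∀ q ∈ τ ×ˢ ({0, 1, -1} : Finset ℤ), p ≠ q →
      s (z p.1 + p.2 * b - (z q.1 + q.2 * b)) ≠ 0 := by
  rintro ⟨i, m⟩ hi ⟨j, n⟩ hj hne
  rw [Finset.mem_product] at hi hj
  dsimp only at *
  by_cases hij : i = j
  · subst hij
    have hmn : m ≠ n := fun h => hne (by rw [h])
    have hs : s (-b) ≠ 0 := by rwa [s.map_neg, neg_ne_zero]
    have hs2 : s (-(2 * b)) ≠ 0 := by rwa [s.map_neg, neg_ne_zero]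
    have hm := hi.2
    have hn := hj.2
    simp only [Finset.mem_insert, Finset.mem_singleton] at hm hn
    rcases hm with rfl | rfl | rfl <;> rcases hn with rfl | rfl | rfl
    all_goals first | exact absurd rfl hmn | skip
    · convert hs using 2; push_cast; ring
    · convert hb using 2; push_cast; ring
    · convert hb using 2; push_cast; ring
    · convert hb2 using 2; push_cast; ring
    · convert hs using 2; push_cast; ring
    · convert hs2 using 2; push_cast; ring
  · convert hz i hi.1 j hj.1 hij (m - n) using 2
    push_cast
    ring

/-- If the source identity holds for fewer variables, then the difference of its two sides does not
depend on the variable `z i`. -/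
theorem exchSum_sub_eq {τ : Finset ι} {i : ι} (hi : i ∉ τ) {a b : ℂ} {z z' : ι → ℂ} (k : ℕ)
    (hz : s.StrongSep b z (insert i τ)) (hz' : s.StrongSep b z' (insert i τ))
    (hzz : ∀ j ∈ τ, z' j = z j) (hii : s (z i - z' i) ≠ 0)
    (hb : s b ≠ 0) (hb2 : s (2 * b) ≠ 0)
    (ih : ∀ ρ ⊂ insert i τ, ∀ k, s.exchSum a b z ρ k = s.exchSum (-a) (-b) z ρ k) :
    s.exchSum a b z (insert i τ) k - s.exchSum (-a) (-b) z (insert i τ) k =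
      s.exchSum a b z' (insert i τ) k - s.exchSum (-a) (-b) z' (insert i τ) k := by
  rcases k with _ | k
  · simp [exchSum_zero]
  rcases τ.eq_empty_or_nonempty with rfl | hτ
  · simp [exchSum_singleton]
  have hne : ∀ l ∈ τ, i ≠ l := fun l hl h => hi (h ▸ hl)
  have hm := Finset.mem_insert_self i τ
  have hm' : ∀ l ∈ τ, l ∈ insert i τ := fun l hl => Finset.mem_insert_of_mem hl
  have hτz := hz.mono (Finset.subset_insert i τ)
  have hinj := separated_exchNodes hτz hb hb2
  have hinj' : Set.InjOn (fun p : ι × ℤ => z p.1 + p.2 * b)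
      (τ ×ˢ ({0, 1, -1} : Finset ℤ) : Finset (ι × ℤ)) := by
    intro p hp q hq h
    by_contra hpq
    exact hinj p hp q hq hpq (by simp only at h; rw [h, sub_self, s.map_zero])
  have hprod : ∀ v, ∏ p ∈ exchNodes b z τ, s (v - p) = ∏ j ∈ τ, s.exchDen b v (z j) := by
    intro v
    rw [exchNodes, Finset.prod_image hinj', Finset.prod_product]
    refine Finset.prod_congr rfl fun j _ => ?_
    rw [Finset.prod_insert (by decide), Finset.prod_pair (by decide), exchDen, mul_assoc]
    push_cast
    congr 2
    · congr 1; ring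
    · congr 1; ring
    · congr 1; ring
  have hden : ∀ u : ι → ℂ, s.StrongSep b u (insert i τ) →
      ∏ j ∈ τ, s.exchDen b (u i) (u j) ≠ 0 := fun u hu =>
    Finset.prod_ne_zero_iff.2 fun j hj => mul_ne_zero (mul_ne_zero (hu.sub_ne hm (hm' j hj)
      (hne j hj)) (hu.sub_sub_ne hm (hm' j hj) (hne j hj))) (hu.add_ne hm (hm' j hj) (hne j hj))
  have hd1 := hden z hz
  have hd2 := hden z' hz'
  rw [Finset.prod_congr rfl fun j hj => by rw [hzz j hj]] at hd2
  -- the difference of the two sides, with denominators cleared, as a function of `z i`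
  have hf : s.IsTheta (3 * τ.card) (3 * ∑ j ∈ τ, z j) fun v =>
      s.exchCleared a b z τ k v + -1 * s.exchCleared (-a) (-b) z τ k v :=
    (isTheta_exchCleared a b z τ k).add ((isTheta_exchCleared (-a) (-b) z τ k).const_mul (-1))
  have key := hf.mul_prod_eq (P := exchNodes b z τ) (z := z i) (w := z' i) ?_ ?_ ?_ ?_ ?_ ?_ ?_ hii
  · have e1 := exchSum_succ_mul hi (a := a) k hz
    have e2 := exchSum_succ_mul hi (a := -a) k hz.neg_right
    have e3 := exchSum_succ_mul hi (a := a) k hz'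
    have e4 := exchSum_succ_mul hi (a := -a) k hz'.neg_right
    rw [exchCleared_congr hzz, Finset.prod_congr rfl fun j hj => by rw [hzz j hj]] at e3 e4
    simp only [exchDen_neg] at e2 e4
    rw [hprod, hprod, ← e1, ← e2, ← e3, ← e4] at key
    refine mul_right_cancel₀ (mul_ne_zero hd1 hd2) ?_
    linear_combination key
  · rw [exchNodes, Finset.card_image_of_injOn hinj', Finset.card_product, mul_comm]
    rfl
  · have := hτ.card_pos
    omega
  · intro x hx y hy hxy
    obtain ⟨p, hp, rfl⟩ := Finset.mem_image.1 hx
    obtain ⟨q, hq, rfl⟩ := Finset.mem_image.1 hy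
    exact hinj p hp q hq fun h => hxy (by rw [h])
  · intro x hx
    obtain ⟨⟨j, n⟩, hp, rfl⟩ := Finset.mem_image.1 hx
    obtain ⟨hj, hn⟩ := Finset.mem_product.1 hp
    dsimp only at hj hn ⊢
    have hje := Finset.insert_erase hj
    have hjn := Finset.notMem_erase j τ
    have hz1 : s.StrongSep b z (insert j (τ.erase j)) := by rwa [hje]
    have hsub : τ.erase j ⊂ insert i τ :=
      (Finset.erase_ssubset hj).trans_subset (Finset.subset_insert i τ)
    simp only [Finset.mem_insert, Finset.mem_singleton] at hn
    have n1 := exchCleared_self hjn (a := a) k hz1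
    have n2 := exchCleared_self hjn (a := -a) k hz1.neg_right
    have n3 := exchCleared_add hjn (a := a) k hz1
    have n4 := exchCleared_add hjn (a := -a) k hz1.neg_right
    have n5 := exchCleared_sub hjn (a := a) k hz1
    have n6 := exchCleared_sub hjn (a := -a) k hz1.neg_right
    simp only [exchDen_neg, ← exch_neg, neg_sub, sub_neg_eq_add, neg_neg, ← sub_eq_add_neg, hje]
      at n1 n2 n3 n4 n5 n6
    rcases hn with rfl | rfl | rfl
    · rw [Int.cast_zero, zero_mul, add_zero, n1, n2]
      ring
    · rw [Int.cast_one, one_mul, n3, n6, ih _ hsub]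
      ring
    · rw [Int.cast_neg, Int.cast_one, neg_one_mul, ← sub_eq_add_neg, n5, n4, ih _ hsub]
      ring
  · rw [exchNodes, Finset.sum_image hinj', Finset.sum_product, Finset.mul_sum]
    refine Finset.sum_congr rfl fun j _ => ?_
    rw [Finset.sum_insert (by decide), Finset.sum_pair (by decide)]
    push_cast
    ring
  · exact Finset.prod_ne_zero_iff.1 (by rw [hprod]; exact hd1)
  · exact Finset.prod_ne_zero_iff.1 (by rw [hprod]; exact hd2)

variable (s) in
theorem exists_generic_point (A : Set (ℂ × ℂ)) (hA : A.Countable) (hA' : ∀ p ∈ A, p.2 ≠ 0) :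
    ∃ t, ∀ p ∈ A, s (p.1 + t * p.2) ≠ 0 := by
  have hc : (⋃ p ∈ A, {t | s (p.1 + t * p.2) = 0}).Countable :=
    hA.biUnion fun p hp => s.countable_zeros_affine p.1 (hA' p hp)
  obtain ⟨t, ht⟩ := (hc.dense_compl ℂ).nonempty
  refine ⟨t, fun p hp h => ht ?_⟩
  exact Set.mem_biUnion hp h

theorem StrongSep.update {b : ℂ} {z : ι → ℂ} {σ : Finset ι} (h : s.StrongSep b z σ) {i : ι}
    {c : ℂ} (hc : ∀ j ∈ σ, ∀ n : ℤ, s (-z j + n * b + c) ≠ 0) :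
    s.StrongSep b (Function.update z i c) σ := by
  intro j hj l hl hjl n
  by_cases hji : j = i
  · subst hji
    rw [Function.update_self, Function.update_of_ne hjl.symm]
    convert hc l hl n using 2
    ring
  · by_cases hli : l = i
    · subst hli
      rw [Function.update_self, Function.update_of_ne hji]
      rw [← neg_ne_zero, ← s.map_neg]
      convert hc j hj (-n) using 2
      push_cast
      ring
    · rw [Function.update_of_ne hji, Function.update_of_ne hli]
      exact h j hj l hl hjl n

/-- Ruijsenaars' source identity: the sum over `I ⊆ σ`, `|I| = k`, of the products of
`exch a b (z i - z j)` over `i ∈ I`, `j ∉ I` is invariant under `z ↦ -z`. -/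
theorem exchSum_neg_neg {a b : ℂ} (hb : s b ≠ 0) (hb2 : s (2 * b) ≠ 0) (σ : Finset ι) :
    ∀ (z : ι → ℂ), s.StrongSep b z σ → ∀ k,
      s.exchSum (-a) (-b) z σ k = s.exchSum a b z σ k := by
  induction σ using Finset.strongInduction with
  | H σ ih =>
    intro z hz k
    -- the difference of the two sides is an odd function
    set Φ : (ι → ℂ) → ℂ := fun z => s.exchSum a b z σ k - s.exchSum (-a) (-b) z σ k with hΦ
    have hodd : Φ (-z) = -Φ z := by
      simp only [hΦ, exchSum_neg, neg_neg]
      ring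
    have hstep : ∀ i ∈ σ, ∀ u c, s.StrongSep b u σ →
        (∀ j ∈ σ, ∀ n : ℤ, s (-u j + n * b + c) ≠ 0) → Φ (Function.update u i c) = Φ u := by
      intro i hi u c hu hc
      have hie := Finset.insert_erase hi
      have := exchSum_sub_eq (s := s) (Finset.notMem_erase i σ) (a := a) (b := b) (z := u)
        (z' := Function.update u i c) k (by rwa [hie]) (by rw [hie]; exact hu.update hc) ?_ ?_
        hb hb2 ?_
      · rw [hie] at this
        exact this.symm
      · intro j hj
        rw [Function.update_of_ne (Finset.ne_of_mem_erase hj)]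
      · rw [Function.update_self, s.map_sub_comm, neg_ne_zero]
        convert hc i hi 0 using 2
        push_cast
        ring
      · intro ρ hρ k
        rw [hie] at hρ
        exact (ih ρ hρ u (hu.mono hρ.1) k).symm
    -- both `z` and `-z` are moved to a common point, one coordinate at a time
    have hchain : ∀ ρ ⊆ σ, ∃ u w : ι → ℂ, s.StrongSep b u σ ∧ s.StrongSep b w σ ∧
        (∀ i ∈ ρ, u i = w i) ∧ Φ u = Φ z ∧ Φ w = Φ (-z) := by
      intro ρ
      induction ρ using Finset.induction_on with
      | empty => exact fun _ => ⟨z, -z, hz, hz.neg, by simp, rfl, rfl⟩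
      | insert i ρ hiρ ihρ =>
        intro hρ
        obtain ⟨u, w, hu, hw, huw, h1, h2⟩ := ihρ fun j hj => hρ (Finset.mem_insert_of_mem hj)
        have hi := hρ (Finset.mem_insert_self i ρ)
        obtain ⟨c, hc⟩ := s.exists_generic_point
          ((Set.range fun p : σ × ℤ => (-u p.1 + p.2 * b, (1 : ℂ))) ∪
            Set.range fun p : σ × ℤ => (-w p.1 + p.2 * b, (1 : ℂ)))
          ((Set.countable_range _).union (Set.countable_range _)) (by
            rintro p (⟨q, rfl⟩ | ⟨q, rfl⟩) <;> exact one_ne_zero)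
        have hcu : ∀ j ∈ σ, ∀ n : ℤ, s (-u j + n * b + c) ≠ 0 := fun j hj n => by
          simpa using hc _ (Or.inl ⟨(⟨j, hj⟩, n), rfl⟩)
        have hcw : ∀ j ∈ σ, ∀ n : ℤ, s (-w j + n * b + c) ≠ 0 := fun j hj n => by
          simpa using hc _ (Or.inr ⟨(⟨j, hj⟩, n), rfl⟩)
        refine ⟨Function.update u i c, Function.update w i c, hu.update hcu, hw.update hcw, ?_,
          (hstep i hi u c hu hcu).trans h1, (hstep i hi w c hw hcw).trans h2⟩
        intro j hj
        by_cases hji : j = i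
        · subst hji; simp
        · rw [Function.update_of_ne hji, Function.update_of_ne hji]
          exact huw j ((Finset.mem_insert.1 hj).resolve_left hji)
    obtain ⟨u, w, _, _, huw, h1, h2⟩ := hchain σ subset_rfl
    have huw' : Φ u = Φ w := by
      simp only [hΦ, exchSum_congr huw]
    have h0 : Φ z = 0 := by
      linear_combination (h2 - h1 + huw' + hodd) / 2
    simp only [hΦ] at h0
    linear_combination -h0

end SigmaFunction

/-! ### The coefficients at complex points -/

section Products

variable {α M : Type*} [CommMonoid M] [Fintype α] [DecidableEq α]

theorem Finset.prod_mem_eq_prod_ite (I : Finset α) (f : α → M) :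
    ∏ i ∈ I, f i = ∏ i, if i ∈ I then f i else 1 := by
  rw [Finset.prod_ite_mem, Finset.univ_inter]

theorem Finset.prod_mul_prod_compl_eq_prod_ite (I : Finset α) (f g : α → M) :
    (∏ i ∈ I, f i) * ∏ i ∈ Iᶜ, g i = ∏ i, if i ∈ I then f i else g i := by
  rw [← Finset.prod_mul_prod_compl I]
  congr 1
  · exact Finset.prod_congr rfl fun i hi => by rw [if_pos hi]
  · exact Finset.prod_congr rfl fun i hi => by rw [if_neg (Finset.mem_compl.1 hi)]

end Products

namespace SigmaFunction

variable (s : SigmaFunction)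

/-- The shifted factorial `[u] [u + δ] ⋯ [u + (k - 1) δ]` of complex numbers. -/
noncomputable def poch (δ u : ℂ) (k : ℕ) : ℂ := ∏ a ∈ Finset.range k, s (u + a * δ)

/-- The value of the coefficient `C_{μ,I}(x; y; δ, κ)` at complex points `x`, `y`. -/
noncomputable def coeffVal {m r : ℕ} (x : Fin m → ℂ) (y : Fin r → ℂ) (δ κ : ℂ) (μ : Fin m → ℕ)
    (I : Finset (Fin r)) : ℂ :=
  (-1) ^ I.card
    * (∏ i : Fin m, ∏ j ∈ Finset.Ioi i,
        s (x i - x j + ((μ i : ℂ) - (μ j : ℂ)) * δ) / s (x i - x j))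
    * (∏ i ∈ I, ∏ j ∈ Iᶜ, s (y i - y j - δ) / s (y i - y j))
    * (∏ i : Fin m, ∏ j : Fin m,
        s.poch δ (x i - x j + κ) (μ i) / s.poch δ (x i - x j + δ) (μ i))
    * ∏ i : Fin m,
        ((∏ j ∈ I, s (x i - y j - κ) / s (x i - y j + (μ i : ℂ) * δ))
          * ∏ j ∈ Iᶜ, s (x i - y j - δ) / s (x i - y j + ((μ i : ℂ) - 1) * δ))

/-- No non-trivial integer combination of `δ` and `κ` is a zero of the sigma function. -/
def Nonres (δ κ : ℂ) : Prop := ∀ a b : ℤ, (a, b) ≠ 0 → s (a * δ + b * κ) ≠ 0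

/-- The differences of the components of `z` avoid the zeros of the sigma function modulo the
lattice `ℤ δ + ℤ κ`. -/
def Generic {ι : Type*} (δ κ : ℂ) (z : ι → ℂ) : Prop :=
  ∀ i j, i ≠ j → ∀ a b : ℤ, s (z i - z j + a * δ + b * κ) ≠ 0

variable {s}

theorem Nonres.ne {δ κ : ℂ} (h : s.Nonres δ κ) (a b : ℤ) (hab : a ≠ 0 ∨ b ≠ 0) {w : ℂ}
    (hw : w = a * δ + b * κ) : s w ≠ 0 := by
  rw [hw]
  refine h a b fun h0 => ?_
  rw [Prod.mk_eq_zero] at h0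
  omega

theorem Generic.ne {ι : Type*} {δ κ : ℂ} {z : ι → ℂ} (h : s.Generic δ κ z) {i j : ι}
    (hij : i ≠ j) (a b : ℤ) {w : ℂ} (hw : w = z i - z j + a * δ + b * κ) : s w ≠ 0 :=
  hw ▸ h i j hij a b

theorem prod_div_telescope (h : ℤ → ℂ) (b : ℤ) (q : ℕ) (hb : h b ≠ 0)
    (hne : ∀ a : ℕ, a < q → h (b - a) ≠ 0) :
    ∏ a ∈ Finset.range q, h (b - a - 1) / h (b - a) = h (b - q) / h b := by
  induction q with
  | zero => simp [hb]
  | succ q ih =>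
    have h1 := hne q (by omega)
    rw [Finset.prod_range_succ, ih fun a ha => hne a (by omega)]
    rw [show b - ((q + 1 : ℕ) : ℤ) = b - q - 1 by push_cast; ring]
    field_simp

theorem poch_mul_poch {δ u : ℂ} (p q n : ℕ)
    (hne : ∀ b ∈ Finset.Ico p (p + n), ∀ a : ℕ, (a = 0 ∨ a < q) →
      s (u + ((b - a : ℤ) : ℂ) * δ) ≠ 0) :
    s.poch δ u p * s.poch δ (u + ((p : ℂ) - q) * δ) n =
      s.poch δ u (p + n) * ∏ a ∈ Finset.range q, ∏ b ∈ Finset.Ico p (p + n),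
        s (u + ((b - a - 1 : ℤ) : ℂ) * δ) / s (u + ((b - a : ℤ) : ℂ) * δ) := by
  have h1 : s.poch δ u (p + n) = s.poch δ u p * ∏ b ∈ Finset.Ico p (p + n), s (u + b * δ) := by
    rw [poch, poch, Finset.prod_range_mul_prod_Ico _ (Nat.le_add_right p n)]
  have h2 : s.poch δ (u + ((p : ℂ) - q) * δ) n =
      ∏ b ∈ Finset.Ico p (p + n), s (u + ((b - q : ℤ) : ℂ) * δ) := by
    rw [poch, Finset.prod_Ico_eq_prod_range, Nat.add_sub_cancel_left]
    refine Finset.prod_congr rfl fun a _ => ?_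
    congr 1
    push_cast
    ring
  have h3 : ∏ a ∈ Finset.range q, ∏ b ∈ Finset.Ico p (p + n),
        s (u + ((b - a - 1 : ℤ) : ℂ) * δ) / s (u + ((b - a : ℤ) : ℂ) * δ) =
      ∏ b ∈ Finset.Ico p (p + n), s (u + ((b - q : ℤ) : ℂ) * δ) / s (u + b * δ) := by
    rw [Finset.prod_comm]
    refine Finset.prod_congr rfl fun b hb => ?_
    have := prod_div_telescope (fun k : ℤ => s (u + k * δ)) b q
      (by simpa using hne b hb 0 (Or.inl rfl)) fun a ha => hne b hb a (Or.inr ha)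
    simpa using this
  have h4 : ∏ b ∈ Finset.Ico p (p + n), s (u + b * δ) ≠ 0 :=
    Finset.prod_ne_zero_iff.2 fun b hb => by simpa using hne b hb 0 (Or.inl rfl)
  rw [h1, h2, h3, Finset.prod_div_distrib, mul_assoc, mul_div_cancel₀ _ h4]

theorem poch_exch_identity {δ κ v : ℂ} (p q n : ℕ)
    (hδ : ∀ b ∈ Finset.Ico p (p + n), ∀ a : ℕ, (a = 0 ∨ a < q) →
      s (v + δ + ((b - a : ℤ) : ℂ) * δ) ≠ 0)
    (hκ : ∀ b ∈ Finset.Ico p (p + n), ∀ a : ℕ, (a = 0 ∨ a < q) →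
      s (v + κ + ((b - a : ℤ) : ℂ) * δ) ≠ 0) :
    s.poch δ (v + κ) p / s.poch δ (v + δ) p *
        (s.poch δ (v + ((p : ℂ) - q) * δ + κ) n / s.poch δ (v + ((p : ℂ) - q) * δ + δ) n) =
      s.poch δ (v + κ) (p + n) / s.poch δ (v + δ) (p + n) *
        ∏ a ∈ Finset.range q, ∏ b ∈ Finset.Ico p (p + n),
          s.exch δ κ (-v + ((a : ℂ) - b) * δ) := by
  rw [div_mul_div_comm, add_right_comm, add_right_comm v _ δ, poch_mul_poch p q n hκ,
    poch_mul_poch p q n hδ, mul_div_mul_comm, ← Finset.prod_div_distrib]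
  congr 1
  refine Finset.prod_congr rfl fun a ha => ?_
  rw [← Finset.prod_div_distrib]
  refine Finset.prod_congr rfl fun b hb => ?_
  have h1 := hκ b hb a (Or.inr (Finset.mem_range.1 ha))
  have h2 := hδ b hb a (Or.inr (Finset.mem_range.1 ha))
  rw [exch, show -v + ((a : ℂ) - b) * δ - δ = -(v + δ + ((b - a : ℤ) : ℂ) * δ) by
      push_cast; ring,
    show -v + ((a : ℂ) - b) * δ + δ - κ = -(v + κ + ((b - a - 1 : ℤ) : ℂ) * δ) by
      push_cast; ring,
    show -v + ((a : ℂ) - b) * δ - κ = -(v + κ + ((b - a : ℤ) : ℂ) * δ) by push_cast; ring,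
    show -v + ((a : ℂ) - b) * δ = -(v + δ + ((b - a - 1 : ℤ) : ℂ) * δ) by push_cast; ring,
    s.map_neg, s.map_neg, s.map_neg, s.map_neg, neg_mul_neg, neg_mul_neg, div_div_div_eq]
  congr 1 <;> ring

theorem prod_exch_add {δ κ d : ℂ} (k : ℕ) (h : ∀ a : ℤ, s (d + a * δ) ≠ 0)
    (h' : ∀ a : ℤ, s (d + a * δ - κ) ≠ 0) :
    ∏ a ∈ Finset.range k, s.exch δ κ (d + a * δ) =
      s (d - δ) * s (d + k * δ - κ) / (s (d + ((k : ℂ) - 1) * δ) * s (d - κ)) := by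
  induction k with
  | zero =>
    have h1 : s (d - δ) ≠ 0 := by simpa [sub_eq_add_neg] using h (-1)
    have h2 : s (d - κ) ≠ 0 := by simpa using h' 0
    simp only [Finset.range_zero, Finset.prod_empty, Nat.cast_zero, zero_mul, add_zero, zero_sub,
      neg_one_mul, ← sub_eq_add_neg]
    field_simp
  | succ k ih =>
    have h1 : s (d + ((k : ℂ) - 1) * δ) ≠ 0 := by simpa using h (k - 1)
    have h2 : s (d + k * δ) ≠ 0 := by simpa using h k
    have h3 : s (d + k * δ - κ) ≠ 0 := by simpa using h' k
    rw [Finset.prod_range_succ, ih, exch, show d + k * δ - δ = d + ((k : ℂ) - 1) * δ by ring,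
      show d + k * δ + δ - κ = d + ((k + 1 : ℕ) : ℂ) * δ - κ by push_cast; ring,
      show (((k + 1 : ℕ) : ℂ) - 1) = k by push_cast; ring]
    generalize s (d + ((k : ℂ) - 1) * δ) = u₁ at *
    generalize s (d + k * δ) = u₂ at *
    generalize s (d + k * δ - κ) = u₃ at *
    field_simp

theorem prod_exch_sub {δ κ d : ℂ} (p n : ℕ) (h : ∀ a : ℤ, s (d + a * δ) ≠ 0)
    (h' : ∀ a : ℤ, s (d + a * δ + κ) ≠ 0) :
    ∏ b ∈ Finset.Ico p (p + n), s.exch δ κ (-d - b * δ) =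
      s (d + (p + n) * δ) * s (d + ((p : ℂ) - 1) * δ + κ) /
        (s (d + p * δ) * s (d + ((p + n : ℂ) - 1) * δ + κ)) := by
  induction n with
  | zero =>
    have h1 : s (d + p * δ) ≠ 0 := by simpa using h p
    have h2 : s (d + ((p : ℂ) - 1) * δ + κ) ≠ 0 := by simpa using h' (p - 1)
    simp only [Finset.Ico_self, Finset.prod_empty, Nat.cast_zero, add_zero]
    rw [mul_comm (s (d + p * δ)), div_self (mul_ne_zero h2 h1)]
  | succ n ih =>
    have h1 : s (d + (p + n) * δ) ≠ 0 := by simpa using h (p + n)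
    have h2 : s (d + (p + n) * δ + κ) ≠ 0 := by simpa using h' (p + n)
    have h3 : s (d + ((p + n : ℂ) - 1) * δ + κ) ≠ 0 := by simpa using h' (p + n - 1)
    rw [← add_assoc, Finset.prod_Ico_succ_top (by omega), ih, exch,
      show -d - ((p + n : ℕ) : ℂ) * δ - δ = -(d + (p + ((n + 1 : ℕ) : ℂ)) * δ) by push_cast; ring,
      show -d - ((p + n : ℕ) : ℂ) * δ + δ - κ = -(d + ((p + n : ℂ) - 1) * δ + κ) by
        push_cast; ring,
      show -d - ((p + n : ℕ) : ℂ) * δ - κ = -(d + (p + n) * δ + κ) by push_cast; ring,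
      show -d - ((p + n : ℕ) : ℂ) * δ = -(d + (p + n) * δ) by push_cast; ring,
      show (p + ((n + 1 : ℕ) : ℂ)) - 1 = p + n by push_cast; ring,
      s.map_neg, s.map_neg, s.map_neg, s.map_neg]
    generalize s (d + (p + n) * δ) = u₁ at *
    generalize s (d + (p + n) * δ + κ) = u₂ at *
    generalize s (d + ((p + n : ℂ) - 1) * δ + κ) = u₃ at *
    field_simp

end SigmaFunction

/-! ### Products of two coefficients of the same family -/

namespace SigmaFunction

variable {s : SigmaFunction} {m r : ℕ} {x : Fin m → ℂ} {y : Fin r → ℂ} {δ κ : ℂ}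

theorem Generic.xx (h : s.Generic δ κ (Sum.elim x y)) {i j : Fin m} (hij : i ≠ j) (a b : ℤ)
    {w : ℂ} (hw : w = x i - x j + a * δ + b * κ) : s w ≠ 0 :=
  Generic.ne h (i := Sum.inl i) (j := Sum.inl j) (by simpa using hij) a b hw

theorem Generic.yy (h : s.Generic δ κ (Sum.elim x y)) {i j : Fin r} (hij : i ≠ j) (a b : ℤ)
    {w : ℂ} (hw : w = y i - y j + a * δ + b * κ) : s w ≠ 0 :=
  Generic.ne h (i := Sum.inr i) (j := Sum.inr j) (by simpa using hij) a b hw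

theorem Generic.xy (h : s.Generic δ κ (Sum.elim x y)) (i : Fin m) (j : Fin r) (a b : ℤ)
    {w : ℂ} (hw : w = x i - y j + a * δ + b * κ) : s w ≠ 0 :=
  Generic.ne h (i := Sum.inl i) (j := Sum.inr j) (by simp) a b hw

theorem vandermonde_identity (h : s.Generic δ κ (Sum.elim x y)) (μ ν : Fin m → ℕ) :
    (∏ i : Fin m, ∏ j ∈ Finset.Ioi i,
        s (x i - x j + ((μ i : ℂ) - (μ j : ℂ)) * δ) / s (x i - x j)) *
      (∏ i : Fin m, ∏ j ∈ Finset.Ioi i,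
        s (x i + δ * μ i - (x j + δ * μ j) + ((ν i : ℂ) - (ν j : ℂ)) * δ) /
          s (x i + δ * μ i - (x j + δ * μ j))) =
      ∏ i : Fin m, ∏ j ∈ Finset.Ioi i,
        s (x i - x j + (((μ i + ν i : ℕ) : ℂ) - ((μ j + ν j : ℕ) : ℂ)) * δ) / s (x i - x j) := by
  rw [← Finset.prod_mul_distrib]
  refine Finset.prod_congr rfl fun i _ => ?_
  rw [← Finset.prod_mul_distrib]
  refine Finset.prod_congr rfl fun j hj => ?_
  have hij : i ≠ j := (Finset.mem_Ioi.1 hj).ne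
  have h1 : s (x i - x j + ((μ i : ℂ) - (μ j : ℂ)) * δ) ≠ 0 :=
    h.xx hij (μ i - μ j) 0 (by push_cast; ring)
  rw [show x i + δ * μ i - (x j + δ * μ j) = x i - x j + ((μ i : ℂ) - (μ j : ℂ)) * δ by ring,
    show x i - x j + ((μ i : ℂ) - (μ j : ℂ)) * δ + ((ν i : ℂ) - (ν j : ℂ)) * δ =
      x i - x j + (((μ i + ν i : ℕ) : ℂ) - ((μ j + ν j : ℕ) : ℂ)) * δ by push_cast; ring,
    mul_comm, div_mul_div_cancel₀ h1]

theorem poch_identity (h : s.Generic δ κ (Sum.elim x y)) (hn : s.Nonres δ κ) (μ ν : Fin m → ℕ) :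
    (∏ i : Fin m, ∏ j : Fin m,
        s.poch δ (x i - x j + κ) (μ i) / s.poch δ (x i - x j + δ) (μ i)) *
      (∏ i : Fin m, ∏ j : Fin m,
        s.poch δ (x i + δ * μ i - (x j + δ * μ j) + κ) (ν i) /
          s.poch δ (x i + δ * μ i - (x j + δ * μ j) + δ) (ν i)) =
      (∏ i : Fin m, ∏ j : Fin m,
        s.poch δ (x i - x j + κ) (μ i + ν i) / s.poch δ (x i - x j + δ) (μ i + ν i)) *
        ∏ i : Fin m, ∏ j : Fin m, ∏ a ∈ Finset.range (μ i),
          ∏ b ∈ Finset.Ico (μ j) (μ j + ν j), s.exch δ κ (x i - x j + ((a : ℂ) - b) * δ) := by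
  rw [Finset.prod_comm (f := fun i j => ∏ a ∈ Finset.range (μ i),
    ∏ b ∈ Finset.Ico (μ j) (μ j + ν j), s.exch δ κ (x i - x j + ((a : ℂ) - b) * δ))]
  simp only [← Finset.prod_mul_distrib]
  refine Finset.prod_congr rfl fun i _ => Finset.prod_congr rfl fun j _ => ?_
  rw [show x i + δ * μ i - (x j + δ * μ j) = x i - x j + ((μ i : ℂ) - (μ j : ℂ)) * δ by ring,
    poch_exch_identity (μ i) (μ j) (ν i), neg_sub]
  · intro b hb a ha
    rw [Finset.mem_Ico] at hb
    by_cases hij : i = j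
    · subst hij
      exact hn.ne (b - a + 1) 0 (Or.inl (by omega)) (by push_cast; ring)
    · exact h.xx hij (b - a + 1) 0 (by push_cast; ring)
  · intro b hb a ha
    by_cases hij : i = j
    · subst hij
      exact hn.ne (b - a) 1 (Or.inr (by omega)) (by push_cast; ring)
    · exact h.xx hij (b - a) 1 (by push_cast; ring)

/-- The contribution of the pair `y i`, `y j` to the part of a product of two coefficients
`C_{μ,I}`, `C_{ν,J}` that depends only on `A = I ∩ J` and `U = I ∪ J`. -/
noncomputable def yyConst (s : SigmaFunction) (δ κ : ℂ) (y : Fin r → ℂ) (A U : Finset (Fin r))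
    (i j : Fin r) : ℂ :=
  if i ∈ A then
    if j ∈ A then 1
    else if j ∈ U then s (y i - y j - δ) / s (y i - y j)
    else s (y i - y j - δ) / s (y i - y j) * (s (y i - y j - κ - δ) / s (y i - y j - κ))
  else if i ∈ U then
    if j ∈ U then 1 else s (y i - y j - δ) / s (y i - y j)
  else 1

theorem yy_identity (I J : Finset (Fin r)) :
    (∏ i ∈ I, ∏ j ∈ Iᶜ, s (y i - y j - δ) / s (y i - y j)) *
      (∏ i ∈ J, ∏ j ∈ Jᶜ, s (y i + (if i ∈ I then -κ else 0) - (y j + if j ∈ I then -κ else 0) - δ)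
        / s (y i + (if i ∈ I then -κ else 0) - (y j + if j ∈ I then -κ else 0))) =
      (∏ i, ∏ j, s.yyConst δ κ y (I ∩ J) (I ∪ J) i j) *
        ∏ i ∈ I \ J, ∏ j ∈ J \ I, s.exch δ κ (y i - y j) := by
  set F : Fin r → Fin r → ℂ := fun i j =>
    s (y i + (if i ∈ I then -κ else 0) - (y j + if j ∈ I then -κ else 0) - δ)
        / s (y i + (if i ∈ I then -κ else 0) - (y j + if j ∈ I then -κ else 0)) with hF
  have e : ∏ i ∈ J, ∏ j ∈ Jᶜ, F i j =
      (∏ i, ∏ j, if i ∈ J ∧ j ∉ J ∧ ¬(i ∉ I ∧ j ∈ I) then F i j else 1) *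
        ∏ i, ∏ j, if j ∈ J ∧ i ∉ J ∧ (j ∉ I ∧ i ∈ I) then F j i else 1 := by
    rw [Finset.prod_comm (f := fun i j => if j ∈ J ∧ i ∉ J ∧ (j ∉ I ∧ i ∈ I) then F j i else 1)]
    simp only [← Finset.prod_mul_distrib]
    rw [Finset.prod_mem_eq_prod_ite]
    refine Finset.prod_congr rfl fun i _ => ?_
    by_cases hi : i ∈ J
    · rw [if_pos hi, Finset.prod_mem_eq_prod_ite]
      refine Finset.prod_congr rfl fun j _ => ?_
      by_cases hj : j ∈ J <;> by_cases hi' : i ∈ I <;> by_cases hj' : j ∈ I <;> simp [*]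
    · rw [if_neg hi]
      symm
      refine Finset.prod_eq_one fun j _ => ?_
      simp [hi]
  rw [e, Finset.prod_mem_eq_prod_ite I, Finset.prod_mem_eq_prod_ite (I \ J)]
  simp only [← Finset.prod_mul_distrib]
  refine Finset.prod_congr rfl fun i _ => ?_
  rw [Finset.prod_mem_eq_prod_ite Iᶜ, Finset.prod_mem_eq_prod_ite (J \ I)]
  rw [← Finset.prod_const_one (s := (Finset.univ : Finset (Fin r))) (M := ℂ), ← apply_ite
    (fun f : Fin r → ℂ => ∏ j, f j), ← apply_ite (fun f : Fin r → ℂ => ∏ j, f j)]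
  simp only [← Finset.prod_mul_distrib]
  refine Finset.prod_congr rfl fun j _ => ?_
  have hexch : s.exch δ κ (y i - y j) = s (y i - y j - δ) / s (y i - y j) *
      (s (y j - (y i + -κ) - δ) / s (y j - (y i + -κ))) := by
    rw [show y j - (y i + -κ) - δ = -(y i - y j + δ - κ) by ring,
      show y j - (y i + -κ) = -(y i - y j - κ) by ring, s.map_neg, s.map_neg, neg_div_neg_eq,
      exch, mul_div_mul_comm]
  have h1 : y i + -κ - (y j + -κ) = y i - y j := by ring
  have h2 : y i + -κ - y j = y i - y j - κ := by ring
  by_cases hi : i ∈ I <;> by_cases hj : j ∈ I <;> by_cases hi' : i ∈ J <;> by_cases hj' : j ∈ J <;>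
    simp [yyConst, *]

/-- The contribution of a pair `x i`, `y j` with `x i - y j = d` to the part of a product of
two coefficients `C_{μ,I}`, `C_{ν,J}` that depends only on `l = μ i + ν i`, `A = I ∩ J` and
`U = I ∪ J`. -/
noncomputable def xyConst (s : SigmaFunction) (δ κ d : ℂ) (l : ℕ) (A U : Finset (Fin r))
    (j : Fin r) : ℂ :=
  if j ∈ A then s (d - κ) / s (d + l * δ + κ)
  else if j ∈ U then s (d - κ) / s (d + l * δ)
  else s (d - δ) / s (d + ((l : ℂ) - 1) * δ)

theorem xy_identity (h : s.Generic δ κ (Sum.elim x y)) (μ ν : Fin m → ℕ) (I J : Finset (Fin r)) :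
    (∏ i : Fin m,
        ((∏ j ∈ I, s (x i - y j - κ) / s (x i - y j + (μ i : ℂ) * δ))
          * ∏ j ∈ Iᶜ, s (x i - y j - δ) / s (x i - y j + ((μ i : ℂ) - 1) * δ))) *
      (∏ i : Fin m,
        ((∏ j ∈ J, s (x i + δ * μ i - (y j + if j ∈ I then -κ else 0) - κ) /
            s (x i + δ * μ i - (y j + if j ∈ I then -κ else 0) + (ν i : ℂ) * δ))
          * ∏ j ∈ Jᶜ, s (x i + δ * μ i - (y j + if j ∈ I then -κ else 0) - δ) /
            s (x i + δ * μ i - (y j + if j ∈ I then -κ else 0) + ((ν i : ℂ) - 1) * δ))) =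
      (∏ i, ∏ j, s.xyConst δ κ (x i - y j) (μ i + ν i) (I ∩ J) (I ∪ J) j) *
        ((∏ i, ∏ j ∈ J \ I, ∏ a ∈ Finset.range (μ i), s.exch δ κ (x i - y j + a * δ)) *
          ∏ i, ∏ j ∈ I \ J, ∏ b ∈ Finset.Ico (μ i) (μ i + ν i),
            s.exch δ κ (-(x i - y j) - b * δ)) := by
  simp only [← Finset.prod_mul_distrib]
  refine Finset.prod_congr rfl fun i _ => ?_
  rw [Finset.prod_mul_prod_compl_eq_prod_ite, Finset.prod_mul_prod_compl_eq_prod_ite,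
    Finset.prod_mem_eq_prod_ite (J \ I), Finset.prod_mem_eq_prod_ite (I \ J)]
  simp only [← Finset.prod_mul_distrib]
  refine Finset.prod_congr rfl fun j _ => ?_
  set d := x i - y j with hd
  have g0 : ∀ a : ℤ, s (d + a * δ) ≠ 0 := fun a => h.xy i j a 0 (by push_cast; ring)
  have g1 : ∀ a : ℤ, s (d + a * δ - κ) ≠ 0 := fun a => h.xy i j a (-1) (by push_cast; ring)
  have g2 : ∀ a : ℤ, s (d + a * δ + κ) ≠ 0 := fun a => h.xy i j a 1 (by push_cast; ring)
  have k1 : s (d + (μ i : ℂ) * δ) ≠ 0 := by simpa using g0 (μ i)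
  have k2 : s (d - κ) ≠ 0 := by simpa using g1 0
  have k3 : s (d + ((μ i : ℂ) - 1) * δ) ≠ 0 := by simpa using g0 (μ i - 1)
  have k4 : s (d + ((μ i : ℂ) + ν i) * δ) ≠ 0 := by simpa using g0 (μ i + ν i)
  have k5 : s (d + ((μ i : ℂ) - 1) * δ + κ) ≠ 0 := by simpa using g2 (μ i - 1)
  have k6 : s (d + ((μ i + ν i : ℂ) - 1) * δ + κ) ≠ 0 := by simpa using g2 (μ i + ν i - 1)
  rw [prod_exch_add (μ i) g0 g1, prod_exch_sub (μ i) (ν i) g0 g2]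
  have c1 : x i + δ * μ i - (y j + -κ) - κ = d + μ i * δ := by rw [hd]; ring
  have c2 : x i + δ * μ i - (y j + -κ) + ν i * δ = d + ((μ i : ℂ) + ν i) * δ + κ := by
    rw [hd]; ring
  have c3 : x i + δ * μ i - (y j + -κ) - δ = d + ((μ i : ℂ) - 1) * δ + κ := by rw [hd]; ring
  have c4 : x i + δ * μ i - (y j + -κ) + ((ν i : ℂ) - 1) * δ =
      d + ((μ i + ν i : ℂ) - 1) * δ + κ := by rw [hd]; ring
  have c5 : x i + δ * μ i - y j - κ = d + μ i * δ - κ := by rw [hd]; ring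
  have c6 : x i + δ * μ i - y j + ν i * δ = d + ((μ i : ℂ) + ν i) * δ := by rw [hd]; ring
  have c7 : x i + δ * μ i - y j - δ = d + ((μ i : ℂ) - 1) * δ := by rw [hd]; ring
  have c8 : x i + δ * μ i - y j + ((ν i : ℂ) - 1) * δ = d + ((μ i + ν i : ℂ) - 1) * δ := by
    rw [hd]; ring
  by_cases hI : j ∈ I <;> by_cases hJ : j ∈ J <;>
    simp only [hI, hJ, xyConst, Finset.mem_inter, Finset.mem_union, Finset.mem_sdiff, if_true,
      if_false, and_true, and_false, and_self, or_self, or_true, true_or, not_true,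
      not_false_iff, mul_one, one_mul, add_zero, c1, c2, c3, c4, c5, c6, c7, c8, Nat.cast_add]
  · generalize s (d + (μ i : ℂ) * δ) = u₁ at *
    field_simp
  · generalize s (d + (μ i : ℂ) * δ) = u₁ at *
    generalize s (d + ((μ i : ℂ) + ν i) * δ) = u₂ at *
    generalize s (d + ((μ i : ℂ) - 1) * δ + κ) = u₃ at *
    generalize s (d + ((μ i + ν i : ℂ) - 1) * δ + κ) = u₄ at *
    field_simp
  · generalize s (d + ((μ i : ℂ) - 1) * δ) = u₁ at *
    generalize s (d + ((μ i : ℂ) + ν i) * δ) = u₂ at *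
    generalize s (d + (μ i : ℂ) * δ - κ) = u₃ at *
    field_simp
  · generalize s (d + ((μ i : ℂ) - 1) * δ) = u₁ at *
    field_simp

/-- The index set of the points `x i + a δ`, `a < μ i`, and `y j`, `j ∈ I`. -/
def segs (μ : Fin m → ℕ) (I : Finset (Fin r)) : Finset ((Σ _ : Fin m, ℕ) ⊕ Fin r) :=
  (Finset.univ.sigma fun i => Finset.range (μ i)).disjSum I

/-- The points `x i + a δ` and `y j`. -/
noncomputable def segPoint (δ : ℂ) (x : Fin m → ℂ) (y : Fin r → ℂ) :
    ((Σ _ : Fin m, ℕ) ⊕ Fin r) → ℂ :=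
  Sum.elim (fun p => x p.1 + p.2 * δ) y

theorem segs_sdiff_segs (μ ν : Fin m → ℕ) (I J : Finset (Fin r)) :
    segs (μ + ν) J \ segs μ I =
      (Finset.univ.sigma fun i => Finset.Ico (μ i) (μ i + ν i)).disjSum (J \ I) := by
  ext (⟨i, a⟩ | j)
  · simp [segs]
    omega
  · simp [segs]

theorem exchProd_segs (μ ν : Fin m → ℕ) (I J : Finset (Fin r)) :
    s.exchProd δ κ (segPoint δ x y) (segs μ I)
        ((Finset.univ.sigma fun i => Finset.Ico (μ i) (μ i + ν i)).disjSum J) =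
      (∏ i : Fin m, ∏ j : Fin m, ∏ a ∈ Finset.range (μ i),
          ∏ b ∈ Finset.Ico (μ j) (μ j + ν j), s.exch δ κ (x i - x j + ((a : ℂ) - b) * δ)) *
        ((∏ i, ∏ j ∈ J, ∏ a ∈ Finset.range (μ i), s.exch δ κ (x i - y j + a * δ)) *
          ∏ i, ∏ j ∈ I, ∏ b ∈ Finset.Ico (μ i) (μ i + ν i),
            s.exch δ κ (-(x i - y j) - b * δ)) *
        ∏ i ∈ I, ∏ j ∈ J, s.exch δ κ (y i - y j) := by
  simp only [exchProd, segs, Finset.prod_disjSum, Finset.prod_sigma, Finset.prod_mul_distrib,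
    segPoint, Sum.elim_inl, Sum.elim_inr]
  have e1 : ∀ i : Fin m, (∏ a ∈ Finset.range (μ i), ∏ j : Fin m,
      ∏ b ∈ Finset.Ico (μ j) (μ j + ν j), s.exch δ κ (x i + a * δ - (x j + b * δ))) =
      ∏ j : Fin m, ∏ a ∈ Finset.range (μ i),
          ∏ b ∈ Finset.Ico (μ j) (μ j + ν j), s.exch δ κ (x i - x j + ((a : ℂ) - b) * δ) := by
    intro i
    rw [Finset.prod_comm]
    refine Finset.prod_congr rfl fun j _ => Finset.prod_congr rfl fun a _ =>
      Finset.prod_congr rfl fun b _ => ?_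
    congr 1
    ring
  have e2 : ∀ i : Fin m, (∏ a ∈ Finset.range (μ i), ∏ j ∈ J,
      s.exch δ κ (x i + a * δ - y j)) =
      ∏ j ∈ J, ∏ a ∈ Finset.range (μ i), s.exch δ κ (x i - y j + a * δ) := by
    intro i
    rw [Finset.prod_comm]
    refine Finset.prod_congr rfl fun j _ => Finset.prod_congr rfl fun a _ => ?_
    congr 1
    ring
  have e3 : (∏ j ∈ I, ∏ i : Fin m, ∏ b ∈ Finset.Ico (μ i) (μ i + ν i),
      s.exch δ κ (y j - (x i + b * δ))) =
      ∏ i : Fin m, ∏ j ∈ I, ∏ b ∈ Finset.Ico (μ i) (μ i + ν i),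
        s.exch δ κ (-(x i - y j) - b * δ) := by
    rw [Finset.prod_comm]
    refine Finset.prod_congr rfl fun j _ => Finset.prod_congr rfl fun a _ =>
      Finset.prod_congr rfl fun b _ => ?_
    congr 1
    ring
  simp only [e1, e2, e3]
  ring

/-- The part of a product of two coefficients that depends only on the total shift. -/
noncomputable def coeffConst (s : SigmaFunction) (x : Fin m → ℂ) (y : Fin r → ℂ) (δ κ : ℂ)
    (l : Fin m → ℕ) (A U : Finset (Fin r)) : ℂ :=
  (-1) ^ (U.card + A.card) *
    (∏ i : Fin m, ∏ j ∈ Finset.Ioi i,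
        s (x i - x j + ((l i : ℂ) - (l j : ℂ)) * δ) / s (x i - x j)) *
    (∏ i, ∏ j, s.yyConst δ κ y A U i j) *
    (∏ i : Fin m, ∏ j : Fin m, s.poch δ (x i - x j + κ) (l i) / s.poch δ (x i - x j + δ) (l i)) *
    ∏ i, ∏ j, s.xyConst δ κ (x i - y j) (l i) A U j

/-- A product of two coefficients, as it appears in a product of two operators, is a summand of the
source identity up to a factor that depends only on the total shift. -/
theorem coeffVal_mul_coeffVal (h : s.Generic δ κ (Sum.elim x y)) (hn : s.Nonres δ κ)
    (μ ν : Fin m → ℕ) (I J : Finset (Fin r)) :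
    s.coeffVal x y δ κ μ I *
      s.coeffVal (fun i => x i + δ * μ i) (fun j => y j + if j ∈ I then -κ else 0) δ κ ν J =
      s.coeffConst x y δ κ (μ + ν) (I ∩ J) (I ∪ J) *
        s.exchProd δ κ (segPoint δ x y) (segs μ (I \ J))
          (segs (μ + ν) ((I ∪ J) \ (I ∩ J)) \ segs μ (I \ J)) := by
  have hJ : ((I ∪ J) \ (I ∩ J)) \ (I \ J) = J \ I := by
    ext j
    simp only [Finset.mem_sdiff, Finset.mem_union, Finset.mem_inter]
    tauto
  rw [segs_sdiff_segs, hJ, exchProd_segs, coeffConst, Finset.card_union_add_card_inter, pow_add]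
  have e1 := vandermonde_identity h μ ν
  have e2 := yy_identity (s := s) (y := y) (δ := δ) (κ := κ) I J
  have e3 := poch_identity h hn μ ν
  have e4 := xy_identity h μ ν I J
  simp only [coeffVal, Pi.add_apply]
  have hcomb : ∀ a₁ a₂ a₃ a₄ a₅ b₁ b₂ b₃ b₄ b₅ : ℂ,
      a₁ * a₂ * a₃ * a₄ * a₅ * (b₁ * b₂ * b₃ * b₄ * b₅) =
        a₁ * b₁ * (a₂ * b₂) * (a₃ * b₃) * (a₄ * b₄) * (a₅ * b₅) := by intros; ring
  rw [hcomb, e1, e2, e3, e4]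
  ring

end SigmaFunction

/-! ### Commutation at the level of coefficients -/

namespace SigmaFunction

variable {s : SigmaFunction} {m r : ℕ} {x : Fin m → ℂ} {y : Fin r → ℂ} {δ κ : ℂ}

theorem mem_segs_inl {μ : Fin m → ℕ} {I : Finset (Fin r)} {i : Fin m} {a : ℕ} :
    Sum.inl ⟨i, a⟩ ∈ segs μ I ↔ a < μ i := by
  simp [segs]

theorem mem_segs_inr {μ : Fin m → ℕ} {I : Finset (Fin r)} {j : Fin r} :
    Sum.inr j ∈ segs μ I ↔ j ∈ I := by
  simp [segs]

theorem card_segs (μ : Fin m → ℕ) (I : Finset (Fin r)) :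
    (segs μ I).card = ∑ i, μ i + I.card := by
  simp [segs, Finset.card_disjSum]

theorem segs_injective {μ ν : Fin m → ℕ} {I J : Finset (Fin r)} (h : segs μ I = segs ν J) :
    μ = ν ∧ I = J := by
  constructor
  · funext i
    refine eq_of_forall_lt_iff fun a => ?_
    rw [← mem_segs_inl (I := I), h, mem_segs_inl]
  · ext j
    rw [← mem_segs_inr (μ := μ), h, mem_segs_inr]

theorem segs_subset {μ ν : Fin m → ℕ} {I J : Finset (Fin r)} (h : μ ≤ ν) (hIJ : I ⊆ J) :
    segs μ I ⊆ segs ν J := by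
  rintro (⟨i, a⟩ | j) hp
  · rw [mem_segs_inl] at hp ⊢
    exact hp.trans_le (h i)
  · rw [mem_segs_inr] at hp ⊢
    exact hIJ hp

/-- The subsets that contribute to the source identity for the points `x i + a δ` and `y j` are
initial in each string `x i, x i + δ, …`. -/
theorem exists_segs_of_exchProd_ne_zero {l : Fin m → ℕ} {B : Finset (Fin r)}
    {T : Finset ((Σ _ : Fin m, ℕ) ⊕ Fin r)} (hT : T ⊆ segs l B)
    (h : s.exchProd δ κ (segPoint δ x y) T (segs l B \ T) ≠ 0) :
    ∃ μ I, μ ≤ l ∧ I ⊆ B ∧ T = segs μ I := by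
  have hex : ∀ i : Fin m, ∃ a : ℕ, Sum.inl ⟨i, a⟩ ∉ T := fun i =>
    ⟨l i, fun h => lt_irrefl _ (mem_segs_inl.1 (hT h))⟩
  have hdown : ∀ (i : Fin m) (a : ℕ), Sum.inl ⟨i, a⟩ ∉ T → Sum.inl ⟨i, a + 1⟩ ∉ T := by
    intro i a ha ha'
    refine h ?_
    have hmem : Sum.inl ⟨i, a⟩ ∈ segs l B \ T := by
      refine Finset.mem_sdiff.2 ⟨mem_segs_inl.2 ?_, ha⟩
      have := mem_segs_inl.1 (hT ha')
      omega
    rw [exchProd]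
    refine Finset.prod_eq_zero ha' (Finset.prod_eq_zero hmem ?_)
    simp only [segPoint, Sum.elim_inl, exch]
    rw [show x i + ((a + 1 : ℕ) : ℂ) * δ - (x i + a * δ) - δ = 0 by push_cast; ring, s.map_zero]
    simp
  classical
  refine ⟨fun i => Nat.find (hex i), Finset.univ.filter fun j => Sum.inr j ∈ T, ?_, ?_, ?_⟩
  · intro i
    exact Nat.find_min' (hex i) fun h => lt_irrefl _ (mem_segs_inl.1 (hT h))
  · intro j hj
    exact mem_segs_inr.1 (hT (Finset.mem_filter.1 hj).2)
  · ext (⟨i, a⟩ | j)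
    · rw [mem_segs_inl]
      constructor
      · intro ha
        by_contra hle
        rw [not_lt] at hle
        have : ∀ b, Nat.find (hex i) ≤ b → Sum.inl ⟨i, b⟩ ∉ T := fun b hb => by
          induction b, hb using Nat.le_induction with
          | base => exact Nat.find_spec (hex i)
          | succ b _ ih => exact hdown i b ih
        exact this a hle ha
      · intro ha
        by_contra hmem
        exact Nat.find_min (hex i) ha hmem
    · rw [mem_segs_inr]
      simp

/-- The shifts of a product of two operators are determined by `μ + ν`, `I ∩ J` and `I ∪ J`. -/
def shiftKey (p q : (Fin m → ℕ) × Finset (Fin r)) :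
    (Fin m → ℕ) × Finset (Fin r) × Finset (Fin r) :=
  (p.1 + q.1, p.2 ∩ q.2, p.2 ∪ q.2)

/-- The coefficient of a given total shift in a product of two operators. -/
noncomputable def shiftCoeff (s : SigmaFunction) (x : Fin m → ℂ) (y : Fin r → ℂ) (δ κ : ℂ)
    (k l : ℕ) (t : (Fin m → ℕ) × Finset (Fin r) × Finset (Fin r)) : ℂ :=
  ∑ p ∈ (deformedIndex m r k ×ˢ deformedIndex m r l).filter (fun p => shiftKey p.1 p.2 = t),
    s.coeffVal x y δ κ p.1.1 p.1.2 *
      s.coeffVal (fun i => x i + δ * p.1.1 i) (fun j => y j + if j ∈ p.1.2 then -κ else 0) δ κ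
        p.2.1 p.2.2

/-- The total weight of a shift in a product of two operators is a sum as in the source identity. -/
theorem shiftCoeff_eq (h : s.Generic δ κ (Sum.elim x y)) (hn : s.Nonres δ κ) {k l k' l' : ℕ}
    {t : (Fin m → ℕ) × Finset (Fin r) × Finset (Fin r)} (ht : t.2.1 ⊆ t.2.2)
    (hk : k' + t.2.1.card = k) (hl : l' + t.2.1.card = l)
    (hkl : (segs t.1 (t.2.2 \ t.2.1)).card = k' + l') :
    s.shiftCoeff x y δ κ k l t = s.coeffConst x y δ κ t.1 t.2.1 t.2.2 *
      s.exchSum δ κ (segPoint δ x y) (segs t.1 (t.2.2 \ t.2.1)) k' := by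
  rw [shiftCoeff, exchSum, Finset.mul_sum]
  obtain ⟨L, A, U⟩ := t
  dsimp only at *
  have hBA := Finset.card_sdiff_add_card_eq_card ht
  rw [card_segs] at hkl
  refine Finset.sum_of_injOn (fun p => segs p.1.1 (p.1.2 \ p.2.2)) ?_ ?_ ?_ ?_
  · rintro ⟨⟨μ, I⟩, ν, J⟩ hp ⟨⟨μ', I'⟩, ν', J'⟩ hp' he
    simp only [Finset.coe_filter, Set.mem_ofPred_eq, shiftKey, Prod.mk.injEq] at hp hp'
    obtain ⟨h1, h2⟩ := segs_injective he
    obtain ⟨-, h3, h4, h5⟩ := hp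
    obtain ⟨-, h3', h4', h5'⟩ := hp'
    dsimp only at h1 h2
    have e1 : ν = ν' := by
      subst h1
      exact add_left_cancel (h3.trans h3'.symm)
    have e2 : I = I' := by
      rw [← Finset.sdiff_union_inter I J, ← Finset.sdiff_union_inter I' J', h2, h4, h4']
    have e3 : ∀ I J : Finset (Fin r), I ∩ J = A → I ∪ J = U → J = A ∪ (U \ I) := by
      rintro I J rfl rfl
      ext j
      simp only [Finset.mem_union, Finset.mem_inter, Finset.mem_sdiff]
      tauto
    rw [h1, e1, e3 I J h4 h5, e3 I' J' h4' h5', e2]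
  · rintro ⟨⟨μ, I⟩, ν, J⟩ hp
    simp only [Finset.coe_filter, Set.mem_ofPred_eq, shiftKey, Prod.mk.injEq, Finset.mem_product,
      mem_deformedIndex] at hp
    obtain ⟨⟨h1, h2⟩, rfl, rfl, rfl⟩ := hp
    rw [Finset.mem_coe, Finset.mem_powersetCard, card_segs]
    refine ⟨segs_subset (fun i => Nat.le_add_right _ _) ?_, ?_⟩
    · intro j
      simp only [Finset.mem_union, Finset.mem_inter, Finset.mem_sdiff]
      tauto
    · have := Finset.card_sdiff_add_card_inter I J
      dsimp only
      omega
  · intro T hT hT'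
    rw [Finset.mem_powersetCard] at hT
    by_contra hne
    obtain ⟨μ, I₀, hμ, hI, rfl⟩ := exists_segs_of_exchProd_ne_zero hT.1 (right_ne_zero_of_mul hne)
    refine hT' ⟨((μ, A ∪ I₀), (L - μ, A ∪ ((U \ A) \ I₀))), ?_, ?_⟩
    · have hA : Disjoint A I₀ := (Finset.disjoint_sdiff).mono_right hI
      have hA' : Disjoint A ((U \ A) \ I₀) :=
        (Finset.disjoint_sdiff).mono_right Finset.sdiff_subset
      have c1 := hT.2
      rw [card_segs] at c1
      have c2 := Finset.card_sdiff_add_card_eq_card hI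
      have c3 : ∑ i, (L - μ) i + ∑ i, μ i = ∑ i, L i := by
        rw [← Finset.sum_add_distrib]
        exact Finset.sum_congr rfl fun i _ => Nat.sub_add_cancel (hμ i)
      simp only [Finset.coe_filter, Set.mem_ofPred_eq, shiftKey, Prod.mk.injEq, Finset.mem_product,
        mem_deformedIndex, Finset.card_union_of_disjoint hA, Finset.card_union_of_disjoint hA']
      refine ⟨⟨by omega, by omega⟩, add_tsub_cancel_of_le hμ, ?_, ?_⟩
      · ext j
        simp only [Finset.mem_union, Finset.mem_inter, Finset.mem_sdiff]
        tauto
      · ext j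
        have h1 := @ht j
        have h2 := @hI j
        simp only [Finset.mem_union, Finset.mem_sdiff] at *
        tauto
    · dsimp only
      congr 1
      ext j
      have h2 := @hI j
      simp only [Finset.mem_union, Finset.mem_sdiff] at *
      tauto
  · rintro ⟨⟨μ, I⟩, ν, J⟩ hp
    simp only [Finset.mem_filter, shiftKey, Prod.mk.injEq] at hp
    obtain ⟨-, rfl, rfl, rfl⟩ := hp
    exact coeffVal_mul_coeffVal h hn μ ν I J

theorem strongSep_segPoint (h : s.Generic δ κ (Sum.elim x y)) (hn : s.Nonres δ κ)
    (σ : Finset ((Σ _ : Fin m, ℕ) ⊕ Fin r)) : s.StrongSep κ (segPoint δ x y) σ := by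
  rintro (⟨i, a⟩ | j) - (⟨i', a'⟩ | j') - hne n
  · by_cases hi : i = i'
    · subst hi
      have ha : a ≠ a' := fun h => hne (by rw [h])
      exact hn.ne (a - a') n (Or.inl (by omega)) (by simp [segPoint]; ring)
    · exact h.xx hi (a - a') n (by simp [segPoint]; ring)
  · exact h.xy i j' a n (by simp [segPoint]; ring)
  · rw [← neg_ne_zero, ← s.map_neg]
    exact h.xy i' j a' (-n) (by simp [segPoint]; ring)
  · exact h.yy (i := j) (j := j') (fun h => hne (by rw [h])) 0 n (by simp [segPoint])

/-- Passing to complements reverses the arguments of the two-body factors. -/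
theorem exchSum_compl {ι : Type*} [DecidableEq ι] (a b : ℂ) (z : ι → ℂ) (σ : Finset ι) {k l : ℕ}
    (hkl : σ.card = k + l) : s.exchSum a b z σ l = s.exchSum (-a) (-b) z σ k := by
  refine Finset.sum_bij' (fun I _ => σ \ I) (fun I _ => σ \ I) ?_ ?_ ?_ ?_ ?_
  · intro I hI
    rw [Finset.mem_powersetCard] at hI ⊢
    exact ⟨Finset.sdiff_subset, by rw [Finset.card_sdiff_of_subset hI.1]; omega⟩
  · intro I hI
    rw [Finset.mem_powersetCard] at hI ⊢
    exact ⟨Finset.sdiff_subset, by rw [Finset.card_sdiff_of_subset hI.1]; omega⟩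
  · intro I hI
    exact Finset.sdiff_sdiff_eq_self (Finset.mem_powersetCard.1 hI).1
  · intro I hI
    exact Finset.sdiff_sdiff_eq_self (Finset.mem_powersetCard.1 hI).1
  · intro I hI
    rw [Finset.sdiff_sdiff_eq_self (Finset.mem_powersetCard.1 hI).1, exchProd, exchProd,
      Finset.prod_comm]
    refine Finset.prod_congr rfl fun i _ => Finset.prod_congr rfl fun j _ => ?_
    rw [← exch_neg, neg_sub]

theorem shiftCoeff_comm_of_card (h : s.Generic δ κ (Sum.elim x y)) (hn : s.Nonres δ κ)
    {k l k' l' : ℕ} {t : (Fin m → ℕ) × Finset (Fin r) × Finset (Fin r)} (ht : t.2.1 ⊆ t.2.2)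
    (hk : k' + t.2.1.card = k) (hl : l' + t.2.1.card = l)
    (hkl : (segs t.1 (t.2.2 \ t.2.1)).card = k' + l') :
    s.shiftCoeff x y δ κ k l t = s.shiftCoeff x y δ κ l k t := by
  rw [shiftCoeff_eq h hn ht hk hl hkl, shiftCoeff_eq h hn ht hl hk (hkl.trans (add_comm _ _)),
    exchSum_compl δ κ _ _ hkl, exchSum_neg_neg _ _ _ _ (strongSep_segPoint h hn _)]
  · exact hn.ne 0 1 (Or.inr one_ne_zero) (by simp)
  · exact hn.ne 0 2 (Or.inr two_ne_zero) (by simp)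

theorem shiftCoeff_comm_of_mem (h : s.Generic δ κ (Sum.elim x y)) (hn : s.Nonres δ κ) {k l : ℕ}
    {p q : (Fin m → ℕ) × Finset (Fin r)} (hp : p ∈ deformedIndex m r k)
    (hq : q ∈ deformedIndex m r l) :
    s.shiftCoeff x y δ κ k l (shiftKey p q) = s.shiftCoeff x y δ κ l k (shiftKey p q) := by
  obtain ⟨μ, I⟩ := p
  obtain ⟨ν, J⟩ := q
  rw [mem_deformedIndex] at hp hq
  have h1 : I ∩ J ⊆ I ∪ J := Finset.inter_subset_left.trans Finset.subset_union_left
  have h2 := Finset.card_sdiff_add_card_inter I J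
  have h3 := Finset.card_sdiff_add_card_inter J I
  rw [Finset.inter_comm] at h3
  have h4 := Finset.card_union_add_card_inter I J
  have h5 := Finset.card_sdiff_add_card_eq_card h1
  have h6 : (segs (μ + ν) ((I ∪ J) \ (I ∩ J))).card =
      (∑ i, μ i + (I \ J).card) + (∑ i, ν i + (J \ I).card) := by
    simp only [card_segs, Pi.add_apply, Finset.sum_add_distrib]
    omega
  have h7 : ∑ i, μ i + (I \ J).card + (I ∩ J).card = k := by omega
  have h8 : ∑ i, ν i + (J \ I).card + (I ∩ J).card = l := by omega
  exact shiftCoeff_comm_of_card h hn (t := (μ + ν, I ∩ J, I ∪ J)) h1 h7 h8 h6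

theorem shiftCoeff_comm_of_nonres (h : s.Generic δ κ (Sum.elim x y)) (hn : s.Nonres δ κ) (k l : ℕ)
    (t : (Fin m → ℕ) × Finset (Fin r) × Finset (Fin r)) :
    s.shiftCoeff x y δ κ k l t = s.shiftCoeff x y δ κ l k t := by
  by_cases h1 : ∃ p ∈ deformedIndex m r k, ∃ q ∈ deformedIndex m r l, shiftKey p q = t
  · obtain ⟨p, hp, q, hq, rfl⟩ := h1
    exact shiftCoeff_comm_of_mem h hn hp hq
  by_cases h2 : ∃ p ∈ deformedIndex m r l, ∃ q ∈ deformedIndex m r k, shiftKey p q = t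
  · obtain ⟨p, hp, q, hq, rfl⟩ := h2
    exact (shiftCoeff_comm_of_mem h hn hp hq).symm
  rw [shiftCoeff, shiftCoeff, Finset.filter_false_of_mem, Finset.filter_false_of_mem]
  · rintro ⟨p, q⟩ hp he
    rw [Finset.mem_product] at hp
    exact h2 ⟨p, hp.1, q, hp.2, he⟩
  · rintro ⟨p, q⟩ hp he
    rw [Finset.mem_product] at hp
    exact h1 ⟨p, hp.1, q, hp.2, he⟩

end SigmaFunction

/-! ### Products of coefficients of the two families -/

/-- A product over unordered pairs of a symmetric function that is trivial on pairs lying on the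
same side of `I` is a product over pairs `i ∈ I`, `j ∉ I`. -/
theorem Finset.prod_prod_Ioi_eq_of_symm {m : ℕ} {M : Type*} [CommMonoid M] (I : Finset (Fin m))
    (f : Fin m → Fin m → M) (hsymm : ∀ i j, f i j = f j i)
    (hone : ∀ i j, (i ∈ I ↔ j ∈ I) → f i j = 1) :
    ∏ i, ∏ j ∈ Finset.Ioi i, f i j = ∏ i, ∏ j, if i ∈ I ∧ j ∉ I then f i j else 1 := by
  rw [Finset.prod_comm]
  calc ∏ i, ∏ j ∈ Finset.Ioi i, f i j
      = ∏ i, ∏ j ∈ Finset.Ioi i, (if j ∈ I ∧ i ∉ I then f j i else 1) *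
          (if i ∈ I ∧ j ∉ I then f i j else 1) := by
        refine Finset.prod_congr rfl fun i _ => Finset.prod_congr rfl fun j _ => ?_
        by_cases hi : i ∈ I <;> by_cases hj : j ∈ I <;> simp [hi, hj, hone, hsymm j i]
    _ = ∏ i, ∏ j ∈ {i}ᶜ, if j ∈ I ∧ i ∉ I then f j i else 1 :=
        Finset.prod_prod_Ioi_mul_eq_prod_prod_off_diag
          (fun i j => if i ∈ I ∧ j ∉ I then f i j else 1)
    _ = _ := by
        refine Finset.prod_congr rfl fun i _ => ?_
        refine Finset.prod_subset (Finset.subset_univ _) fun j _ hj => ?_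
        have : j = i := by simpa using hj
        subst this
        simp

theorem Finset.prod_prod_compl_eq_prod_ite {α M : Type*} [CommMonoid M] [Fintype α]
    [DecidableEq α] (I : Finset α) (f : α → α → M) :
    ∏ i ∈ I, ∏ j ∈ Iᶜ, f i j = ∏ i, ∏ j, if i ∈ I ∧ j ∉ I then f i j else 1 := by
  rw [Finset.prod_mem_eq_prod_ite]
  refine Finset.prod_congr rfl fun i _ => ?_
  by_cases hi : i ∈ I
  · rw [if_pos hi, Finset.prod_mem_eq_prod_ite]
    simp [hi]
  · simp [hi]

theorem Finset.prod_prod_mul_prod_compl {α β M : Type*} [CommMonoid M] [Fintype α] [Fintype β]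
    [DecidableEq α] (I : Finset α) (f g : α → β → M) :
    (∏ j ∈ I, ∏ i, f j i) * ∏ j ∈ Iᶜ, ∏ i, g j i =
      ∏ i, ∏ j, if j ∈ I then f j i else g j i := by
  rw [Finset.prod_mul_prod_compl_eq_prod_ite, Finset.prod_comm]
  refine Finset.prod_congr rfl fun j _ => ?_
  split_ifs <;> rfl

namespace SigmaFunction

variable {s : SigmaFunction} {m r : ℕ} {x : Fin m → ℂ} {y : Fin r → ℂ} {δ κ : ℂ}

theorem poch_succ (δ u : ℂ) (k : ℕ) : s.poch δ u (k + 1) = s.poch δ u k * s (u + k * δ) := by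
  rw [poch, Finset.prod_range_succ, poch]

theorem poch_succ' (δ u : ℂ) (k : ℕ) : s.poch δ u (k + 1) = s u * s.poch δ (u + δ) k := by
  rw [poch, Finset.prod_range_succ', mul_comm, poch]
  congr 1
  · simp
  · refine Finset.prod_congr rfl fun a _ => ?_
    congr 1
    push_cast
    ring

theorem poch_sub_mul (δ u : ℂ) (k : ℕ) :
    s.poch δ (u - δ) k * s (u + ((k : ℂ) - 1) * δ) = s (u - δ) * s.poch δ u k := by
  have h1 := s.poch_succ δ (u - δ) k
  rw [poch_succ', sub_add_cancel] at h1
  rw [h1]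
  congr 2
  ring

theorem poch_ne_zero {u : ℂ} {k : ℕ} (h : ∀ a < k, s (u + a * δ) ≠ 0) : s.poch δ u k ≠ 0 :=
  Finset.prod_ne_zero_iff.2 fun a ha => h a (Finset.mem_range.1 ha)

/-- The factors that involve only `x` in a product of two coefficients from the two families: a
factor that depends only on the total shift `L`, and factors of the alternating identity. -/
theorem wronski_x_group (h : s.Generic δ κ (Sum.elim x y)) (hn : s.Nonres δ κ)
    (L μ : Fin m → ℕ) (I : Finset (Fin m)) (hL : ∀ i, L i = μ i + if i ∈ I then 1 else 0) :
    (∏ i : Fin m, ∏ j ∈ Finset.Ioi i,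
        s (x i + (if i ∈ I then δ else 0) - (x j + if j ∈ I then δ else 0)
          + ((μ i : ℂ) - (μ j : ℂ)) * δ) /
          s (x i + (if i ∈ I then δ else 0) - (x j + if j ∈ I then δ else 0))) *
      (∏ i ∈ I, ∏ j ∈ Iᶜ, s (x i - x j - -κ) / s (x i - x j)) *
      (∏ i : Fin m, ∏ j : Fin m,
        s.poch δ (x i + (if i ∈ I then δ else 0) - (x j + if j ∈ I then δ else 0) + κ) (μ i) /
        s.poch δ (x i + (if i ∈ I then δ else 0) - (x j + if j ∈ I then δ else 0) + δ) (μ i)) =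
      ((∏ i : Fin m, ∏ j ∈ Finset.Ioi i,
          s (x i - x j + ((L i : ℂ) - L j) * δ) / s (x i - x j)) *
        ∏ i : Fin m, ∏ j : Fin m,
          s.poch δ (x i - x j + κ) (L i) / s.poch δ (x i - x j + δ) (L i) /
            -s (x i - x j + κ + ((L i : ℂ) - 1) * δ)) *
      ((∏ i ∈ I, ∏ j ∈ Iᶜ, s (x i - δ - (x j - δ) + (δ - κ)) / s (x i - δ - (x j - δ))) *
        (∏ j ∈ I, ∏ i, s (x j - δ - (x i + ((L i : ℂ) - 1) * δ))) *
        ∏ j ∈ Iᶜ, ∏ i, s (x j - δ + (δ - κ) - (x i + ((L i : ℂ) - 1) * δ))) := by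
  have hV : (∏ i : Fin m, ∏ j ∈ Finset.Ioi i,
        s (x i + (if i ∈ I then δ else 0) - (x j + if j ∈ I then δ else 0)
          + ((μ i : ℂ) - (μ j : ℂ)) * δ) /
          s (x i + (if i ∈ I then δ else 0) - (x j + if j ∈ I then δ else 0))) =
      (∏ i : Fin m, ∏ j ∈ Finset.Ioi i,
          s (x i - x j + ((L i : ℂ) - L j) * δ) / s (x i - x j)) *
        ∏ i : Fin m, ∏ j, if i ∈ I ∧ j ∉ I then (if i = j then 1 else s (x i - x j) /
          s (x i + (if i ∈ I then δ else 0) - (x j + if j ∈ I then δ else 0))) else 1 := by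
    rw [← Finset.prod_prod_Ioi_eq_of_symm I (fun i j => if i = j then 1 else s (x i - x j) /
          s (x i + (if i ∈ I then δ else 0) - (x j + if j ∈ I then δ else 0)))]
    · simp only [← Finset.prod_mul_distrib]
      refine Finset.prod_congr rfl fun i _ => Finset.prod_congr rfl fun j hj => ?_
      have hij : i ≠ j := (Finset.mem_Ioi.1 hj).ne
      have h1 : s (x i - x j) ≠ 0 := h.xx hij 0 0 (by simp)
      rw [if_neg hij, div_mul_div_cancel₀ h1]
      congr 2
      rw [hL i, hL j]
      push_cast
      split_ifs <;> ring
    · intro i j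
      by_cases hij : i = j
      · subst hij; rfl
      · rw [if_neg hij, if_neg (Ne.symm hij), s.map_sub_comm (x i), s.map_sub_comm (x i + _),
          neg_div_neg_eq]
    · intro i j hiff
      by_cases hij : i = j
      · rw [if_pos hij]
      · rw [if_neg hij]
        have h1 : s (x i - x j) ≠ 0 := h.xx hij 0 0 (by simp)
        rw [if_congr hiff rfl rfl, add_sub_add_right_eq_sub, div_self h1]
  rw [hV, Finset.prod_prod_compl_eq_prod_ite, Finset.prod_prod_compl_eq_prod_ite, mul_assoc,
    mul_assoc, mul_assoc (∏ i : Fin m, ∏ j ∈ Finset.Ioi i,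
          s (x i - x j + ((L i : ℂ) - L j) * δ) / s (x i - x j)), mul_assoc (∏ i, ∏ j, _),
    Finset.prod_prod_mul_prod_compl]
  congr 1
  rw [Finset.prod_comm (f := fun i j => if i ∈ I ∧ j ∉ I then
    s (x i - δ - (x j - δ) + (δ - κ)) / s (x i - δ - (x j - δ)) else 1)]
  simp only [← Finset.prod_mul_distrib]
  refine Finset.prod_congr rfl fun i _ => Finset.prod_congr rfl fun j _ => ?_
  -- the identity for a single pair
  have hLi := hL i
  set u := x i - x j with hu
  have hκ : s (u + κ + ((L i : ℂ) - 1) * δ) ≠ 0 := by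
    by_cases hij : i = j
    · subst hij
      exact hn.ne (L i - 1) 1 (Or.inr one_ne_zero) (by rw [hu]; push_cast; ring)
    · exact h.xx hij (L i - 1) 1 (by push_cast; ring)
  have hδ : i ∈ I → s (u + δ + ((L i : ℂ) - 1) * δ) ≠ 0 := by
    intro hi
    rw [if_pos hi] at hLi
    by_cases hij : i = j
    · subst hij
      exact hn.ne (L i) 0 (Or.inl (by omega)) (by rw [hu]; push_cast; ring)
    · exact h.xx hij (L i) 0 (by push_cast; ring)
  have hpκ : s.poch δ (u + κ) (L i) ≠ 0 := poch_ne_zero fun a _ => by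
    by_cases hij : i = j
    · subst hij
      exact hn.ne a 1 (Or.inr one_ne_zero) (by rw [hu]; push_cast; ring)
    · exact h.xx hij a 1 (by push_cast; ring)
  have hpδ : s.poch δ (u + δ) (L i) ≠ 0 := poch_ne_zero fun a _ => by
    by_cases hij : i = j
    · subst hij
      exact hn.ne (a + 1) 0 (Or.inl (by omega)) (by rw [hu]; push_cast; ring)
    · exact h.xx hij (a + 1) 0 (by push_cast; ring)
  have a1 : x j - δ - (x i + ((L i : ℂ) - 1) * δ) = -(u + δ + ((L i : ℂ) - 1) * δ) := by
    rw [hu]; ring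
  have a2 : x j - δ + (δ - κ) - (x i + ((L i : ℂ) - 1) * δ) = -(u + κ + ((L i : ℂ) - 1) * δ) := by
    rw [hu]; ring
  have a3 : x j - δ - (x i - δ) + (δ - κ) = -(u + κ - δ) := by rw [hu]; ring
  have a4 : x j - δ - (x i - δ) = -u := by rw [hu]; ring
  rw [a1, a2, a3, a4, s.map_neg, s.map_neg, s.map_neg, s.map_neg, neg_div_neg_eq]
  by_cases hi : i ∈ I <;> by_cases hj : j ∈ I
  · have hδ := hδ hi
    rw [if_pos hi] at hLi
    simp only [hi, hj, not_true, and_false, if_false, if_true, one_mul]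
    rw [show x i + δ - (x j + δ) = u by rw [hu]; ring]
    rw [hLi, poch_succ, poch_succ] at *
    rw [show ((μ i + 1 : ℕ) : ℂ) - 1 = μ i by push_cast; ring] at *
    have := left_ne_zero_of_mul hpκ
    have := left_ne_zero_of_mul hpδ
    generalize s (u + κ + (μ i : ℂ) * δ) = v at *
    generalize s (u + δ + (μ i : ℂ) * δ) = w at *
    field_simp
  · have hij : i ≠ j := fun h => hj (h ▸ hi)
    have g1 : s u ≠ 0 := h.xx hij 0 0 (by simp [hu])
    have g2 : s (u + δ) ≠ 0 := h.xx hij 1 0 (by simp [hu])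
    have g3 : s (u + κ) ≠ 0 := h.xx hij 0 1 (by simp [hu])
    rw [if_pos hi] at hLi
    simp only [hi, hj, hij, not_true, not_false_iff, and_self, if_false, if_true,
      one_mul, add_zero]
    rw [show x i + δ - x j = u + δ by rw [hu]; ring, sub_neg_eq_add]
    rw [hLi, poch_succ', poch_succ'] at *
    rw [add_right_comm u δ κ]
    have := right_ne_zero_of_mul hpκ
    have := right_ne_zero_of_mul hpδ
    generalize s (u + κ + (((μ i + 1 : ℕ) : ℂ) - 1) * δ) = v at *
    field_simp
  · have hij : i ≠ j := fun h => hi (h ▸ hj)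
    have g1 : s u ≠ 0 := h.xx hij 0 0 (by simp [hu])
    have hδ' : s (u + δ + ((L i : ℂ) - 1) * δ) ≠ 0 := h.xx hij (L i) 0 (by rw [hu]; push_cast; ring)
    rw [if_neg hi, add_zero] at hLi
    simp only [hi, hj, not_true, not_false_iff, and_self, if_false, if_true, one_mul, add_zero]
    rw [show x i - (x j + δ) + κ = u + κ - δ by rw [hu]; ring,
      show x i - (x j + δ) + δ = u + δ - δ by rw [hu]; ring]
    have e1 := s.poch_sub_mul δ (u + κ) (L i)
    have e2 := s.poch_sub_mul δ (u + δ) (L i)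
    rw [← hLi, eq_div_of_mul_eq hκ e1, eq_div_of_mul_eq hδ' e2, add_sub_cancel_right]
    generalize s (u + κ + ((L i : ℂ) - 1) * δ) = v at *
    generalize s (u + δ + ((L i : ℂ) - 1) * δ) = w at *
    field_simp
  · rw [if_neg hi, add_zero] at hLi
    simp only [hi, hj, not_false_iff, and_true, if_false,
      one_mul, add_zero]
    rw [← hu, ← hLi]
    generalize s (u + κ + ((L i : ℂ) - 1) * δ) = v at *
    field_simp

end SigmaFunction

namespace SigmaFunction

variable {s : SigmaFunction} {m r : ℕ} {x : Fin m → ℂ} {y : Fin r → ℂ} {δ κ : ℂ}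

/-- The factors that involve only `y` in a product of two coefficients from the two families: a
factor that depends only on the total shift `Λ`, and factors of the alternating identity. -/
theorem wronski_y_group (h : s.Generic δ κ (Sum.elim x y)) (hn : s.Nonres δ κ)
    (Λ ν : Fin r → ℕ) (J : Finset (Fin r)) (hΛ : ∀ a, Λ a = ν a + if a ∈ J then 1 else 0) :
    (∏ a : Fin r, ∏ b ∈ Finset.Ioi a,
        s (y a - y b + ((ν a : ℂ) - (ν b : ℂ)) * -κ) / s (y a - y b)) *
      (∏ a ∈ J, ∏ b ∈ Jᶜ, s (y a + -κ * ν a - (y b + -κ * ν b) - δ) /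
        s (y a + -κ * ν a - (y b + -κ * ν b))) *
      (∏ a : Fin r, ∏ b : Fin r,
        s.poch (-κ) (y a - y b + -δ) (ν a) / s.poch (-κ) (y a - y b + -κ) (ν a)) =
      ((∏ a : Fin r, ∏ b ∈ Finset.Ioi a,
          s (y a - y b + ((Λ a : ℂ) - Λ b) * -κ) / s (y a - y b)) *
        ∏ a : Fin r, ∏ b : Fin r,
          s.poch (-κ) (y a - y b + -δ) (Λ a) / s.poch (-κ) (y a - y b + -κ) (Λ a) /
            s (y a - y b + -δ + ((Λ a : ℂ) - 1) * -κ)) *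
      ((∏ a ∈ Jᶜ, ∏ b ∈ J, s (y a - ((Λ a : ℂ) - 1) * κ - δ - (y b - ((Λ b : ℂ) - 1) * κ - δ)
          + (δ - κ)) / s (y a - ((Λ a : ℂ) - 1) * κ - δ - (y b - ((Λ b : ℂ) - 1) * κ - δ))) *
        (∏ a ∈ Jᶜ, ∏ b, s (y a - ((Λ a : ℂ) - 1) * κ - δ - y b)) *
        ∏ a ∈ J, ∏ b, s (y a - ((Λ a : ℂ) - 1) * κ - δ + (δ - κ) - y b)) := by
  have hne : ∀ {a b : Fin r}, a ≠ b → ∀ n : ℤ, s (y a - y b + n * -κ) ≠ 0 := fun hab n =>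
    h.yy hab 0 (-n) (by push_cast; ring)
  have hV : (∏ a : Fin r, ∏ b ∈ Finset.Ioi a,
        s (y a - y b + ((ν a : ℂ) - (ν b : ℂ)) * -κ) / s (y a - y b)) =
      (∏ a : Fin r, ∏ b ∈ Finset.Ioi a,
          s (y a - y b + ((Λ a : ℂ) - Λ b) * -κ) / s (y a - y b)) *
        ∏ a : Fin r, ∏ b, if a ∈ J ∧ b ∉ J then (if a = b then 1 else
          s (y a - y b + ((ν a : ℂ) - (ν b : ℂ)) * -κ) /
            s (y a - y b + ((Λ a : ℂ) - Λ b) * -κ)) else 1 := by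
    rw [← Finset.prod_prod_Ioi_eq_of_symm J (fun a b => if a = b then 1 else
          s (y a - y b + ((ν a : ℂ) - (ν b : ℂ)) * -κ) /
            s (y a - y b + ((Λ a : ℂ) - Λ b) * -κ))]
    · simp only [← Finset.prod_mul_distrib]
      refine Finset.prod_congr rfl fun a _ => Finset.prod_congr rfl fun b hb => ?_
      have hab : a ≠ b := (Finset.mem_Ioi.1 hb).ne
      have h1 : s (y a - y b + ((Λ a : ℂ) - Λ b) * -κ) ≠ 0 := by
        simpa using hne hab (Λ a - Λ b)
      rw [if_neg hab]
      generalize s (y a - y b + ((Λ a : ℂ) - Λ b) * -κ) = w at *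
      field_simp
    · intro a b
      by_cases hab : a = b
      · subst hab; rfl
      · rw [if_neg hab, if_neg (Ne.symm hab),
          show y a - y b + ((ν a : ℂ) - (ν b : ℂ)) * -κ =
            -(y b - y a + ((ν b : ℂ) - (ν a : ℂ)) * -κ) by ring,
          show y a - y b + ((Λ a : ℂ) - (Λ b : ℂ)) * -κ =
            -(y b - y a + ((Λ b : ℂ) - (Λ a : ℂ)) * -κ) by ring,
          s.map_neg, s.map_neg, neg_div_neg_eq]
    · intro a b hiff
      by_cases hab : a = b
      · rw [if_pos hab]
      · rw [if_neg hab]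
        have h1 : s (y a - y b + ((Λ a : ℂ) - Λ b) * -κ) ≠ 0 := by
          simpa using hne hab (Λ a - Λ b)
        rw [div_eq_one_iff_eq h1, hΛ a, hΛ b, if_congr hiff rfl rfl]
        congr 2
        push_cast
        ring
  rw [hV, Finset.prod_prod_compl_eq_prod_ite, Finset.prod_comm (s := Jᶜ) (t := J),
    Finset.prod_prod_compl_eq_prod_ite, mul_assoc,
    mul_assoc, mul_assoc (∏ a : Fin r, ∏ b ∈ Finset.Ioi a,
          s (y a - y b + ((Λ a : ℂ) - Λ b) * -κ) / s (y a - y b)), mul_assoc (∏ a, ∏ b, _),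
    mul_comm (∏ a ∈ Jᶜ, ∏ b, s (y a - ((Λ a : ℂ) - 1) * κ - δ - y b)),
    Finset.prod_prod_mul_prod_compl]
  congr 1
  rw [Finset.prod_comm (f := fun b a => if a ∈ J then
    s (y a - ((Λ a : ℂ) - 1) * κ - δ + (δ - κ) - y b) else
    s (y a - ((Λ a : ℂ) - 1) * κ - δ - y b))]
  simp only [← Finset.prod_mul_distrib]
  refine Finset.prod_congr rfl fun a _ => Finset.prod_congr rfl fun b _ => ?_
  -- the identity for a single pair
  have hΛa := hΛ a
  have hΛb := hΛ b
  set u := y a - y b with hu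
  have hδ : s (u + -δ + ((Λ a : ℂ) - 1) * -κ) ≠ 0 := by
    by_cases hab : a = b
    · subst hab
      exact hn.ne (-1) (1 - Λ a) (Or.inl (by norm_num)) (by rw [hu]; push_cast; ring)
    · exact h.yy hab (-1) (1 - Λ a) (by push_cast; ring)
  have hpδ : s.poch (-κ) (u + -δ) (Λ a) ≠ 0 := poch_ne_zero fun n _ => by
    by_cases hab : a = b
    · subst hab
      exact hn.ne (-1) (-n) (Or.inl (by norm_num)) (by rw [hu]; push_cast; ring)
    · exact h.yy hab (-1) (-n) (by push_cast; ring)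
  have hpκ : s.poch (-κ) (u + -κ) (Λ a) ≠ 0 := poch_ne_zero fun n _ => by
    by_cases hab : a = b
    · subst hab
      exact hn.ne 0 (-1 - n) (Or.inr (by omega)) (by rw [hu]; push_cast; ring)
    · exact h.yy hab 0 (-1 - n) (by push_cast; ring)
  have a1 : y a - ((Λ a : ℂ) - 1) * κ - δ - y b = u + -δ + ((Λ a : ℂ) - 1) * -κ := by
    rw [hu]; ring
  have a2 : y a - ((Λ a : ℂ) - 1) * κ - δ + (δ - κ) - y b = u + -κ + ((Λ a : ℂ) - 1) * -κ := by
    rw [hu]; ring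
  rw [a1, a2]
  by_cases ha : a ∈ J
  · rw [if_pos ha] at hΛa
    by_cases hb : b ∈ J
    · simp only [ha, hb, not_true, and_false, if_false, if_true, one_mul]
      rw [hΛa, poch_succ, poch_succ] at *
      rw [show ((ν a + 1 : ℕ) : ℂ) - 1 = ν a by push_cast; ring] at *
      have := left_ne_zero_of_mul hpκ
      have := left_ne_zero_of_mul hpδ
      have := right_ne_zero_of_mul hpκ
      generalize s (u + -κ + (ν a : ℂ) * -κ) = v at *
      generalize s (u + -δ + (ν a : ℂ) * -κ) = w at *
      field_simp
    · have hab : a ≠ b := fun h => hb (h ▸ ha)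
      rw [if_neg hb, add_zero] at hΛb
      have g1 : s (u + ((Λ a : ℂ) - Λ b) * -κ) ≠ 0 := by
        simpa using hne hab (Λ a - Λ b)
      have g2 : s (u + ((ν a : ℂ) - ν b) * -κ) ≠ 0 := by
        simpa using hne hab (ν a - ν b)
      simp only [ha, hb, hab, not_false_iff, and_self, if_false, if_true]
      have b1 : y b - ((Λ b : ℂ) - 1) * κ - δ - (y a - ((Λ a : ℂ) - 1) * κ - δ) =
          -(u + ((Λ a : ℂ) - Λ b) * -κ) := by rw [hu]; ring
      have b2 : y b - ((Λ b : ℂ) - 1) * κ - δ - (y a - ((Λ a : ℂ) - 1) * κ - δ) + (δ - κ) =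
          -(u + ((ν a : ℂ) - ν b) * -κ - δ) := by rw [hu, hΛa, hΛb]; push_cast; ring
      have b3 : y a + -κ * ν a - (y b + -κ * ν b) = u + ((ν a : ℂ) - ν b) * -κ := by
        rw [hu]; ring
      rw [b2, b1, b3, s.map_neg, s.map_neg, neg_div_neg_eq]
      generalize s (u + ((Λ a : ℂ) - Λ b) * -κ) = z₁ at *
      generalize s (u + ((ν a : ℂ) - ν b) * -κ) = z₂ at *
      rw [hΛa, poch_succ, poch_succ] at *
      rw [show ((ν a + 1 : ℕ) : ℂ) - 1 = ν a by push_cast; ring] at *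
      have := left_ne_zero_of_mul hpκ
      have := left_ne_zero_of_mul hpδ
      have := right_ne_zero_of_mul hpκ
      generalize s (u + -κ + (ν a : ℂ) * -κ) = v at *
      generalize s (u + -δ + (ν a : ℂ) * -κ) = w at *
      generalize s (u + ((ν a : ℂ) - ν b) * -κ - δ) = z₃ at *
      field_simp
  · rw [if_neg ha, add_zero] at hΛa
    simp only [ha, false_and, if_false, one_mul]
    rw [← hΛa]
    generalize s (u + -δ + ((Λ a : ℂ) - 1) * -κ) = w at *
    field_simp

/-- The factors that involve both `x` and `y` in a product of two coefficients from the two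
families: a factor that depends only on the total shift `(L, Λ)`, and factors of the alternating
identity. -/
theorem wronski_xy_group (h : s.Generic δ κ (Sum.elim x y))
    (L μ : Fin m → ℕ) (I : Finset (Fin m)) (hL : ∀ i, L i = μ i + if i ∈ I then 1 else 0)
    (Λ ν : Fin r → ℕ) (J : Finset (Fin r)) (hΛ : ∀ a, Λ a = ν a + if a ∈ J then 1 else 0) :
    (∏ b : Fin r, ((∏ i ∈ I, s (y b - x i - -δ) / s (y b - x i + (ν b : ℂ) * -κ)) *
      ∏ i ∈ Iᶜ, s (y b - x i - -κ) / s (y b - x i + ((ν b : ℂ) - 1) * -κ))) *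
    (∏ i : Fin m,
      ((∏ b ∈ J, s (x i + (if i ∈ I then δ else 0) - (y b + -κ * ν b) - κ) /
          s (x i + (if i ∈ I then δ else 0) - (y b + -κ * ν b) + (μ i : ℂ) * δ)) *
        ∏ b ∈ Jᶜ, s (x i + (if i ∈ I then δ else 0) - (y b + -κ * ν b) - δ) /
          s (x i + (if i ∈ I then δ else 0) - (y b + -κ * ν b) + ((μ i : ℂ) - 1) * δ))) =
    (∏ i : Fin m, ∏ b : Fin r, -(s (x i - y b + Λ b * κ + ((L i : ℂ) - 1) * δ) *
        s (x i - y b + ((Λ b : ℂ) - 1) * κ + L i * δ))⁻¹) *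
    ((∏ i ∈ I, ∏ b ∈ J, s (x i - δ - (y b - ((Λ b : ℂ) - 1) * κ - δ) + (δ - κ)) /
        s (x i - δ - (y b - ((Λ b : ℂ) - 1) * κ - δ))) *
      (∏ b ∈ Jᶜ, ∏ i ∈ Iᶜ, s (y b - ((Λ b : ℂ) - 1) * κ - δ - (x i - δ) + (δ - κ)) /
        s (y b - ((Λ b : ℂ) - 1) * κ - δ - (x i - δ))) *
      ((∏ i ∈ I, ∏ b, s (x i - δ - y b)) * ∏ i ∈ Iᶜ, ∏ b, s (x i - δ + (δ - κ) - y b)) *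
      ((∏ b ∈ J, ∏ i, s (y b - ((Λ b : ℂ) - 1) * κ - δ + (δ - κ) - (x i + ((L i : ℂ) - 1) * δ))) *
        ∏ b ∈ Jᶜ, ∏ i, s (y b - ((Λ b : ℂ) - 1) * κ - δ - (x i + ((L i : ℂ) - 1) * δ)))) := by
  have hif : ∀ (f : Fin m → Fin r → ℂ), ∏ i ∈ I, ∏ b ∈ J, f i b =
      ∏ i, ∏ b, if i ∈ I then (if b ∈ J then f i b else 1) else 1 := fun f => by
    rw [Finset.prod_mem_eq_prod_ite]
    refine Finset.prod_congr rfl fun i _ => ?_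
    by_cases hi : i ∈ I
    · simp only [hi, if_true]
      rw [Finset.prod_mem_eq_prod_ite]
    · simp [hi]
  have hif' : ∀ (f : Fin r → Fin m → ℂ), ∏ b ∈ Jᶜ, ∏ i ∈ Iᶜ, f b i =
      ∏ i, ∏ b, if i ∈ I then 1 else (if b ∈ J then 1 else f b i) := fun f => by
    rw [Finset.prod_comm, Finset.prod_mem_eq_prod_ite]
    refine Finset.prod_congr rfl fun i _ => ?_
    by_cases hi : i ∈ I
    · simp [hi]
    · simp only [hi, Finset.mem_compl, not_false_iff, if_true, if_false]
      rw [Finset.prod_mem_eq_prod_ite]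
      refine Finset.prod_congr rfl fun b _ => ?_
      by_cases hb : b ∈ J <;> simp [hb]
  rw [hif, hif', Finset.prod_prod_mul_prod_compl I, Finset.prod_prod_mul_prod_compl J,
    Finset.prod_comm (f := fun b i => if i ∈ I then s (x i - δ - y b) else _)]
  simp only [Finset.prod_mul_prod_compl_eq_prod_ite]
  rw [Finset.prod_comm (s := (Finset.univ : Finset (Fin r)))]
  simp only [← Finset.prod_mul_distrib]
  refine Finset.prod_congr rfl fun i _ => Finset.prod_congr rfl fun b _ => ?_
  -- the identity for a single pair
  have hLi := hL i
  have hΛb := hΛ b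
  obtain ⟨d, hd⟩ : ∃ d, d = x i - y b := ⟨_, rfl⟩
  have hne : ∀ (p q : ℤ) {w : ℂ}, w = d + p * δ + q * κ → s w ≠ 0 := fun p q w hw =>
    h.xy i b p q (by rw [hw, hd])
  have n1 : s (d + ((Λ b : ℂ) - 1) * κ) ≠ 0 := hne 0 (Λ b - 1) (by push_cast; ring)
  have n2 : s (d + Λ b * κ + ((L i : ℂ) - 1) * δ) ≠ 0 := hne (L i - 1) (Λ b) (by push_cast; ring)
  have n3 : s (d + ((Λ b : ℂ) - 1) * κ + L i * δ) ≠ 0 := hne (L i) (Λ b - 1) (by push_cast; ring)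
  rw [← hd]
  rw [show x i - δ - y b = d - δ by rw [hd]; ring,
    show x i - δ + (δ - κ) - y b = d - κ by rw [hd]; ring,
    show x i - δ - (y b - ((Λ b : ℂ) - 1) * κ - δ) = d + ((Λ b : ℂ) - 1) * κ by rw [hd]; ring,
    show y b - ((Λ b : ℂ) - 1) * κ - δ - (x i - δ) = -(d + ((Λ b : ℂ) - 1) * κ) by rw [hd]; ring,
    show y b - ((Λ b : ℂ) - 1) * κ - δ - (x i + ((L i : ℂ) - 1) * δ) =
      -(d + ((Λ b : ℂ) - 1) * κ + L i * δ) by rw [hd]; ring,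
    show y b - ((Λ b : ℂ) - 1) * κ - δ + (δ - κ) - (x i + ((L i : ℂ) - 1) * δ) =
      -(d + Λ b * κ + ((L i : ℂ) - 1) * δ) by rw [hd]; ring,
    show -(d + ((Λ b : ℂ) - 1) * κ) + (δ - κ) = -(d + Λ b * κ - δ) by ring,
    show y b - x i - -δ = -(d - δ) by rw [hd]; ring,
    show y b - x i - -κ = -(d - κ) by rw [hd]; ring,
    show y b - x i + (ν b : ℂ) * -κ = -(d + ν b * κ) by rw [hd]; ring,
    show y b - x i + ((ν b : ℂ) - 1) * -κ = -(d + ((ν b : ℂ) - 1) * κ) by rw [hd]; ring]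
  simp only [s.map_neg, neg_div_neg_eq]
  have e : x i + (if i ∈ I then δ else 0) - (y b + -κ * ν b) =
      d + ν b * κ + (if i ∈ I then δ else 0) := by rw [hd]; ring
  rw [e]
  have g0 : s (d - κ) ≠ 0 := hne 0 (-1) (by push_cast; ring)
  have g1 : s (d - δ) ≠ 0 := hne (-1) 0 (by push_cast; ring)
  by_cases hi : i ∈ I <;> by_cases hb : b ∈ J
  · rw [if_pos hi] at hLi
    rw [if_pos hb] at hΛb
    simp only [hi, hb, if_true]
    rw [hΛb, hLi] at *
    rw [show d + ν b * κ + δ - κ = d + (((ν b + 1 : ℕ) : ℂ) - 1) * κ + (δ - κ) by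
        push_cast; ring,
      show d + ν b * κ + δ + (μ i : ℂ) * δ =
        d + (((ν b + 1 : ℕ) : ℂ) - 1) * κ + ((μ i + 1 : ℕ) : ℂ) * δ by push_cast; ring,
      show d + ν b * κ = d + (((ν b + 1 : ℕ) : ℂ) - 1) * κ by push_cast; ring]
    generalize s (d + (((ν b + 1 : ℕ) : ℂ) - 1) * κ + ((μ i + 1 : ℕ) : ℂ) * δ) = w₁ at *
    generalize s (d + (((ν b + 1 : ℕ) : ℂ) - 1) * κ + (δ - κ)) = w₂ at *
    generalize s (d + (((ν b + 1 : ℕ) : ℂ) - 1) * κ) = w₃ at *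
    generalize s (d + ((ν b + 1 : ℕ) : ℂ) * κ + (((μ i + 1 : ℕ) : ℂ) - 1) * δ) = w₄ at *
    generalize s (d - δ) = w₅ at *
    field_simp
  · rw [if_pos hi] at hLi
    rw [if_neg hb, add_zero] at hΛb
    simp only [hi, hb, if_true, if_false]
    rw [hΛb, hLi] at *
    rw [show d + ν b * κ + δ - δ = d + ν b * κ by ring,
      show d + ν b * κ + δ + ((μ i : ℂ) - 1) * δ =
        d + (ν b : ℂ) * κ + (((μ i + 1 : ℕ) : ℂ) - 1) * δ by push_cast; ring]
    have g2 : s (d + ν b * κ) ≠ 0 := hne 0 (ν b) (by push_cast; ring)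
    generalize s (d + ((ν b : ℂ) - 1) * κ + ((μ i + 1 : ℕ) : ℂ) * δ) = w₁ at *
    generalize s (d + (ν b : ℂ) * κ + (((μ i + 1 : ℕ) : ℂ) - 1) * δ) = w₂ at *
    generalize s (d + ν b * κ) = w₃ at *
    generalize s (d - δ) = w₅ at *
    field_simp
  · rw [if_neg hi, add_zero] at hLi
    rw [if_pos hb] at hΛb
    simp only [hi, hb, if_true, if_false, add_zero]
    rw [hΛb, hLi] at *
    rw [show d + ν b * κ - κ = d + ((ν b : ℂ) - 1) * κ by ring,
      show d + ν b * κ + (μ i : ℂ) * δ =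
        d + (((ν b + 1 : ℕ) : ℂ) - 1) * κ + (μ i : ℂ) * δ by push_cast; ring]
    have g2 : s (d + ((ν b : ℂ) - 1) * κ) ≠ 0 := hne 0 (ν b - 1) (by push_cast; ring)
    generalize s (d + (((ν b + 1 : ℕ) : ℂ) - 1) * κ + (μ i : ℂ) * δ) = w₁ at *
    generalize s (d + ((ν b + 1 : ℕ) : ℂ) * κ + ((μ i : ℂ) - 1) * δ) = w₂ at *
    generalize s (d + ((ν b : ℂ) - 1) * κ) = w₃ at *
    generalize s (d - κ) = w₅ at *
    field_simp
  · rw [if_neg hi, add_zero] at hLi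
    rw [if_neg hb, add_zero] at hΛb
    simp only [hi, hb, if_false, add_zero]
    rw [hΛb, hLi] at *
    generalize s (d + ((ν b : ℂ) - 1) * κ + (μ i : ℂ) * δ) = w₁ at *
    generalize s (d + (ν b : ℂ) * κ + ((μ i : ℂ) - 1) * δ) = w₂ at *
    generalize s (d + ((ν b : ℂ) - 1) * κ) = w₃ at *
    generalize s (d + (ν b : ℂ) * κ - δ) = w₄ at *
    generalize s (d - κ) = w₅ at *
    field_simp

end SigmaFunction

/-! ### The Wronski relation at the level of coefficients -/

namespace SigmaFunction

variable {s : SigmaFunction} {m r : ℕ} {x : Fin m → ℂ} {y : Fin r → ℂ} {δ κ : ℂ}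

/-- The points at which the alternating sum is built for the Wronski relation. -/
noncomputable def wronskiPoint (x : Fin m → ℂ) (y : Fin r → ℂ) (δ κ : ℂ) (Λ : Fin r → ℕ) :
    Fin m ⊕ Fin r → ℂ :=
  Sum.elim (fun i => x i - δ) (fun b => y b - ((Λ b : ℂ) - 1) * κ - δ)

/-- The zeros at which the alternating sum is built for the Wronski relation. -/
noncomputable def wronskiZeros (x : Fin m → ℂ) (y : Fin r → ℂ) (δ : ℂ) (L : Fin m → ℕ) :
    Multiset ℂ :=
  (Finset.univ : Finset (Fin m ⊕ Fin r)).val.map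
    (Sum.elim (fun i => x i + ((L i : ℂ) - 1) * δ) y)

/-- The part of the products of coefficients in the Wronski relation that depends only on the
total shift `(L, Λ)`. -/
noncomputable def wronskiConst (s : SigmaFunction) (x : Fin m → ℂ) (y : Fin r → ℂ) (δ κ : ℂ)
    (L : Fin m → ℕ) (Λ : Fin r → ℕ) : ℂ :=
  -(-1) ^ r *
    ((∏ i : Fin m, ∏ j ∈ Finset.Ioi i,
          s (x i - x j + ((L i : ℂ) - L j) * δ) / s (x i - x j)) *
        ∏ i : Fin m, ∏ j : Fin m,
          s.poch δ (x i - x j + κ) (L i) / s.poch δ (x i - x j + δ) (L i) /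
            -s (x i - x j + κ + ((L i : ℂ) - 1) * δ)) *
    ((∏ a : Fin r, ∏ b ∈ Finset.Ioi a,
          s (y a - y b + ((Λ a : ℂ) - Λ b) * -κ) / s (y a - y b)) *
        ∏ a : Fin r, ∏ b : Fin r,
          s.poch (-κ) (y a - y b + -δ) (Λ a) / s.poch (-κ) (y a - y b + -κ) (Λ a) /
            s (y a - y b + -δ + ((Λ a : ℂ) - 1) * -κ)) *
    ∏ i : Fin m, ∏ b : Fin r, -(s (x i - y b + Λ b * κ + ((L i : ℂ) - 1) * δ) *
        s (x i - y b + ((Λ b : ℂ) - 1) * κ + L i * δ))⁻¹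

theorem thetaProd_wronskiZeros (L : Fin m → ℕ) (z : ℂ) :
    s.thetaProd (wronskiZeros x y δ L) z =
      (∏ i, s (z - (x i + ((L i : ℂ) - 1) * δ))) * ∏ b, s (z - y b) := by
  rw [thetaProd, wronskiZeros, Multiset.map_map]
  exact Fintype.prod_sum_type
    (fun c => s (z - Sum.elim (fun i => x i + ((L i : ℂ) - 1) * δ) y c))

theorem compl_disjSum (I : Finset (Fin m)) (J : Finset (Fin r)) :
    Finset.univ \ I.disjSum Jᶜ = Iᶜ.disjSum J := by
  ext (i | b) <;> simp

/-- A product of two coefficients in the Wronski relation is a summand of the alternating identity,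
up to a factor that depends only on the total shift. -/
theorem wronski_term (h : s.Generic δ κ (Sum.elim x y)) (hn : s.Nonres δ κ)
    (L μ : Fin m → ℕ) (I : Finset (Fin m)) (hL : ∀ i, L i = μ i + if i ∈ I then 1 else 0)
    (Λ ν : Fin r → ℕ) (J : Finset (Fin r)) (hΛ : ∀ a, Λ a = ν a + if a ∈ J then 1 else 0) :
    s (((∑ a, ν a + I.card : ℕ) : ℂ) * κ + ((∑ i, μ i + J.card : ℕ) : ℂ) * δ) *
      (s.coeffVal y x (-κ) (-δ) ν I *
        s.coeffVal (fun i => x i + if i ∈ I then δ else 0) (fun a => y a + -κ * ν a) δ κ μ J) =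
    s.wronskiConst x y δ κ L Λ *
      s.altTerm Finset.univ (wronskiPoint x y δ κ Λ) (wronskiZeros x y δ L) (δ - κ)
        (I.disjSum Jᶜ) := by
  have hbr : ∑ c, wronskiPoint x y δ κ Λ c - (wronskiZeros x y δ L).sum +
      ((I.disjSum Jᶜ).card : ℂ) * (δ - κ) =
      -(((∑ a, ν a + I.card : ℕ) : ℂ) * κ + ((∑ i, μ i + J.card : ℕ) : ℂ) * δ) := by
    have h1 : (wronskiZeros x y δ L).sum =
        ∑ i, (x i + ((L i : ℂ) - 1) * δ) + ∑ b, y b := by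
      rw [wronskiZeros]
      exact Fintype.sum_sum_type (Sum.elim (fun i => x i + ((L i : ℂ) - 1) * δ) y)
    have h2 : ((∑ i, L i : ℕ) : ℂ) = (∑ i, μ i : ℕ) + I.card := by
      simp only [hL, Finset.sum_add_distrib]
      simp
    have h3 : ((∑ i, Λ i : ℕ) : ℂ) = (∑ i, ν i : ℕ) + J.card := by
      simp only [hΛ, Finset.sum_add_distrib]
      simp
    have h4 : (Jᶜ.card : ℂ) = r - J.card := by
      rw [Finset.card_compl, Nat.cast_sub (Finset.card_le_univ J), Fintype.card_fin]
    rw [h1, Fintype.sum_sum_type, Finset.card_disjSum, Nat.cast_add, h4]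
    simp only [wronskiPoint, Sum.elim_inl, Sum.elim_inr, Finset.sum_sub_distrib,
      Finset.sum_add_distrib, ← Finset.sum_mul, Finset.sum_const, Finset.card_univ,
      Fintype.card_fin, nsmul_eq_mul, mul_one, ← Nat.cast_sum, h2, h3]
    push_cast
    ring
  have hsign : (-1 : ℂ) ^ J.card = (-1) ^ r * (-1) ^ Jᶜ.card := by
    have := Finset.card_add_card_compl J
    rw [Fintype.card_fin] at this
    have e : (-1 : ℂ) ^ r = (-1) ^ (J.card + Jᶜ.card) := by rw [this]
    rw [e, pow_add, mul_assoc, ← pow_add, Even.neg_one_pow ⟨_, rfl⟩, mul_one]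
  have hx := wronski_x_group h hn L μ I hL
  have hy := wronski_y_group h hn Λ ν J hΛ
  have hxy := wronski_xy_group h L μ I hL Λ ν J hΛ
  rw [altTerm, hbr, s.map_neg, Finset.card_disjSum, pow_add, compl_disjSum, coeffVal, coeffVal,
    hsign]
  simp only [Finset.prod_disjSum, thetaProd_wronskiZeros, Finset.prod_mul_distrib]
  simp only [wronskiPoint, Sum.elim_inl, Sum.elim_inr]
  simp only [Finset.prod_mul_distrib] at hxy
  have hcomb : ∀ w e₁ e₂ e₃ a₁ a₂ a₃ a₄ a₅ a₆ b₁ b₂ b₃ b₄ b₅ b₆ c₁ d₁ d₂ d₃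
      f₁ f₂ f₃ f₄ t₁ t₂ t₃ t₄ t₅ t₆ t₇ t₈ : ℂ,
      b₁ * a₂ * b₃ = d₁ * (f₁ * t₁ * t₂) →
      a₁ * b₂ * a₃ = d₂ * (f₂ * t₃ * t₄) →
      (a₄ * a₅) * (b₄ * b₅) = d₃ * (f₃ * f₄ * (t₅ * t₆) * (t₇ * t₈)) →
      w * (e₁ * a₁ * a₂ * a₃ * (a₄ * a₅) * (e₃ * e₂ * b₁ * b₂ * b₃ * (b₄ * b₅))) =
      -e₃ * d₁ * d₂ * d₃ * (e₁ * e₂ * (-w) * (f₁ * f₃ * (f₄ * f₂)) *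
        ((t₁ * t₅) * (t₈ * t₃)) * ((t₂ * t₆) * (t₇ * t₄))) := by
    intro w e₁ e₂ e₃ a₁ a₂ a₃ a₄ a₅ a₆ b₁ b₂ b₃ b₄ b₅ b₆ c₁ d₁ d₂ d₃ f₁ f₂ f₃ f₄ t₁ t₂ t₃ t₄ t₅
      t₆ t₇ t₈ h1 h2 h3
    linear_combination (w * e₁ * e₂ * e₃ * ((a₄ * a₅) * (b₄ * b₅)) * (a₁ * b₂ * a₃)) * h1 +
      (w * e₁ * e₂ * e₃ * ((a₄ * a₅) * (b₄ * b₅)) * d₁ * (f₁ * t₁ * t₂)) * h2 +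
      (w * e₁ * e₂ * e₃ * d₁ * (f₁ * t₁ * t₂) * d₂ * (f₂ * t₃ * t₄)) * h3
  simp only [wronskiConst]
  refine hcomb _ _ _ _ _ _ _ _ _ 0 _ _ _ _ _ 0 0 _ _ _ _ _ _ _ _ _ _ _ _ _ _ _ hx hy ?_
  exact hxy.trans (by ring)

theorem sum_altTerm_wronski (h : s.Generic δ κ (Sum.elim x y)) (hmr : 0 < m + r)
    (L : Fin m → ℕ) (Λ : Fin r → ℕ) :
    ∑ S : Finset (Fin m ⊕ Fin r), s.altTerm Finset.univ (wronskiPoint x y δ κ Λ)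
      (wronskiZeros x y δ L) (δ - κ) S = 0 := by
  have := sum_altTerm_eq_zero (s := s) (m + r - 1) Finset.univ (wronskiPoint x y δ κ Λ)
    (wronskiZeros x y δ L) (δ - κ) (by simp; omega) (by simp [wronskiZeros]; omega) ?_
  · rwa [Finset.powerset_univ] at this
  · rintro (i | a) - (j | b) - hij
    · exact h.xx (i := i) (j := j) (fun e => hij (congrArg _ e)) 0 0 (by simp [wronskiPoint])
    · exact h.xy i b 0 (Λ b - 1) (by simp [wronskiPoint]; ring)
    · rw [s.map_sub_comm, neg_ne_zero]
      exact h.xy j a 0 (Λ a - 1) (by simp [wronskiPoint]; ring)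
    · exact h.yy (i := a) (j := b) (fun e => hij (congrArg _ e)) 0 (Λ b - Λ a)
        (by simp [wronskiPoint]; ring)

/-- There is no term in the Wronski relation with `i ∈ I` and `L i = 0`; the corresponding summand
of the alternating identity vanishes since `x i - δ` is among its zeros. -/
theorem altTerm_wronski_eq_zero_of_left (L : Fin m → ℕ) (Λ : Fin r → ℕ) {I : Finset (Fin m)}
    (J : Finset (Fin r)) {i : Fin m} (hi : i ∈ I) (hL : L i = 0) :
    s.altTerm Finset.univ (wronskiPoint x y δ κ Λ) (wronskiZeros x y δ L) (δ - κ)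
      (I.disjSum Jᶜ) = 0 := by
  have hi' : Sum.inl i ∈ I.disjSum Jᶜ := Finset.inl_mem_disjSum.2 hi
  rw [altTerm, Finset.prod_eq_zero hi' (f := fun c => s.thetaProd (wronskiZeros x y δ L)
    (wronskiPoint x y δ κ Λ c)), mul_zero, zero_mul]
  · rw [thetaProd_wronskiZeros, Finset.prod_eq_zero (Finset.mem_univ i), zero_mul]
    rw [wronskiPoint, Sum.elim_inl, hL, ← s.map_zero]
    congr 1
    push_cast
    ring

/-- There is no term in the Wronski relation with `b ∈ J` and `Λ b = 0`; the corresponding summand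
of the alternating identity vanishes since its point for `b`, shifted by `δ - κ`, is the zero `y b`.
-/
theorem altTerm_wronski_eq_zero_of_right (L : Fin m → ℕ) (Λ : Fin r → ℕ) (I : Finset (Fin m))
    {J : Finset (Fin r)} {b : Fin r} (hb : b ∈ J) (hΛ : Λ b = 0) :
    s.altTerm Finset.univ (wronskiPoint x y δ κ Λ) (wronskiZeros x y δ L) (δ - κ)
      (I.disjSum Jᶜ) = 0 := by
  have hb' : Sum.inr b ∈ Iᶜ.disjSum J := Finset.inr_mem_disjSum.2 hb
  rw [altTerm, compl_disjSum, Finset.prod_eq_zero hb' (f := fun c =>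
    s.thetaProd (wronskiZeros x y δ L) (wronskiPoint x y δ κ Λ c + (δ - κ))), mul_zero]
  · rw [thetaProd_wronskiZeros, Finset.prod_eq_zero (Finset.mem_univ b), mul_zero]
    rw [wronskiPoint, Sum.elim_inr, hΛ, ← s.map_zero]
    congr 1
    push_cast
    ring

/-- The total shift `(L, Λ)`, in units of `(δ, -κ)`, of the product of the term of `D^{(k)}`
indexed by `p` and the term of `H^{(l)}` indexed by `q`. -/
def wronskiKey (p : (Fin r → ℕ) × Finset (Fin m)) (q : (Fin m → ℕ) × Finset (Fin r)) :
    (Fin m → ℕ) × (Fin r → ℕ) :=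
  (fun i => q.1 i + if i ∈ p.2 then 1 else 0, fun b => p.1 b + if b ∈ q.2 then 1 else 0)

/-- The value of the coefficient of the total shift `t` in
`∑_{k + l = K} [k κ + l δ] D^{(k)} H^{(l)}`. -/
noncomputable def wronskiCoeff (s : SigmaFunction) (x : Fin m → ℂ) (y : Fin r → ℂ) (δ κ : ℂ)
    (K : ℕ) (t : (Fin m → ℕ) × (Fin r → ℕ)) : ℂ :=
  ∑ kl ∈ Finset.HasAntidiagonal.antidiagonal K,
    ∑ p ∈ (deformedIndex r m kl.1 ×ˢ deformedIndex m r kl.2).filter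
      (fun p => wronskiKey p.1 p.2 = t),
      s (kl.1 * κ + kl.2 * δ) * (s.coeffVal y x (-κ) (-δ) p.1.1 p.1.2 *
        s.coeffVal (fun i => x i + if i ∈ p.1.2 then δ else 0) (fun a => y a + -κ * p.1.1 a)
          δ κ p.2.1 p.2.2)

theorem sum_wronskiKey {K : ℕ} {kl : ℕ × ℕ} (hkl : kl ∈ Finset.HasAntidiagonal.antidiagonal K)
    {t : (Fin m → ℕ) × (Fin r → ℕ)}
    {p : ((Fin r → ℕ) × Finset (Fin m)) × ((Fin m → ℕ) × Finset (Fin r))}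
    (hp : p ∈ (deformedIndex r m kl.1 ×ˢ deformedIndex m r kl.2).filter
      (fun p => wronskiKey p.1 p.2 = t)) : ∑ i, t.1 i + ∑ b, t.2 b = K := by
  obtain ⟨⟨ν, I⟩, ⟨μ, J⟩⟩ := p
  simp only [Finset.mem_filter, Finset.mem_product, mem_deformedIndex] at hp
  obtain ⟨⟨h1, h2⟩, rfl⟩ := hp
  rw [Finset.HasAntidiagonal.mem_antidiagonal] at hkl
  simp only [wronskiKey, Finset.sum_add_distrib, Finset.sum_boole, Finset.filter_mem_eq_inter,
    Finset.univ_inter, Nat.cast_id]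
  omega

theorem wronskiCoeff_eq_zero_of_nonres (h : s.Generic δ κ (Sum.elim x y)) (hn : s.Nonres δ κ)
    {K : ℕ} (hK : 0 < K) (t : (Fin m → ℕ) × (Fin r → ℕ)) : s.wronskiCoeff x y δ κ K t = 0 := by
  by_cases ht : ∑ i, t.1 i + ∑ b, t.2 b = K
  swap
  · refine Finset.sum_eq_zero fun kl hkl => Finset.sum_eq_zero fun p hp => ?_
    exact absurd (sum_wronskiKey hkl hp) ht
  obtain ⟨L, Λ⟩ := t
  have hmr : 0 < m + r := by
    by_contra h0
    obtain ⟨rfl, rfl⟩ : m = 0 ∧ r = 0 := by omega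
    simp at ht
    omega
  set A : Finset (Fin m) → Finset (Fin r) → ℂ := fun I J =>
    s.altTerm Finset.univ (wronskiPoint x y δ κ Λ) (wronskiZeros x y δ L) (δ - κ)
      (I.disjSum Jᶜ) with hA
  have h1 : s.wronskiCoeff x y δ κ K (L, Λ) = s.wronskiConst x y δ κ L Λ *
      ∑ kl ∈ Finset.HasAntidiagonal.antidiagonal K,
        ∑ p ∈ (deformedIndex r m kl.1 ×ˢ deformedIndex m r kl.2).filter
          (fun p => wronskiKey p.1 p.2 = (L, Λ)), A p.1.2 p.2.2 := by
    rw [wronskiCoeff, Finset.mul_sum]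
    refine Finset.sum_congr rfl fun kl hkl => ?_
    rw [Finset.mul_sum]
    refine Finset.sum_congr rfl fun p hp => ?_
    rw [Finset.mem_filter, Finset.mem_product] at hp
    have h1 := (mem_deformedIndex _ _).1 hp.1.1
    have h2 := (mem_deformedIndex _ _).1 hp.1.2
    have h3 := Prod.mk.inj hp.2
    rw [← wronski_term h hn L p.2.1 p.1.2 (fun i => (congrFun h3.1 i).symm) Λ p.1.1 p.2.2
      (fun i => (congrFun h3.2 i).symm), h1, h2]
  have h2 : ∑ kl ∈ Finset.HasAntidiagonal.antidiagonal K,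
        ∑ p ∈ (deformedIndex r m kl.1 ×ˢ deformedIndex m r kl.2).filter
          (fun p => wronskiKey p.1 p.2 = (L, Λ)), A p.1.2 p.2.2 =
      ∑ q ∈ (Finset.univ : Finset (Finset (Fin m) × Finset (Fin r))).filter
        (fun q => (∀ i ∈ q.1, L i ≠ 0) ∧ ∀ b ∈ q.2, Λ b ≠ 0), A q.1 q.2 := by
    rw [Finset.sum_sigma']
    refine Finset.sum_nbij (fun z => (z.2.1.2, z.2.2.2)) ?_ ?_ ?_ fun _ _ => rfl
    · rintro ⟨kl, ⟨ν, I⟩, ⟨μ, J⟩⟩ hz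
      simp only [Finset.mem_sigma, Finset.mem_filter, wronskiKey, Prod.mk.injEq] at hz
      obtain ⟨-, -, h1, h2⟩ := hz
      simp only [Finset.mem_filter, Finset.mem_univ, true_and]
      refine ⟨fun i hi => ?_, fun b hb => ?_⟩
      · rw [← h1]; simp [hi]
      · rw [← h2]; simp [hb]
    · rintro ⟨⟨k, l⟩, ⟨ν, I⟩, ⟨μ, J⟩⟩ hz ⟨⟨k', l'⟩, ⟨ν', I'⟩, ⟨μ', J'⟩⟩ hz' heq
      simp only [Finset.coe_sigma, Set.mem_sigma_iff, Finset.mem_coe, Finset.mem_filter,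
        Finset.mem_product, mem_deformedIndex, wronskiKey, Prod.mk.injEq] at hz hz' heq
      obtain ⟨-, ⟨rfl, rfl⟩, h1, h2⟩ := hz
      obtain ⟨-, ⟨rfl, rfl⟩, h1', h2'⟩ := hz'
      obtain ⟨rfl, rfl⟩ := heq
      obtain rfl : μ = μ' := funext fun i => by
        have := congrFun (h1.trans h1'.symm) i
        simpa using this
      obtain rfl : ν = ν' := funext fun i => by
        have := congrFun (h2.trans h2'.symm) i
        simpa using this
      rfl
    · rintro ⟨I, J⟩ hq
      simp only [Finset.coe_filter, Finset.mem_univ, true_and, Set.mem_ofPred_eq] at hq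
      have e1 : ∀ i, L i = (L i - if i ∈ I then 1 else 0) + if i ∈ I then 1 else 0 := fun i => by
        have := hq.1 i
        split_ifs with hi
        · have := this hi
          omega
        · rfl
      have e2 : ∀ i, Λ i = (Λ i - if i ∈ J then 1 else 0) + if i ∈ J then 1 else 0 := fun i => by
        have := hq.2 i
        split_ifs with hi
        · have := this hi
          omega
        · rfl
      refine ⟨⟨(∑ b, (Λ b - if b ∈ J then 1 else 0) + I.card,
        ∑ i, (L i - if i ∈ I then 1 else 0) + J.card),
        ⟨fun b => Λ b - if b ∈ J then 1 else 0, I⟩, ⟨fun i => L i - if i ∈ I then 1 else 0, J⟩⟩,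
        ?_, rfl⟩
      simp only [Finset.coe_sigma, Set.mem_sigma_iff, Finset.mem_coe, Finset.mem_filter,
        Finset.mem_product, mem_deformedIndex, wronskiKey, Prod.mk.injEq,
        Finset.HasAntidiagonal.mem_antidiagonal, true_and]
      refine ⟨?_, funext fun i => (e1 i).symm, funext fun i => (e2 i).symm⟩
      have f1 : ∑ i, L i = ∑ i, (L i - if i ∈ I then 1 else 0) + I.card := by
        rw [Finset.sum_congr rfl fun i _ => e1 i, Finset.sum_add_distrib]
        simp
      have f2 : ∑ i, Λ i = ∑ i, (Λ i - if i ∈ J then 1 else 0) + J.card := by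
        rw [Finset.sum_congr rfl fun i _ => e2 i, Finset.sum_add_distrib]
        simp
      simp only at ht
      omega
  have h3 : ∑ q ∈ (Finset.univ : Finset (Finset (Fin m) × Finset (Fin r))).filter
        (fun q => (∀ i ∈ q.1, L i ≠ 0) ∧ ∀ b ∈ q.2, Λ b ≠ 0), A q.1 q.2 =
      ∑ q : Finset (Fin m) × Finset (Fin r), A q.1 q.2 := by
    refine Finset.sum_filter_of_ne fun q _ hq => ⟨fun i hi h0 => hq ?_, fun b hb h0 => hq ?_⟩
    · exact altTerm_wronski_eq_zero_of_left L Λ q.2 hi h0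
    · exact altTerm_wronski_eq_zero_of_right L Λ q.1 hb h0
  have h4 : ∑ q : Finset (Fin m) × Finset (Fin r), A q.1 q.2 =
      ∑ S : Finset (Fin m ⊕ Fin r), s.altTerm Finset.univ (wronskiPoint x y δ κ Λ)
        (wronskiZeros x y δ L) (δ - κ) S := by
    refine Finset.sum_bij' (fun q _ => q.1.disjSum q.2ᶜ) (fun S _ => (S.toLeft, S.toRightᶜ))
      (fun _ _ => Finset.mem_univ _) (fun _ _ => Finset.mem_univ _) ?_ ?_ fun _ _ => rfl
    · intro q _
      ext <;> simp
    · intro S _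
      ext (i | b) <;> simp
  rw [h1, h2, h3, h4, sum_altTerm_wronski h hmr, mul_zero]

end SigmaFunction

/-! ### Arbitrary parameters -/

namespace SigmaFunction

variable {s : SigmaFunction} {m r : ℕ} {x : Fin m → ℂ} {y : Fin r → ℂ} {δ κ : ℂ}

/-- None of the denominators of the coefficient `C_{μ,I}(x; y; δ, κ)` vanishes. -/
structure CoeffRegular (s : SigmaFunction) (x : Fin m → ℂ) (y : Fin r → ℂ) (δ : ℂ)
    (μ : Fin m → ℕ) : Prop where
  left : ∀ i j, i ≠ j → s (x i - x j) ≠ 0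
  right : ∀ i j, i ≠ j → s (y i - y j) ≠ 0
  poch : ∀ i j, ∀ a < μ i, s (x i - x j + δ + a * δ) ≠ 0
  mixed : ∀ i j, s (x i - y j + (μ i : ℂ) * δ) ≠ 0
  mixed' : ∀ i j, s (x i - y j + ((μ i : ℂ) - 1) * δ) ≠ 0

theorem Generic.coeffRegular (h : s.Generic δ κ (Sum.elim x y))
    (hδ : ∀ n : ℕ, 0 < n → s (n * δ) ≠ 0) (μ : Fin m → ℕ) : s.CoeffRegular x y δ μ where
  left i j hij := h.xx hij 0 0 (by simp)
  right i j hij := h.yy hij 0 0 (by simp)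
  poch i j a _ := by
    by_cases hij : i = j
    · subst hij
      have := hδ (a + 1) (Nat.succ_pos a)
      rwa [show ((a + 1 : ℕ) : ℂ) * δ = x i - x i + δ + a * δ by push_cast; ring] at this
    · exact h.xx hij (a + 1) 0 (by push_cast; ring)
  mixed i j := h.xy i j (μ i) 0 (by push_cast; ring)
  mixed' i j := h.xy i j (μ i - 1) 0 (by push_cast; ring)

theorem Generic.swap (h : s.Generic δ κ (Sum.elim x y)) :
    s.Generic (-κ) (-δ) (Sum.elim y x) := by
  intro i j hij a b
  refine h.ne (i := i.swap) (j := j.swap) (fun e => hij ((Equiv.sumComm _ _).injective e))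
    (-b) (-a) ?_
  rcases i with i | i <;> rcases j with j | j <;>
    · simp
      ring

theorem Generic.shift {ι : Type*} {z : ι → ℂ} (h : s.Generic δ κ z) (a b : ι → ℤ) :
    s.Generic δ κ (fun i => z i + a i * δ + b i * κ) := fun i j hij c d =>
  h.ne hij (a i - a j + c) (b i - b j + d) (by push_cast; ring)

/-- Shifting `x` and `y` as the terms of `H^{(k)}` do preserves genericity. -/
theorem Generic.shift_left (h : s.Generic δ κ (Sum.elim x y)) (μ : Fin m → ℕ)
    (I : Finset (Fin r)) :
    s.Generic δ κ (Sum.elim (fun i => x i + δ * μ i) fun j => y j + if j ∈ I then -κ else 0) := by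
  convert h.shift (Sum.elim (fun i => (μ i : ℤ)) fun _ => 0)
    (Sum.elim (fun _ => 0) fun j => if j ∈ I then -1 else 0) using 1
  ext (i | j)
  · simp [mul_comm]
  · by_cases hj : j ∈ I <;> simp [hj]

/-- Shifting `x` and `y` as the terms of `D^{(k)}` do preserves genericity. -/
theorem Generic.shift_right (h : s.Generic δ κ (Sum.elim x y)) (I : Finset (Fin m))
    (ν : Fin r → ℕ) :
    s.Generic δ κ (Sum.elim (fun i => x i + if i ∈ I then δ else 0) fun j => y j + -κ * ν j) := by
  convert h.shift (Sum.elim (fun i => if i ∈ I then 1 else 0) fun _ => 0)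
    (Sum.elim (fun _ => 0) fun j => -(ν j : ℤ)) using 1
  ext (i | j)
  · by_cases hi : i ∈ I <;> simp [hi]
  · simp [mul_comm]

theorem _root_.ContinuousAt.coeffVal {T : Type*} [TopologicalSpace T] {t₀ : T}
    {x : T → Fin m → ℂ} {y : T → Fin r → ℂ} {δ κ : T → ℂ}
    (hx : ∀ i, ContinuousAt (fun t => x t i) t₀) (hy : ∀ j, ContinuousAt (fun t => y t j) t₀)
    (hδ : ContinuousAt δ t₀) (hκ : ContinuousAt κ t₀) {μ : Fin m → ℕ}
    (h : s.CoeffRegular (x t₀) (y t₀) (δ t₀) μ) (I : Finset (Fin r)) :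
    ContinuousAt (fun t => s.coeffVal (x t) (y t) (δ t) (κ t) μ I) t₀ := by
  have hs : ∀ {f : T → ℂ}, ContinuousAt f t₀ → ContinuousAt (fun t => s (f t)) t₀ := fun hf =>
    s.continuous.continuousAt.comp hf
  have hpoch : ∀ {f g : T → ℂ} (k : ℕ), ContinuousAt f t₀ → ContinuousAt g t₀ →
      ContinuousAt (fun t => s.poch (f t) (g t) k) t₀ := fun k hf hg =>
    tendsto_finsetProd _ fun a _ => hs (hg.add (continuousAt_const.mul hf))
  unfold SigmaFunction.coeffVal
  refine ((((continuousAt_const.mul ?_).mul ?_).mul ?_).mul ?_)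
  · refine tendsto_finsetProd _ fun i _ => tendsto_finsetProd _ fun j hj => ?_
    exact (hs (((hx i).sub (hx j)).add (continuousAt_const.mul hδ))).div
      (hs ((hx i).sub (hx j))) (h.left i j (Finset.mem_Ioi.1 hj).ne)
  · refine tendsto_finsetProd _ fun i hi => tendsto_finsetProd _ fun j hj => ?_
    exact (hs (((hy i).sub (hy j)).sub hδ)).div
      (hs ((hy i).sub (hy j))) (h.right i j fun e => Finset.mem_compl.1 hj (e ▸ hi))
  · refine tendsto_finsetProd _ fun i _ => tendsto_finsetProd _ fun j _ => ?_
    exact (hpoch _ hδ (((hx i).sub (hx j)).add hκ)).div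
      (hpoch _ hδ (((hx i).sub (hx j)).add hδ)) (poch_ne_zero (h.poch i j))
  · refine tendsto_finsetProd _ fun i _ => ContinuousAt.mul ?_ ?_
    · refine tendsto_finsetProd _ fun j _ => ?_
      exact (hs (((hx i).sub (hy j)).sub hκ)).div
        (hs (((hx i).sub (hy j)).add (continuousAt_const.mul hδ))) (h.mixed i j)
    · refine tendsto_finsetProd _ fun j _ => ?_
      exact (hs (((hx i).sub (hy j)).sub hδ)).div
        (hs (((hx i).sub (hy j)).add (continuousAt_const.mul hδ))) (h.mixed' i j)

/-- Only countably many values of the second parameter destroy genericity. -/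
theorem dense_generic {ι : Type*} [Countable ι] {z : ι → ℂ} (h : s.Generic δ κ z)
    (hδ : ∀ n : ℕ, 0 < n → s (n * δ) ≠ 0) :
    Dense {κ' : ℂ | s.Generic δ κ' z ∧ s.Nonres δ κ'} := by
  have hc₁ : (⋃ p : (ι × ι) × ℤ × ℤ, ⋃ _ : p.2.2 ≠ 0,
      {t : ℂ | s (z p.1.1 - z p.1.2 + p.2.1 * δ + t * p.2.2) = 0}).Countable := by
    refine Set.countable_iUnion fun p => Set.countable_iUnion fun hp => ?_
    exact s.countable_zeros_affine _ (Int.cast_ne_zero.2 hp)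
  have hc₂ : (⋃ p : ℤ × ℤ, ⋃ _ : p.2 ≠ 0, {t : ℂ | s (p.1 * δ + t * p.2) = 0}).Countable := by
    refine Set.countable_iUnion fun p => Set.countable_iUnion fun hp => ?_
    exact s.countable_zeros_affine _ (Int.cast_ne_zero.2 hp)
  refine ((hc₁.union hc₂).dense_compl ℂ).mono fun κ' hκ' => ?_
  simp only [Set.mem_compl_iff, Set.mem_union, Set.mem_iUnion, Set.mem_ofPred_eq, not_or,
    not_exists] at hκ'
  refine ⟨fun i j hij a b => ?_, fun a b hab => ?_⟩
  · by_cases hb : b = 0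
    · subst hb
      exact h.ne hij a 0 (by simp)
    · rw [mul_comm (b : ℂ)]
      exact hκ'.1 ((i, j), a, b) hb
  · by_cases hb : b = 0
    · subst hb
      have ha : a ≠ 0 := fun ha => hab (by rw [ha]; rfl)
      rw [Int.cast_zero, zero_mul, add_zero]
      have hpos : 0 < a.natAbs := Int.natAbs_pos.2 ha
      have := hδ _ hpos
      rcases Int.natAbs_eq a with h1 | h1
      · rwa [h1, Int.cast_natCast]
      · rwa [h1, Int.cast_neg, Int.cast_natCast, neg_mul, s.map_neg, neg_ne_zero]
    · rw [mul_comm (b : ℂ)]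
      exact hκ'.2 (a, b) hb

theorem eq_zero_of_dense {F : ℂ → ℂ} {w : ℂ} {G : Set ℂ} (hG : Dense G) (hF : ContinuousAt F w)
    (h : ∀ t ∈ G, F t = 0) : F w = 0 := by
  by_contra h0
  obtain ⟨t, htG, ht⟩ := hG.inter_nhds_nonempty (hF.eventually_ne h0)
  exact ht (h t htG)

theorem continuousAt_shiftCoeff (h : s.Generic δ κ (Sum.elim x y))
    (hδ : ∀ n : ℕ, 0 < n → s (n * δ) ≠ 0) (k l : ℕ)
    (t : (Fin m → ℕ) × Finset (Fin r) × Finset (Fin r)) :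
    ContinuousAt (fun κ' => s.shiftCoeff x y δ κ' k l t) κ := by
  unfold shiftCoeff
  refine tendsto_finsetSum _ fun p _ => ContinuousAt.mul ?_ ?_
  · exact ContinuousAt.coeffVal (x := fun _ => x) (y := fun _ => y) (δ := fun _ => δ)
      (κ := fun κ' => κ') (fun _ => continuousAt_const) (fun _ => continuousAt_const)
      continuousAt_const continuousAt_id (h.coeffRegular hδ _) _
  · refine ContinuousAt.coeffVal (x := fun _ i => x i + δ * p.1.1 i)
      (y := fun κ' j => y j + if j ∈ p.1.2 then -κ' else 0) (δ := fun _ => δ)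
      (κ := fun κ' => κ') (fun _ => continuousAt_const) (fun j => ?_)
      continuousAt_const continuousAt_id ((h.shift_left p.1.1 p.1.2).coeffRegular hδ _) _
    refine continuousAt_const.add ?_
    split_ifs
    · exact continuousAt_id.neg
    · exact continuousAt_const

/-- The values of the coefficients of two products of the operators in opposite orders agree. -/
theorem shiftCoeff_comm (h : s.Generic δ κ (Sum.elim x y))
    (hδ : ∀ n : ℕ, 0 < n → s (n * δ) ≠ 0) (k l : ℕ)
    (t : (Fin m → ℕ) × Finset (Fin r) × Finset (Fin r)) :
    s.shiftCoeff x y δ κ k l t = s.shiftCoeff x y δ κ l k t := by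
  rw [← sub_eq_zero]
  refine eq_zero_of_dense (F := fun κ' => s.shiftCoeff x y δ κ' k l t - s.shiftCoeff x y δ κ' l k t)
    (dense_generic h hδ) ((continuousAt_shiftCoeff h hδ k l t).sub
      (continuousAt_shiftCoeff h hδ l k t)) fun κ' hκ' => ?_
  rw [sub_eq_zero]
  exact shiftCoeff_comm_of_nonres hκ'.1 hκ'.2 k l t

/-- The Wronski relation at the level of coefficients. -/
theorem wronskiCoeff_eq_zero (h : s.Generic δ κ (Sum.elim x y))
    (hδ : ∀ n : ℕ, 0 < n → s (n * δ) ≠ 0) (hκ : ∀ n : ℕ, 0 < n → s (n * κ) ≠ 0) {K : ℕ}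
    (hK : 0 < K) (t : (Fin m → ℕ) × (Fin r → ℕ)) : s.wronskiCoeff x y δ κ K t = 0 := by
  refine eq_zero_of_dense (F := fun κ' => s.wronskiCoeff x y δ κ' K t) (dense_generic h hδ) ?_
    fun κ' hκ' => wronskiCoeff_eq_zero_of_nonres hκ'.1 hκ'.2 hK t
  have hκ' : ∀ n : ℕ, 0 < n → s (n * -κ) ≠ 0 := fun n hn => by
    rw [mul_neg, s.map_neg, neg_ne_zero]
    exact hκ n hn
  unfold wronskiCoeff
  refine tendsto_finsetSum _ fun kl _ => tendsto_finsetSum _ fun p _ => ?_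
  refine ContinuousAt.mul (s.continuous.continuousAt.comp (by fun_prop)) (ContinuousAt.mul ?_ ?_)
  · exact ContinuousAt.coeffVal (x := fun _ => y) (y := fun _ => x) (δ := fun κ' => -κ')
      (κ := fun _ => -δ) (fun _ => continuousAt_const) (fun _ => continuousAt_const)
      continuousAt_id.neg continuousAt_const (h.swap.coeffRegular hκ' _) _
  · refine ContinuousAt.coeffVal (x := fun _ i => x i + if i ∈ p.1.2 then δ else 0)
      (y := fun κ' j => y j + -κ' * p.1.1 j) (δ := fun _ => δ)
      (κ := fun κ' => κ') (fun _ => continuousAt_const) (fun j => by fun_prop)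
      continuousAt_const continuousAt_id ((h.shift_right p.1.2 p.1.1).coeffRegular hδ _) _

end SigmaFunction

/-! ### Values of meromorphic functions -/

section HasVal

variable {ι : Type} [Fintype ι]

/-- The meromorphic function `f` is regular at `p`, with value `v`: it is a quotient of entire
functions whose denominator does not vanish at `p`. -/
def Mero.HasVal (f : Mero ι) (p : ι → ℂ) (v : ℂ) : Prop :=
  ∃ n d : Entire ι, f * algebraMap (Entire ι) (Mero ι) d = algebraMap (Entire ι) (Mero ι) n ∧
    d.1 p ≠ 0 ∧ n.1 p = v * d.1 p

namespace Mero

variable {f g : Mero ι} {p : ι → ℂ} {v w : ℂ}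

theorem hasVal_algebraMap (n : Entire ι) (p : ι → ℂ) :
    HasVal (algebraMap (Entire ι) (Mero ι) n) p (n.1 p) :=
  ⟨n, 1, by rw [_root_.map_one, mul_one], one_ne_zero, (mul_one _).symm⟩

theorem hasVal_one (p : ι → ℂ) : HasVal (1 : Mero ι) p 1 := by
  have h := hasVal_algebraMap (1 : Entire ι) p
  rwa [_root_.map_one] at h

theorem hasVal_zero (p : ι → ℂ) : HasVal (0 : Mero ι) p 0 := by
  have h := hasVal_algebraMap (0 : Entire ι) p
  rwa [_root_.map_zero] at h

theorem HasVal.mul (hf : HasVal f p v) (hg : HasVal g p w) : HasVal (f * g) p (v * w) := by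
  obtain ⟨n, d, h, hd, hv⟩ := hf
  obtain ⟨n', d', h', hd', hw⟩ := hg
  refine ⟨n * n', d * d', ?_, mul_ne_zero hd hd', ?_⟩
  · rw [map_mul, map_mul, ← h, ← h']
    ring
  · change n.1 p * n'.1 p = v * w * (d.1 p * d'.1 p)
    rw [hv, hw]
    ring

theorem HasVal.add (hf : HasVal f p v) (hg : HasVal g p w) : HasVal (f + g) p (v + w) := by
  obtain ⟨n, d, h, hd, hv⟩ := hf
  obtain ⟨n', d', h', hd', hw⟩ := hg
  refine ⟨n * d' + n' * d, d * d', ?_, mul_ne_zero hd hd', ?_⟩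
  · rw [map_mul, map_add, map_mul, map_mul, ← h, ← h']
    ring
  · change n.1 p * d'.1 p + n'.1 p * d.1 p = (v + w) * (d.1 p * d'.1 p)
    rw [hv, hw]
    ring

theorem HasVal.smul (a : ℂ) (hf : HasVal f p v) : HasVal (a • f) p (a * v) := by
  obtain ⟨n, d, h, hd, hv⟩ := hf
  refine ⟨a • n, d, ?_, hd, ?_⟩
  · rw [Algebra.smul_def, Algebra.smul_def a n, map_mul, ← IsScalarTower.algebraMap_apply,
      mul_assoc, h]
  · change a * n.1 p = _
    rw [hv, mul_assoc]

theorem HasVal.sub (hf : HasVal f p v) (hg : HasVal g p w) : HasVal (f - g) p (v - w) := by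
  have h := hf.add (hg.smul (-1))
  rwa [neg_one_smul, neg_one_mul, ← sub_eq_add_neg, ← sub_eq_add_neg] at h

theorem HasVal.div (hf : HasVal f p v) (hg : HasVal g p w) (hw : w ≠ 0) :
    HasVal (f / g) p (v / w) := by
  obtain ⟨n, d, h, hd, hv⟩ := hf
  obtain ⟨n', d', h', hd', hw'⟩ := hg
  have hn' : n'.1 p ≠ 0 := hw' ▸ mul_ne_zero hw hd'
  have hn0 : algebraMap (Entire ι) (Mero ι) n' ≠ 0 := by
    rw [Ne, IsFractionRing.to_map_eq_zero_iff]
    rintro rfl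
    exact hn' rfl
  have hg0 : g ≠ 0 := by
    rintro rfl
    exact hn0 (by rw [← h', zero_mul])
  refine ⟨n * d', d * n', ?_, mul_ne_zero hd hn', ?_⟩
  · rw [map_mul, map_mul, ← h, ← h']
    field_simp
  · change n.1 p * d'.1 p = v / w * (d.1 p * n'.1 p)
    rw [hv, hw']
    field_simp

theorem HasVal.sum {α : Type*} {A : Finset α} {F : α → Mero ι} {V : α → ℂ}
    (h : ∀ a ∈ A, HasVal (F a) p (V a)) : HasVal (∑ a ∈ A, F a) p (∑ a ∈ A, V a) := by
  classical
  induction A using Finset.induction_on with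
  | empty => simpa using hasVal_zero p
  | insert a A ha ih =>
    rw [Finset.sum_insert ha, Finset.sum_insert ha]
    exact (h a (Finset.mem_insert_self a A)).add
      (ih fun b hb => h b (Finset.mem_insert_of_mem hb))

theorem HasVal.prod {α : Type*} {A : Finset α} {F : α → Mero ι} {V : α → ℂ}
    (h : ∀ a ∈ A, HasVal (F a) p (V a)) : HasVal (∏ a ∈ A, F a) p (∏ a ∈ A, V a) := by
  classical
  induction A using Finset.induction_on with
  | empty => simpa using hasVal_one p
  | insert a A ha ih =>
    rw [Finset.prod_insert ha, Finset.prod_insert ha]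
    exact (h a (Finset.mem_insert_self a A)).mul
      (ih fun b hb => h b (Finset.mem_insert_of_mem hb))

theorem shift_algebraMap (v : ι → ℂ) (n : Entire ι) :
    Mero.shift v (algebraMap (Entire ι) (Mero ι) n) =
      algebraMap (Entire ι) (Mero ι) (Entire.shift v n) :=
  IsFractionRing.fieldEquivOfAlgEquiv_algebraMap ℂ (Mero ι) (Mero ι) (Entire.shift v) n

theorem shift_mul (v : ι → ℂ) (f g : Mero ι) :
    Mero.shift v (f * g) = Mero.shift v f * Mero.shift v g :=
  map_mul (IsFractionRing.fieldEquivOfAlgEquiv ℂ (Mero ι) (Mero ι) (Entire.shift v)) f g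

theorem shift_div (v : ι → ℂ) (f g : Mero ι) :
    Mero.shift v (f / g) = Mero.shift v f / Mero.shift v g :=
  map_div₀ (IsFractionRing.fieldEquivOfAlgEquiv ℂ (Mero ι) (Mero ι) (Entire.shift v)) f g

theorem shift_shift (v w : ι → ℂ) (f : Mero ι) :
    Mero.shift v (Mero.shift w f) = Mero.shift (v + w) f := by
  have hE : ∀ n : Entire ι, Entire.shift v (Entire.shift w n) = Entire.shift (v + w) n :=
    fun n => Subtype.ext (funext fun p => congrArg n.1 (add_assoc p v w))
  obtain ⟨n, d, -, rfl⟩ := IsFractionRing.div_surjective (A := Entire ι) f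
  rw [shift_div, shift_div, shift_div]
  simp only [shift_algebraMap, hE]

theorem shift_zero : (Mero.shift (0 : ι → ℂ)) = 1 := by
  ext f
  have hE : ∀ n : Entire ι, Entire.shift 0 n = n :=
    fun n => Subtype.ext (funext fun p => congrArg n.1 (add_zero p))
  obtain ⟨n, d, -, rfl⟩ := IsFractionRing.div_surjective (A := Entire ι) f
  rw [shift_div, shift_algebraMap, shift_algebraMap, hE, hE]
  rfl

theorem HasVal.shift (u : ι → ℂ) (h : HasVal f (p + u) v) : HasVal (Mero.shift u f) p v := by
  obtain ⟨n, d, h, hd, hv⟩ := h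
  refine ⟨Entire.shift u n, Entire.shift u d, ?_, hd, hv⟩
  rw [← shift_algebraMap, ← shift_algebraMap, ← shift_mul, h]

/-- A meromorphic function with value zero at every generic point is zero. -/
theorem eq_zero_of_hasVal_zero (s : SigmaFunction) (δ κ : ℂ)
    (h : ∀ p : ι → ℂ, s.Generic δ κ p → HasVal f p 0) : f = 0 := by
  obtain ⟨n, d, hd, rfl⟩ := IsFractionRing.div_surjective (A := Entire ι) f
  by_contra hf
  have hn : n ≠ 0 := by
    rintro rfl
    exact hf (by rw [_root_.map_zero, zero_div])
  obtain ⟨p₀, hp₀⟩ : ∃ p, n.1 p ≠ 0 := by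
    by_contra hcon
    push Not at hcon
    exact hn (Subtype.ext (funext hcon))
  -- the generic points on a line through `p₀` whose direction has distinct components
  set w : ι → ℂ := fun i => ((Fintype.equivFin ι i : ℕ) : ℂ) with hw
  have hwne : ∀ i j, i ≠ j → w i - w j ≠ 0 := fun i j hij h0 => hij <| by
    rw [sub_eq_zero, hw] at h0
    exact (Fintype.equivFin ι).injective (Fin.ext (Nat.cast_injective h0))
  have hc : (⋃ q : (ι × ι) × ℤ × ℤ, ⋃ _ : q.1.1 ≠ q.1.2,
      {t : ℂ | s ((p₀ q.1.1 - p₀ q.1.2 + q.2.1 * δ + q.2.2 * κ) +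
        t * (w q.1.1 - w q.1.2)) = 0}).Countable := by
    refine Set.countable_iUnion fun q => Set.countable_iUnion fun hq => ?_
    exact s.countable_zeros_affine _ (hwne _ _ hq)
  have hcont : ContinuousAt (fun t : ℂ => n.1 (p₀ + t • w)) 0 := by
    have h1 : ContinuousAt n.1 (p₀ + (0 : ℂ) • w) := (n.2 _ (Set.mem_univ _)).continuousAt
    exact ContinuousAt.comp (f := fun t : ℂ => p₀ + t • w) h1 (by fun_prop)
  obtain ⟨t, htG, ht⟩ := (hc.dense_compl ℂ).inter_nhds_nonempty
    (hcont.eventually_ne (by simpa using hp₀))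
  simp only [Set.mem_compl_iff, Set.mem_iUnion, Set.mem_ofPred_eq, not_exists] at htG
  obtain ⟨n', d', h', hd', hn'⟩ := h (p₀ + t • w) fun i j hij a b => by
    refine fun h0 => htG ((i, j), a, b) hij ?_
    rw [← h0]
    congr 1
    simp only [Pi.add_apply, Pi.smul_apply, smul_eq_mul]
    ring
  have hd0 : algebraMap (Entire ι) (Mero ι) d ≠ 0 := fun h0 => hf (by rw [h0, div_zero])
  rw [div_mul_eq_mul_div, div_eq_iff hd0, ← map_mul, ← map_mul] at h'
  have h2 := congrArg (fun e : Entire ι => e.1 (p₀ + t • w))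
    (IsFractionRing.injective (Entire ι) (Mero ι) h')
  change n.1 _ * d'.1 _ = n'.1 _ * d.1 _ at h2
  rw [hn', zero_mul, zero_mul] at h2
  exact mul_ne_zero ht hd' h2

end Mero

namespace SigmaFunction

variable {s : SigmaFunction}

theorem hasVal_br (f : Entire ι) (p : ι → ℂ) : Mero.HasVal (s.br f) p (s (f.1 p)) :=
  Mero.hasVal_algebraMap _ p

theorem hasVal_brFactorial (δ : ℂ) (f : Entire ι) (k : ℕ) (p : ι → ℂ) :
    Mero.HasVal (s.brFactorial δ f k) p (s.poch δ (f.1 p) k) :=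
  Mero.HasVal.prod fun _ _ => hasVal_br _ p

/-- `coeffVal` is the value of the meromorphic function `deformedCoeff` wherever no denominator
vanishes. -/
theorem hasVal_deformedCoeff {m r : ℕ} {x : Fin m → Entire ι} {y : Fin r → Entire ι} {δ : ℂ}
    (κ : ℂ) {μ : Fin m → ℕ} (I : Finset (Fin r)) {p : ι → ℂ}
    (h : s.CoeffRegular (fun i => (x i).1 p) (fun j => (y j).1 p) δ μ) :
    Mero.HasVal (deformedCoeff s x y δ κ μ I) p
      (s.coeffVal (fun i => (x i).1 p) (fun j => (y j).1 p) δ κ μ I) := by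
  unfold deformedCoeff coeffVal
  refine ((((?_ : Mero.HasVal _ _ _).mul ?_).mul ?_).mul ?_).mul ?_
  · have h1 := Mero.HasVal.prod (p := p) (A := I) (F := fun _ => (-1 : Mero ι))
      (V := fun _ => (-1 : ℂ)) fun _ _ => by
        simpa using (Mero.hasVal_one p).smul (-1)
    simpa using h1
  · refine Mero.HasVal.prod fun i _ => Mero.HasVal.prod fun j hj => ?_
    exact (hasVal_br _ p).div (hasVal_br _ p) (h.left i j (Finset.mem_Ioi.1 hj).ne)
  · refine Mero.HasVal.prod fun i hi => Mero.HasVal.prod fun j hj => ?_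
    exact (hasVal_br _ p).div (hasVal_br _ p)
      (h.right i j fun e => Finset.mem_compl.1 hj (e ▸ hi))
  · refine Mero.HasVal.prod fun i _ => Mero.HasVal.prod fun j _ => ?_
    exact (hasVal_brFactorial _ _ _ p).div (hasVal_brFactorial _ _ _ p)
      (poch_ne_zero (h.poch i j))
  · refine Mero.HasVal.prod fun i _ => Mero.HasVal.mul ?_ ?_
    · refine Mero.HasVal.prod fun j _ => ?_
      exact (hasVal_br _ p).div (hasVal_br _ p) (h.mixed i j)
    · refine Mero.HasVal.prod fun j _ => ?_
      exact (hasVal_br _ p).div (hasVal_br _ p) (h.mixed' i j)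

end SigmaFunction

end HasVal

/-! ### Difference operators -/

section Operators

variable {ι : Type} [Fintype ι]

/-- The operator `f ↦ c · f(· + v)`. -/
noncomputable def Mero.op (c : Mero ι) (v : ι → ℂ) : Module.End ℂ (Mero ι) :=
  LinearMap.mulLeft ℂ c * Mero.shift v

namespace Mero

theorem op_apply (c : Mero ι) (v : ι → ℂ) (f : Mero ι) : op c v f = c * Mero.shift v f := rfl

theorem op_mul_op (c d : Mero ι) (v w : ι → ℂ) :
    op c v * op d w = op (c * Mero.shift v d) (v + w) := by
  refine LinearMap.ext fun f => ?_
  rw [Module.End.mul_apply, op_apply, op_apply, op_apply, shift_mul, shift_shift, mul_assoc]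

theorem smul_op (a : ℂ) (c : Mero ι) (v : ι → ℂ) : a • op c v = op (a • c) v := by
  refine LinearMap.ext fun f => ?_
  rw [LinearMap.smul_apply, op_apply, op_apply, smul_mul_assoc]

theorem sum_op {α : Type*} (A : Finset α) (c : α → Mero ι) (v : ι → ℂ) :
    ∑ a ∈ A, op (c a) v = op (∑ a ∈ A, c a) v := by
  refine LinearMap.ext fun f => ?_
  rw [LinearMap.sum_apply, op_apply, Finset.sum_mul]
  rfl

theorem sum_op_mul_sum_op {α β : Type*} (A : Finset α) (B : Finset β) (c : α → Mero ι)
    (d : β → Mero ι) (v : α → ι → ℂ) (w : β → ι → ℂ) :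
    (∑ a ∈ A, op (c a) (v a)) * ∑ b ∈ B, op (d b) (w b) =
      ∑ p ∈ A ×ˢ B, op (c p.1 * Mero.shift (v p.1) (d p.2)) (v p.1 + w p.2) := by
  rw [Finset.sum_mul_sum, Finset.sum_product]
  simp only [op_mul_op]

theorem sum_op_eq_sum_fiber {α γ : Type*} [DecidableEq γ] {A : Finset α} {c : α → Mero ι}
    {key : α → γ} (u : γ → ι → ℂ) {T : Finset γ} (hT : ∀ a ∈ A, key a ∈ T) :
    ∑ a ∈ A, op (c a) (u (key a)) =
      ∑ t ∈ T, op (∑ a ∈ A.filter (fun a => key a = t), c a) (u t) := by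
  rw [← Finset.sum_fiberwise_of_maps_to hT]
  refine Finset.sum_congr rfl fun t _ => ?_
  rw [← sum_op]
  refine Finset.sum_congr rfl fun a ha => ?_
  rw [(Finset.mem_filter.1 ha).2]

/-- Two sums of weighted shifts agree as soon as the total weights of each shift agree. -/
theorem sum_op_congr {α β γ : Type*} [DecidableEq γ] {A : Finset α} {B : Finset β}
    {c : α → Mero ι} {d : β → Mero ι} {key : α → γ} {key' : β → γ} (u : γ → ι → ℂ)
    (h : ∀ t, ∑ a ∈ A.filter (fun a => key a = t), c a =
      ∑ b ∈ B.filter (fun b => key' b = t), d b) :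
    ∑ a ∈ A, op (c a) (u (key a)) = ∑ b ∈ B, op (d b) (u (key' b)) := by
  rw [sum_op_eq_sum_fiber (T := A.image key ∪ B.image key') u fun a ha =>
      Finset.mem_union_left _ (Finset.mem_image_of_mem _ ha),
    sum_op_eq_sum_fiber (T := A.image key ∪ B.image key') u fun b hb =>
      Finset.mem_union_right _ (Finset.mem_image_of_mem _ hb)]
  exact Finset.sum_congr rfl fun t _ => by rw [h]

end Mero

end Operators

section DeformedOperators

variable {s : SigmaFunction} {δ κ : ℂ} {m r : ℕ}

theorem SigmaFunction.nat_mul_neg_ne_zero (hκ : ∀ n : ℕ, 0 < n → s (n * κ) ≠ 0) (n : ℕ)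
    (hn : 0 < n) : s (n * -κ) ≠ 0 := by
  rw [mul_neg, s.map_neg, neg_ne_zero]
  exact hκ n hn

theorem Mero.eq_zero_of_hasVal_elim {f : Mero (Fin m ⊕ Fin r)} (s : SigmaFunction) (δ κ : ℂ)
    (h : ∀ (x : Fin m → ℂ) (y : Fin r → ℂ), s.Generic δ κ (Sum.elim x y) →
      HasVal f (Sum.elim x y) 0) : f = 0 := by
  refine eq_zero_of_hasVal_zero s δ κ fun p hp => ?_
  rw [← Sum.elim_comp_inl_inr p] at hp ⊢
  exact h _ _ hp

theorem Mero.eq_of_hasVal_elim {f g : Mero (Fin m ⊕ Fin r)} (s : SigmaFunction) (δ κ : ℂ)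
    {V : (Fin m → ℂ) → (Fin r → ℂ) → ℂ}
    (hf : ∀ x y, s.Generic δ κ (Sum.elim x y) → HasVal f (Sum.elim x y) (V x y))
    (hg : ∀ x y, s.Generic δ κ (Sum.elim x y) → HasVal g (Sum.elim x y) (V x y)) : f = g := by
  rw [← sub_eq_zero]
  refine eq_zero_of_hasVal_elim s δ κ fun x y h => ?_
  have := (hf x y h).sub (hg x y h)
  rwa [sub_self] at this

theorem hasVal_coeffH (hδ : ∀ n : ℕ, 0 < n → s (n * δ) ≠ 0) (μ : Fin m → ℕ)
    (I : Finset (Fin r)) {x : Fin m → ℂ} {y : Fin r → ℂ} (h : s.Generic δ κ (Sum.elim x y)) :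
    Mero.HasVal (deformedCoeff s (xVar m r) (yVar m r) δ κ μ I) (Sum.elim x y)
      (s.coeffVal x y δ κ μ I) :=
  SigmaFunction.hasVal_deformedCoeff κ I (h.coeffRegular hδ μ)

theorem hasVal_coeffD (hκ : ∀ n : ℕ, 0 < n → s (n * κ) ≠ 0) (ν : Fin r → ℕ)
    (I : Finset (Fin m)) {x : Fin m → ℂ} {y : Fin r → ℂ} (h : s.Generic δ κ (Sum.elim x y)) :
    Mero.HasVal (deformedCoeff s (yVar m r) (xVar m r) (-κ) (-δ) ν I) (Sum.elim x y)
      (s.coeffVal y x (-κ) (-δ) ν I) :=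
  SigmaFunction.hasVal_deformedCoeff (-δ) I
    (h.swap.coeffRegular (SigmaFunction.nat_mul_neg_ne_zero hκ) ν)

theorem deformedIndex_zero : deformedIndex m r 0 = {(0, ∅)} := by
  ext ⟨μ, I⟩
  rw [mem_deformedIndex, Finset.mem_singleton, Prod.mk.injEq, Nat.add_eq_zero_iff,
    Finset.card_eq_zero, Finset.sum_eq_zero_iff, funext_iff]
  simp

theorem SigmaFunction.coeffVal_zero {x : Fin m → ℂ} {y : Fin r → ℂ}
    (h : s.Generic δ κ (Sum.elim x y)) : s.coeffVal x y δ κ 0 ∅ = 1 := by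
  unfold coeffVal
  rw [Finset.card_empty, pow_zero, one_mul, Finset.prod_empty, mul_one,
    Finset.prod_eq_one, Finset.prod_eq_one, Finset.prod_eq_one, one_mul, one_mul]
  · intro i _
    rw [Finset.prod_empty, one_mul]
    refine Finset.prod_eq_one fun j _ => ?_
    rw [show x i - y j + ((((0 : Fin m → ℕ) i : ℕ) : ℂ) - 1) * δ = x i - y j - δ by simp; ring]
    exact div_self (h.xy i j (-1) 0 (by push_cast; ring))
  · intro i _
    refine Finset.prod_eq_one fun j _ => ?_
    simp [poch]
  · intro i _
    refine Finset.prod_eq_one fun j hj => ?_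
    simp only [Pi.zero_apply, sub_self, zero_mul, add_zero]
    exact div_self (h.xx (Finset.mem_Ioi.1 hj).ne 0 0 (by simp))

theorem opH_zero (hδ : ∀ n : ℕ, 0 < n → s (n * δ) ≠ 0) : opH s δ κ m r 0 = 1 := by
  rw [opH, deformedIndex_zero, Finset.sum_singleton]
  have h1 : deformedCoeff s (xVar m r) (yVar m r) δ κ 0 ∅ = 1 :=
    Mero.eq_of_hasVal_elim s δ κ (V := fun _ _ => 1) (fun x y h => by
      have := hasVal_coeffH hδ 0 ∅ h
      rwa [SigmaFunction.coeffVal_zero h] at this) fun _ _ _ => Mero.hasVal_one _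
  have h2 : (Sum.elim (fun i => δ * (((0 : Fin m → ℕ) i : ℕ) : ℂ))
      (fun j => if j ∈ (∅ : Finset (Fin r)) then -κ else 0)) = 0 := by
    ext (i | j) <;> simp
  rw [h1, h2, Mero.shift_zero, LinearMap.mulLeft_one]
  rfl

theorem opD_zero (hκ : ∀ n : ℕ, 0 < n → s (n * κ) ≠ 0) : opD s δ κ m r 0 = 1 := by
  rw [opD, deformedIndex_zero, Finset.sum_singleton]
  have h1 : deformedCoeff s (yVar m r) (xVar m r) (-κ) (-δ) 0 ∅ = 1 :=
    Mero.eq_of_hasVal_elim s δ κ (V := fun _ _ => 1) (fun x y h => by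
      have := hasVal_coeffD hκ 0 ∅ h
      rwa [SigmaFunction.coeffVal_zero h.swap] at this) fun _ _ _ => Mero.hasVal_one _
  have h2 : (Sum.elim (fun i => if i ∈ (∅ : Finset (Fin m)) then δ else 0)
      (fun j => -κ * (((0 : Fin r → ℕ) j : ℕ) : ℂ))) = 0 := by
    ext (i | j) <;> simp
  rw [h1, h2, Mero.shift_zero, LinearMap.mulLeft_one]
  rfl

/-- The shift of the variables belonging to the key `t` in a product of two operators
`D^{(k)}`. -/
noncomputable def shiftVec (δ κ : ℂ) (t : (Fin r → ℕ) × Finset (Fin m) × Finset (Fin m)) :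
    Fin m ⊕ Fin r → ℂ :=
  Sum.elim (fun i => (if i ∈ t.2.1 then δ else 0) + if i ∈ t.2.2 then δ else 0)
    (fun j => -κ * (t.1 j : ℂ))

/-- The shift of the variables belonging to the key `t` in a product `D^{(k)} H^{(l)}`. -/
noncomputable def wronskiVec (δ κ : ℂ) (t : (Fin m → ℕ) × (Fin r → ℕ)) : Fin m ⊕ Fin r → ℂ :=
  Sum.elim (fun i => δ * (t.1 i : ℂ)) (fun j => -κ * (t.2 j : ℂ))

theorem opD_mul_opD (k l : ℕ) : opD s δ κ m r k * opD s δ κ m r l =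
    ∑ p ∈ deformedIndex r m k ×ˢ deformedIndex r m l,
      Mero.op (deformedCoeff s (yVar m r) (xVar m r) (-κ) (-δ) p.1.1 p.1.2 *
        Mero.shift (Sum.elim (fun i => if i ∈ p.1.2 then δ else 0) (fun j => -κ * (p.1.1 j : ℂ)))
          (deformedCoeff s (yVar m r) (xVar m r) (-κ) (-δ) p.2.1 p.2.2))
        (shiftVec δ κ (SigmaFunction.shiftKey p.1 p.2)) := by
  refine (Mero.sum_op_mul_sum_op _ _ _ _ _ _).trans (Finset.sum_congr rfl fun p _ => ?_)
  congr 1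
  ext (i | j)
  · by_cases h1 : i ∈ p.1.2 <;> by_cases h2 : i ∈ p.2.2 <;>
      simp [shiftVec, SigmaFunction.shiftKey, h1, h2]
  · simp [shiftVec, SigmaFunction.shiftKey, mul_add]

theorem hasVal_opD_mul_opD (hκ : ∀ n : ℕ, 0 < n → s (n * κ) ≠ 0) {x : Fin m → ℂ} {y : Fin r → ℂ}
    (h : s.Generic δ κ (Sum.elim x y)) (k l : ℕ)
    (t : (Fin r → ℕ) × Finset (Fin m) × Finset (Fin m)) :
    Mero.HasVal (∑ p ∈ (deformedIndex r m k ×ˢ deformedIndex r m l).filter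
      (fun p => SigmaFunction.shiftKey p.1 p.2 = t),
      deformedCoeff s (yVar m r) (xVar m r) (-κ) (-δ) p.1.1 p.1.2 *
        Mero.shift (Sum.elim (fun i => if i ∈ p.1.2 then δ else 0) (fun j => -κ * (p.1.1 j : ℂ)))
          (deformedCoeff s (yVar m r) (xVar m r) (-κ) (-δ) p.2.1 p.2.2)) (Sum.elim x y)
      (s.shiftCoeff y x (-κ) (-δ) k l t) := by
  refine Mero.HasVal.sum fun p _ => (hasVal_coeffD hκ _ _ h).mul (Mero.HasVal.shift _ ?_)
  have h1 := hasVal_coeffD hκ p.2.1 p.2.2 (h.shift_right p.1.2 p.1.1)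
  convert h1 using 1
  · ext (i | j) <;> rfl
  · simp only [neg_neg]

/-- The operators `D^{(k)}` commute with each other. -/
theorem opD_commute (hκ : ∀ n : ℕ, 0 < n → s (n * κ) ≠ 0) (k l : ℕ) :
    Commute (opD s δ κ m r k) (opD s δ κ m r l) := by
  rw [Commute, SemiconjBy, opD_mul_opD, opD_mul_opD]
  refine Mero.sum_op_congr (shiftVec δ κ) fun t => ?_
  refine Mero.eq_of_hasVal_elim s δ κ (fun x y h => hasVal_opD_mul_opD hκ h k l t) fun x y h => ?_
  rw [SigmaFunction.shiftCoeff_comm h.swap (SigmaFunction.nat_mul_neg_ne_zero hκ) k l t]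
  exact hasVal_opD_mul_opD hκ h l k t

theorem opD_mul_opH (k l : ℕ) : opD s δ κ m r k * opH s δ κ m r l =
    ∑ p ∈ deformedIndex r m k ×ˢ deformedIndex m r l,
      Mero.op (deformedCoeff s (yVar m r) (xVar m r) (-κ) (-δ) p.1.1 p.1.2 *
        Mero.shift (Sum.elim (fun i => if i ∈ p.1.2 then δ else 0) (fun j => -κ * (p.1.1 j : ℂ)))
          (deformedCoeff s (xVar m r) (yVar m r) δ κ p.2.1 p.2.2))
        (wronskiVec δ κ (SigmaFunction.wronskiKey p.1 p.2)) := by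
  refine (Mero.sum_op_mul_sum_op _ _ _ _ _ _).trans (Finset.sum_congr rfl fun p _ => ?_)
  congr 1
  ext (i | j)
  · by_cases h1 : i ∈ p.1.2 <;> simp [wronskiVec, SigmaFunction.wronskiKey, h1]; ring
  · by_cases h1 : j ∈ p.2.2 <;> simp [wronskiVec, SigmaFunction.wronskiKey, h1]; ring

/-- The Wronski relation between the two families of operators. -/
theorem sum_smul_opD_mul_opH (hδ : ∀ n : ℕ, 0 < n → s (n * δ) ≠ 0)
    (hκ : ∀ n : ℕ, 0 < n → s (n * κ) ≠ 0) {K : ℕ} (hK : 0 < K) :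
    ∑ kl ∈ Finset.HasAntidiagonal.antidiagonal K, s (kl.1 * κ + kl.2 * δ) •
      (opD s δ κ m r kl.1 * opH s δ κ m r kl.2) = 0 := by
  simp only [opD_mul_opH, Finset.smul_sum, Mero.smul_op]
  rw [Finset.sum_sigma']
  refine (Mero.sum_op_congr (B := (∅ : Finset Unit)) (d := fun _ => 0)
    (key' := fun _ => (0, 0)) (wronskiVec δ κ) fun t => ?_).trans Finset.sum_empty
  rw [Finset.filter_empty, Finset.sum_empty]
  refine Mero.eq_zero_of_hasVal_elim s δ κ fun x y h => ?_
  have h0 := SigmaFunction.wronskiCoeff_eq_zero h hδ hκ hK t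
  rw [SigmaFunction.wronskiCoeff, Finset.sum_congr rfl fun kl _ => Finset.sum_filter _ _,
    Finset.sum_sigma', ← Finset.sum_filter] at h0
  refine (congrArg (Mero.HasVal _ _) h0).mp (Mero.HasVal.sum fun z _ => Mero.HasVal.smul _ ?_)
  refine (hasVal_coeffD hκ z.2.1.1 z.2.1.2 h).mul (Mero.HasVal.shift _ ?_)
  have h2 := hasVal_coeffH hδ z.2.2.1 z.2.2.2 (h.shift_right z.2.1.2 z.2.1.1)
  convert h2 using 1
  ext (i | j) <;> rfl

end DeformedOperators

theorem corollary2p5 (s : SigmaFunction) (δ κ : ℂ)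
    (hδ : ∀ n : ℕ, 0 < n → s.toFun (n * δ) ≠ 0)
    (hκ : ∀ n : ℕ, 0 < n → s.toFun (n * κ) ≠ 0)
    (m r : ℕ) :
    (∀ l : ℕ, opH s δ κ m r l ∈
      Algebra.adjoin ℂ {T | ∃ k : ℕ, 1 ≤ k ∧ k ≤ l ∧ T = opD s δ κ m r k}) ∧
    (∀ k l : ℕ, ⁅opD s δ κ m r k, opH s δ κ m r l⁆ = 0) := by
  have hmem : ∀ l : ℕ, opH s δ κ m r l ∈
      Algebra.adjoin ℂ {T | ∃ k : ℕ, 1 ≤ k ∧ k ≤ l ∧ T = opD s δ κ m r k} := by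
    intro l
    induction l using Nat.strong_induction_on with
    | _ l ih =>
    rcases Nat.eq_zero_or_pos l with rfl | hl
    · rw [opH_zero hδ]
      exact one_mem _
    -- the Wronski relation expresses `[l δ] H^{(l)}` through `H^{(l - k)}` with `1 ≤ k`
    have h := sum_smul_opD_mul_opH (m := m) (r := r) hδ hκ hl
    have h0 : ((0, l) : ℕ × ℕ) ∈ Finset.HasAntidiagonal.antidiagonal l := by simp
    rw [← Finset.add_sum_erase _ _ h0, opD_zero hκ, one_mul, Nat.cast_zero, zero_mul, zero_add,
      add_eq_zero_iff_eq_neg] at h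
    have hs := hδ l hl
    rw [← inv_smul_smul₀ hs (opH s δ κ m r l), h]
    refine Subalgebra.smul_mem _ (neg_mem (sum_mem fun kl hkl => ?_)) _
    rw [Finset.mem_erase, Finset.HasAntidiagonal.mem_antidiagonal] at hkl
    have hk : 1 ≤ kl.1 := by
      by_contra hk
      exact hkl.1 (Prod.ext (by simp; omega) (by simp; omega))
    refine Subalgebra.smul_mem _ (mul_mem (Algebra.subset_adjoin ?_) ?_) _
    · exact ⟨kl.1, hk, by omega, rfl⟩
    refine Algebra.adjoin_mono ?_ (ih kl.2 (by omega))
    rintro T ⟨k, hk1, hk2, rfl⟩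
    exact ⟨k, hk1, by omega, rfl⟩
  refine ⟨hmem, fun k l => ?_⟩
  have hle : Algebra.adjoin ℂ {T | ∃ k : ℕ, 1 ≤ k ∧ k ≤ l ∧ T = opD s δ κ m r k} ≤
      Subalgebra.centralizer ℂ {opD s δ κ m r k} := by
    refine Algebra.adjoin_le ?_
    rintro T ⟨k', -, -, rfl⟩
    rw [SetLike.mem_coe, Subalgebra.mem_centralizer_iff]
    rintro _ rfl
    exact opD_commute hκ k k'
  rw [Ring.lie_def, sub_eq_zero]
  exact (Subalgebra.mem_centralizer_iff ℂ).1 (hle (hmem l)) _ rfl
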